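/- Let $\pi:Q\to M$ be a smooth principal $G$-bundle over a smooth (finite-dimensional, Hausdorff) manifold $M$, with $G$ a Lie group acting on $Q$ from the right. A connection on $Q$ is a smooth $G$-invariant distribution $\mathcal H$ on $Q$ complementary to the vertical distribution $\ker d\pi$; it is flat if its curvature $\Omega(X,Y)=-[X^{\mathrm{hor}},Y^{\mathrm{hor}}]^{\mathrm{ver}}$ vanishes for all smooth vector fields $X,Y$ on $Q$. A path is a piecewise smooth map $\gamma:[a,b]\to M$, $a<b$. A smooth family of paths parametrized by a finite-dimensional manifold $S$ is a family $\gamma_s:[a,b]\to M$ for which there is a subdivision of $[a,b]$, independent of $s$, such that $(s,t)\mapsto\gamma_s(t)$ is smooth on $S\times[c,d]$ for each subinterval $[c,d]$ of the subdivision. A parallel transport map $P$ on $Q$ assigns to every path $\gamma:[a,b]\to M$ a $G$-equivariant map $P(\gamma):Q_{\gamma(a)}\to Q_{\gamma(b)}$ such that (1) $P(\gamma)$ is the identity if $\gamma$ is constant; (2) $P(\gamma\circ\alpha)=P(\gamma)$ for every orientation-preserving diffeomorphism $\alpha$ of closed intervals; (3) $P(\gamma_2\star\gamma_1)=P(\gamma_2)\circ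 P(\gamma_1)$ for the juxtaposition $\gamma_2\star\gamma_1$ ($\gamma_1$ followed by $\gamma_2$); and (4) $P$ is smooth: for every smooth family of paths $(\gamma_s)_{s\in S}$ and every smooth map $\sigma:S\to Q$ with $\sigma(s)\in Q_{\gamma_s(a)}$, the map $s\mapsto P(\gamma_s)(\sigma(s))$ is smooth. It is homotopy-invariant if $P(\gamma_0)=P(\gamma_1)$ whenever $\gamma_0,\gamma_1:[a,b]\to M$ have the same end points and are joined by a deformation $K:[0,1]\times[a,b]\to M$ with fixed end points which is smooth on $[0,1]\times[c,d]$ for each subinterval $[c,d]$ of some subdivision of $[a,b]$. A connection $\mathcal H$ has parallel transport $P$ if, for every path $\gamma:[a,b]\to M$ and $q\in Q_{\gamma(a)}$, $P(\gamma)(q)$ is the end point of an $\mathcal H$-horizontal piecewise smooth lift of $\gamma$ starting at $q$. Then there is a natural bijection $\Phi$ from the set of flat connections on $Q$ onto the set of homotopy-invariant parallel transport maps on $Q$. Natural means: for a flat connection $\mathcal H$, $\Phi(\mathcal H)$ is the one and only parallel transport map which is the parallel transport of $\mathcal H$; and for a homotopy-invariant parallel transport map $P$, $\Phi^{-1}(P)$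 is the one and only connection (flat or not) whose parallel transport is $P$. In particular the parallel transport of a flat connection is homotopy-invariant, and a connection whose parallel transport is homotopy-invariant is flat. -/

import Mathlib

open scoped Manifold ContDiff RightActions
open Set

noncomputable section

namespace PrincipalTransport

/-! ### Principal bundles -/

section Bundle

variable (EM : Type*) [NormedAddCommGroup EM] [NormedSpace ℝ EM]
  {M : Type*} [TopologicalSpace M] [ChartedSpace EM M]
  (EG : Type*) [NormedAddCommGroup EG] [NormedSpace ℝ EG]
  (G : Type*) [Group G] [TopologicalSpace G] [ChartedSpace EG G]
  (EQ : Type*) [NormedAddCommGroup EQ] [NormedSpace ℝ EQ]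
  {Q : Type*} [TopologicalSpace Q] [ChartedSpace EQ Q] [MulAction Gᵐᵒᵖ Q]

/-- `π : Q → M` is a smooth principal `G`-bundle for the right action `q <• g` of `G` on `Q`:
the action preserves the fibres of `π`, and around every point of `M` there is a smooth local
trivialization `π⁻¹ U ≃ U × G` which is equivariant for right multiplication on `G`.
(Smoothness of `π` and of the action, and simple transitivity on the fibres, follow.) -/
structure IsPrincipalBundle (π : Q → M) : Prop where
  proj_act : ∀ (q : Q) (g : G), π (q <• g) = π q
  locally_trivial : ∀ x : M, ∃ e : Bundle.Trivialization G π, x ∈ e.baseSet ∧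
    ContMDiffOn 𝓘(ℝ, EQ) (𝓘(ℝ, EM).prod 𝓘(ℝ, EG)) ∞ e e.source ∧
    ContMDiffOn (𝓘(ℝ, EM).prod 𝓘(ℝ, EG)) 𝓘(ℝ, EQ) ∞ e.toOpenPartialHomeomorph.symm e.target ∧
    ∀ q ∈ e.source, ∀ g : G, e (q <• g) = ((e q).1, (e q).2 * g)

end Bundle

/-! ### Connections and curvature -/

section Connection

variable (EM : Type*) [NormedAddCommGroup EM] [NormedSpace ℝ EM]
  {M : Type*} [TopologicalSpace M] [ChartedSpace EM M]
  (G : Type*) [Group G]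
  (EQ : Type*) [NormedAddCommGroup EQ] [NormedSpace ℝ EQ]
  {Q : Type*} [TopologicalSpace Q] [ChartedSpace EQ Q] [IsManifold 𝓘(ℝ, EQ) ∞ Q]
  [MulAction Gᵐᵒᵖ Q]

/-- The vertical space at `p`: the tangent space to the fibre of `π` through `p`. -/
def verticalSpace (π : Q → M) (p : Q) : Submodule ℝ (TangentSpace 𝓘(ℝ, EQ) p) :=
  LinearMap.ker (mfderiv 𝓘(ℝ, EQ) 𝓘(ℝ, EM) π p).toLinearMap

variable {EQ} in
/-- Smoothness, on a set `U`, of a vector field on `Q`. -/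
def SmoothFieldOn (X : ∀ p : Q, TangentSpace 𝓘(ℝ, EQ) p) (U : Set Q) : Prop :=
  ContMDiffOn 𝓘(ℝ, EQ) 𝓘(ℝ, EQ).tangent ∞
    (fun p => (⟨p, X p⟩ : TangentBundle 𝓘(ℝ, EQ) Q)) U

variable {EQ} in
/-- The component along `A` of a vector field, for a pointwise splitting `T_p Q = A p ⊕ B p`. -/
def component (A B : ∀ p : Q, Submodule ℝ (TangentSpace 𝓘(ℝ, EQ) p))
    (hAB : ∀ p, IsCompl (A p) (B p)) (X : ∀ p : Q, TangentSpace 𝓘(ℝ, EQ) p) (p : Q) :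
    TangentSpace 𝓘(ℝ, EQ) p :=
  (((A p).projectionOnto (B p) (hAB p) (X p) : A p) : TangentSpace 𝓘(ℝ, EQ) p)

/-- A connection on `π : Q → M`: a smooth `G`-invariant distribution on `Q` complementary to the
vertical distribution. Smoothness of the distribution means that the horizontal component of
every smooth vector field (defined on an open set) is smooth. -/
@[ext]
structure Connection (π : Q → M) where
  hor : ∀ p : Q, Submodule ℝ (TangentSpace 𝓘(ℝ, EQ) p)
  isCompl : ∀ p, IsCompl (hor p) (verticalSpace EM EQ π p)
  invariant : ∀ (p : Q) (g : G), hor (p <• g) =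
    (hor p).map (mfderiv 𝓘(ℝ, EQ) 𝓘(ℝ, EQ) (fun q : Q => q <• g) p).toLinearMap
  smooth : ∀ (U : Set Q), IsOpen U → ∀ X : (∀ p : Q, TangentSpace 𝓘(ℝ, EQ) p),
    SmoothFieldOn X U → SmoothFieldOn (component hor (verticalSpace EM EQ π) isCompl X) U

variable {EM G EQ}

/-- The horizontal component of a vector field on `Q`. -/
def Connection.horizontalPart {π : Q → M} (H : Connection EM G EQ π)
    (X : ∀ p : Q, TangentSpace 𝓘(ℝ, EQ) p) : ∀ p : Q, TangentSpace 𝓘(ℝ, EQ) p :=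
  component H.hor (verticalSpace EM EQ π) H.isCompl X

/-- The vertical component of a vector field on `Q`. -/
def Connection.verticalPart {π : Q → M} (H : Connection EM G EQ π)
    (X : ∀ p : Q, TangentSpace 𝓘(ℝ, EQ) p) : ∀ p : Q, TangentSpace 𝓘(ℝ, EQ) p :=
  component (verticalSpace EM EQ π) H.hor (fun p => (H.isCompl p).symm) X

/-- The curvature of a connection evaluated on two vector fields on `Q`, with values in the
vertical bundle (whose fibres are identified with the Lie algebra of `G` by the action):
`Ω(X, Y) = -[X^hor, Y^hor]^ver`. -/
def Connection.curvature {π : Q → M} (H : Connection EM G EQ π)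
    (X Y : ∀ p : Q, TangentSpace 𝓘(ℝ, EQ) p) (p : Q) : TangentSpace 𝓘(ℝ, EQ) p :=
  -H.verticalPart
    (VectorField.mlieBracket 𝓘(ℝ, EQ) (H.horizontalPart X) (H.horizontalPart Y)) p

/-- A connection is flat if its curvature vanishes. -/
def Connection.IsFlat {π : Q → M} (H : Connection EM G EQ π) : Prop :=
  ∀ X Y : (∀ p : Q, TangentSpace 𝓘(ℝ, EQ) p), SmoothFieldOn X univ → SmoothFieldOn Y univ →
    ∀ p, H.curvature X Y p = 0

end Connection

/-! ### Piecewise smooth paths -/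

section Paths

/-- A piecewise smooth path `[a, b] → M` with `a < b`: there is a finite set `F` of break points
such that the path is smooth on every closed subinterval without break points in its interior.
In order that a path be determined by its restriction to `[a, b]`, it is extended to `ℝ` by its
end values. -/
structure PSPath (EM : Type*) [NormedAddCommGroup EM] [NormedSpace ℝ EM]
    (M : Type*) [TopologicalSpace M] [ChartedSpace EM M] where
  a : ℝ
  b : ℝ
  lt : a < b
  toFun : ℝ → M
  eq_left : ∀ t ≤ a, toFun t = toFun a
  eq_right : ∀ t, b ≤ t → toFun t = toFun b
  piecewise_smooth : ∃ F : Finset ℝ, ∀ c d : ℝ, a ≤ c → c < d → d ≤ b →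
    Disjoint (F : Set ℝ) (Ioo c d) → ContMDiffOn 𝓘(ℝ, ℝ) 𝓘(ℝ, EM) ∞ toFun (Icc c d)

variable {EM : Type*} [NormedAddCommGroup EM] [NormedSpace ℝ EM]
  {M : Type*} [TopologicalSpace M] [ChartedSpace EM M]

instance : CoeFun (PSPath EM M) (fun _ => ℝ → M) := ⟨PSPath.toFun⟩

namespace PSPath

/-- The starting point of a path. -/
def start (γ : PSPath EM M) : M := γ γ.a

/-- The ending point of a path. -/
def finish (γ : PSPath EM M) : M := γ γ.b

/-- The path is constant. -/
def IsConstant (γ : PSPath EM M) : Prop := ∀ t ∈ Icc γ.a γ.b, γ t = γ γ.a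

/-- `γ' = γ ∘ α` for some orientation-preserving diffeomorphism `α`, with inverse `β`, from the
interval of `γ'` onto the interval of `γ`. -/
def IsReparametrization (γ' γ : PSPath EM M) : Prop :=
  ∃ α β : ℝ → ℝ,
    MapsTo α (Icc γ'.a γ'.b) (Icc γ.a γ.b) ∧ MapsTo β (Icc γ.a γ.b) (Icc γ'.a γ'.b) ∧
    InvOn β α (Icc γ'.a γ'.b) (Icc γ.a γ.b) ∧
    ContDiffOn ℝ ∞ α (Icc γ'.a γ'.b) ∧ ContDiffOn ℝ ∞ β (Icc γ.a γ.b) ∧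
    StrictMonoOn α (Icc γ'.a γ'.b) ∧
    ∀ t ∈ Icc γ'.a γ'.b, γ' t = γ (α t)

/-- `γ` is the juxtaposition `γ₂ ⋆ γ₁`: first `γ₁`, then `γ₂` (its interval being translated so
that it begins where the interval of `γ₁` ends). This forces `γ₁` to end where `γ₂` starts. -/
def IsJuxtaposition (γ γ₂ γ₁ : PSPath EM M) : Prop :=
  γ.a = γ₁.a ∧ γ.b = γ₁.b + (γ₂.b - γ₂.a) ∧
  (∀ t ∈ Icc γ₁.a γ₁.b, γ t = γ₁ t) ∧
  (∀ t ∈ Icc γ₂.a γ₂.b, γ (γ₁.b + (t - γ₂.a)) = γ₂ t)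

/-- Two paths on the same interval `[a, b]`, with the same end points, are smoothly homotopic
if there is a deformation `K : [0, 1] × [a, b] → M` from one to the other which fixes the end
points and is smooth on `[0, 1] × [c, d]` whenever `(c, d)` avoids a fixed finite set of break
points. -/
def SmoothlyHomotopic (γ₀ γ₁ : PSPath EM M) : Prop :=
  γ₁.a = γ₀.a ∧ γ₁.b = γ₀.b ∧ ∃ K : ℝ × ℝ → M,
    (∀ t ∈ Icc γ₀.a γ₀.b, K (0, t) = γ₀ t) ∧
    (∀ t ∈ Icc γ₀.a γ₀.b, K (1, t) = γ₁ t) ∧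
    (∀ s ∈ Icc (0 : ℝ) 1, K (s, γ₀.a) = γ₀.start ∧ K (s, γ₀.b) = γ₀.finish) ∧
    ∃ F : Finset ℝ, ∀ c d : ℝ, γ₀.a ≤ c → c < d → d ≤ γ₀.b →
      Disjoint (F : Set ℝ) (Ioo c d) →
      ContMDiffOn (𝓘(ℝ, ℝ).prod 𝓘(ℝ, ℝ)) 𝓘(ℝ, EM) ∞ K (Icc (0 : ℝ) 1 ×ˢ Icc c d)

/-- A smooth family of paths parametrized by the `n`-dimensional manifold `S`: the paths have a
common interval `[a, b]` and common break points, and the family is smooth on `S × [c, d]`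
whenever `(c, d)` contains no break point. -/
def IsSmoothFamily {n : ℕ} {S : Type*} [TopologicalSpace S]
    [ChartedSpace (EuclideanSpace ℝ (Fin n)) S] (γ : S → PSPath EM M) : Prop :=
  ∃ (a b : ℝ) (F : Finset ℝ), (∀ s, (γ s).a = a ∧ (γ s).b = b) ∧
    ∀ c d : ℝ, a ≤ c → c < d → d ≤ b → Disjoint (F : Set ℝ) (Ioo c d) →
      ContMDiffOn ((𝓡 n).prod 𝓘(ℝ, ℝ)) 𝓘(ℝ, EM) ∞ (fun z : S × ℝ => γ z.1 z.2)
        ((univ : Set S) ×ˢ Icc c d)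

end PSPath

end Paths

/-! ### Parallel transport -/

section Transport

variable (EM : Type*) [NormedAddCommGroup EM] [NormedSpace ℝ EM]
  {M : Type*} [TopologicalSpace M] [ChartedSpace EM M]
  (G : Type*) [Group G]
  (EQ : Type*) [NormedAddCommGroup EQ] [NormedSpace ℝ EQ]
  {Q : Type*} [TopologicalSpace Q] [ChartedSpace EQ Q] [IsManifold 𝓘(ℝ, EQ) ∞ Q]
  [MulAction Gᵐᵒᵖ Q]

/-- The fibre `Q_x`. -/
abbrev Fibre (π : Q → M) (x : M) : Type _ := {q : Q // π q = x}

/-- A parallel transport map associated to `π : Q → M`. It assigns to every piecewise smooth path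
`γ` in `M` a `G`-map from the fibre over the start of `γ` to the fibre over its end, is the
identity on constant paths, is invariant under orientation-preserving reparametrization, is
compatible with juxtaposition, and is smooth: for every smooth family `γ s` of paths,
parametrized by a finite-dimensional manifold `S`, the `G`-maps `P (γ s)` form a smooth family,
that is, they map smooth families of points `σ s` of the initial fibres to smooth families. -/
@[ext]
structure ParallelTransport (π : Q → M) where
  toFun : ∀ γ : PSPath EM M, Fibre π γ.start → Fibre π γ.finish
  equivariant : ∀ (γ : PSPath EM M) (q q' : Fibre π γ.start) (g : G),
    (q' : Q) = (q : Q) <• g → (toFun γ q' : Q) = (toFun γ q : Q) <• g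
  constant : ∀ (γ : PSPath EM M), γ.IsConstant → ∀ q, (toFun γ q : Q) = q
  reparametrization : ∀ γ' γ : PSPath EM M, γ'.IsReparametrization γ →
    ∀ (q : Q) (h' : π q = γ'.start) (h : π q = γ.start),
      (toFun γ' ⟨q, h'⟩ : Q) = toFun γ ⟨q, h⟩
  juxtaposition : ∀ γ γ₂ γ₁ : PSPath EM M, γ.IsJuxtaposition γ₂ γ₁ →
    ∀ (q : Q) (h : π q = γ.start) (h₁ : π q = γ₁.start)
      (h₂ : π (toFun γ₁ ⟨q, h₁⟩ : Q) = γ₂.start),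
      (toFun γ ⟨q, h⟩ : Q) = toFun γ₂ ⟨toFun γ₁ ⟨q, h₁⟩, h₂⟩
  smooth : ∀ (n : ℕ) (S : Type) [TopologicalSpace S] [T2Space S] [SecondCountableTopology S]
    [ChartedSpace (EuclideanSpace ℝ (Fin n)) S] [IsManifold (𝓡 n) ∞ S]
    (γ : S → PSPath EM M), PSPath.IsSmoothFamily (n := n) γ →
    ∀ (σ : S → Q) (hσ : ∀ s, π (σ s) = (γ s).start),
      ContMDiff (𝓡 n) 𝓘(ℝ, EQ) ∞ σ →
      ContMDiff (𝓡 n) 𝓘(ℝ, EQ) ∞ (fun s => (toFun (γ s) ⟨σ s, hσ s⟩ : Q))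

variable {EM G EQ}

/-- Homotopy invariance: smoothly homotopic paths with the same end points have the same
transport. -/
def ParallelTransport.HomotopyInvariant {π : Q → M} (P : ParallelTransport EM G EQ π) : Prop :=
  ∀ γ₀ γ₁ : PSPath EM M, γ₀.SmoothlyHomotopic γ₁ →
    ∀ (q : Q) (h₀ : π q = γ₀.start) (h₁ : π q = γ₁.start),
      (P.toFun γ₀ ⟨q, h₀⟩ : Q) = P.toFun γ₁ ⟨q, h₁⟩

/-- The piecewise smooth path `δ` in `Q` is a horizontal lift of the path `γ` in `M`. -/
def Connection.IsHorizontalLift {π : Q → M} (H : Connection EM G EQ π)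
    (γ : PSPath EM M) (δ : PSPath EQ Q) : Prop :=
  δ.a = γ.a ∧ δ.b = γ.b ∧ (∀ t ∈ Icc γ.a γ.b, π (δ t) = γ t) ∧
  ∀ t ∈ Ioo γ.a γ.b, MDifferentiableAt 𝓘(ℝ, ℝ) 𝓘(ℝ, EQ) δ t →
    mfderiv 𝓘(ℝ, ℝ) 𝓘(ℝ, EQ) δ t (1 : ℝ) ∈ H.hor (δ t)

/-- `P` is the parallel transport of the connection `H`: the transport of `q` along `γ` is the
end point of a horizontal lift of `γ` starting at `q`. -/
def Connection.HasParallelTransport {π : Q → M} (H : Connection EM G EQ π)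
    (P : ParallelTransport EM G EQ π) : Prop :=
  ∀ (γ : PSPath EM M) (q : Fibre π γ.start), ∃ δ : PSPath EQ Q,
    H.IsHorizontalLift γ δ ∧ δ.start = q ∧ δ.finish = P.toFun γ q

end Transport

end PrincipalTransport

end

/-!
Everything rests on local horizontal sections. A connection has local horizontal sections through
every point of `Q` if and only if it is flat. One direction is Frobenius' theorem
(`Connection.IsFlat.hasFlatSections`): in charts, a horizontal section solves a total differential
equation `du = h(u)`, whose integrability condition says that the horizontal lifts of coordinate
fields commute (`Connection.IsFlat.fderiv_lift_symm`), and which is solved along rays from a point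
(`exists_solution_total_differential_equation`). Conversely
(`Connection.HasFlatSections.isFlat`), the fibre coordinate `c` relative to a horizontal section
`s`, defined by `q = s (π q) <• c q`, has the horizontal vectors as kernel of its derivative, and this
kernel is closed under Lie brackets.

Two horizontal curves over the same curve in `M` differ by a constant element of `G`, because the
action is infinitesimally free (`IsPrincipalBundle.div_eq_of_horizontal`). So horizontal lifts are
unique, a connection has at most one parallel transport (`Connection.HasParallelTransport.unique`),
and local horizontal sections through the same point agree near it.

From a flat connection to a transport: the local horizontal sections define a finer topology on `Q`,
the leaf topology, for which `π` is a covering map (`Connection.HasFlatSections.isCoveringMap`). The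
horizontal lifts of paths are the lifts to this covering, and transport is its monodromy
(`Connection.HasFlatSections.parallelTransport`). Lifting a homotopy, a map from the plane, gives
homotopy invariance; lifting a family of paths, locally a map from `ℝⁿ × ℝ`, gives smoothness.

From a homotopy-invariant transport `P` to a connection: transporting a point of `Q` along the rays
of a coordinate domain gives a smooth section, and homotopy invariance makes it parallel along all
paths in the domain (`ParallelTransport.HomotopyInvariant.exists_isParallelSection`). Parallel
sections through the same point agree near it, so their tangent spaces define an invariant
distribution, the connection `ParallelTransport.HomotopyInvariant.connection`. It has the parallel
sections as local horizontal sections, so it is flat, and its transport is `P`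
(`ParallelTransport.HomotopyInvariant.hasParallelTransport_connection`). If any connection has
transport `P`, its horizontal lifts of curves follow the parallel sections, whose tangent spaces are
therefore horizontal; as both families of horizontal spaces are complements of the vertical spaces,
the connection is the one just defined
(`ParallelTransport.HomotopyInvariant.eq_connection`).
-/

namespace PrincipalTransport

/-! ### Total differential equations -/

section Frobenius

open Metric ODE
open scoped NNReal Topology

/-- The Picard–Lindelöf theorem together with the information, needed for estimates, that the
solution stays in the ball on which the hypotheses hold. -/
theorem exists_solution_mem_closedBall {F : Type*} [NormedAddCommGroup F] [NormedSpace ℝ F]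
    [CompleteSpace F] {f : ℝ → F → F} {tmin tmax : ℝ} {t₀ : Icc tmin tmax} {x₀ x : F}
    {a r L K : ℝ≥0} (hf : IsPicardLindelof f t₀ x₀ a r L K) (hx : x ∈ closedBall x₀ r) :
    ∃ α : ℝ → F, α t₀ = x ∧ (∀ t, α t ∈ closedBall x₀ a) ∧
      ∀ t ∈ Icc tmin tmax, HasDerivWithinAt α (f t (α t)) (Icc tmin tmax) t := by
  obtain ⟨α, hα⟩ := FunSpace.exists_isFixedPt_next hf hx
  refine ⟨α.compProj, by rw [FunSpace.compProj_val, ← hα, FunSpace.next_apply₀],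
    fun t => α.compProj_mem_closedBall hf.mul_max_le, fun t ht ↦ ?_⟩
  apply hasDerivWithinAt_picard_Icc t₀.2 hf.continuousOn_uncurry
    α.continuous_compProj.continuousOn (fun _ ht' ↦ α.compProj_mem_closedBall hf.mul_max_le)
    x ht |>.congr_of_mem _ ht
  intro t' ht'
  nth_rw 1 [← hα]
  rw [FunSpace.compProj_of_mem ht', FunSpace.next_apply]

variable {E F : Type*} [NormedAddCommGroup E] [NormedSpace ℝ E]
  [NormedAddCommGroup F] [NormedSpace ℝ F]

/-- A `C²` map satisfies a uniform second order Taylor estimate near a point. -/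
theorem exists_closedBall_taylor_estimate {W : Type*} [NormedAddCommGroup W] [NormedSpace ℝ W]
    {h : F → W} {V : Set F} (hV : IsOpen V) (hh : ContDiffOn ℝ 2 h V) {y₀ : F} (hy₀ : y₀ ∈ V) :
    ∃ R > 0, ∃ B : ℝ≥0, closedBall y₀ R ⊆ V ∧
      (∀ y ∈ closedBall y₀ R, ‖h y‖ ≤ B) ∧ (∀ y ∈ closedBall y₀ R, ‖fderiv ℝ h y‖ ≤ B) ∧
      LipschitzOnWith B h (closedBall y₀ R) ∧
      ∀ y ∈ closedBall y₀ R, ∀ k, y + k ∈ closedBall y₀ R →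
        ‖h (y + k) - h y - fderiv ℝ h y k‖ ≤ B * ‖k‖ ^ 2 := by
  have h0 : ContDiffAt ℝ 2 h y₀ := hh.contDiffAt (hV.mem_nhds hy₀)
  have h1 : ContDiffAt ℝ 1 (fderiv ℝ h) y₀ := h0.fderiv_right (by norm_num)
  obtain ⟨K, s, hs, hK⟩ := h1.exists_lipschitzOnWith
  have e1 : ∀ᶠ y in 𝓝 y₀, ‖h y‖ < ‖h y₀‖ + 1 :=
    h0.continuousAt.norm.eventually_lt continuousAt_const (by simp)
  have e2 : ∀ᶠ y in 𝓝 y₀, ‖fderiv ℝ h y‖ < ‖fderiv ℝ h y₀‖ + 1 :=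
    h1.continuousAt.norm.eventually_lt continuousAt_const (by simp)
  obtain ⟨R, hR, hball⟩ := nhds_basis_closedBall.mem_iff.1
    (Filter.inter_mem (Filter.inter_mem (hV.mem_nhds hy₀) hs) (Filter.inter_mem e1 e2))
  set B : ℝ≥0 := ‖h y₀‖₊ + 1 + (‖fderiv ℝ h y₀‖₊ + 1) + K with hB
  have hB1 : ‖h y₀‖ + 1 ≤ B := by
    rw [hB]; push_cast; have := norm_nonneg (fderiv ℝ h y₀); have := K.2; simp; linarith
  have hB2 : ‖fderiv ℝ h y₀‖ + 1 ≤ B := by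
    rw [hB]; push_cast; have := norm_nonneg (h y₀); have := K.2; simp; linarith
  have hB3 : (K : ℝ) ≤ B := by
    rw [hB]; push_cast
    have := norm_nonneg (fderiv ℝ h y₀); have := norm_nonneg (h y₀); simp; linarith
  have hd : ∀ y ∈ closedBall y₀ R, DifferentiableAt ℝ h y := fun y hy =>
    (hh.contDiffAt (hV.mem_nhds (hball hy).1.1)).differentiableAt (by norm_num)
  have hbd : ∀ y ∈ closedBall y₀ R, ‖fderiv ℝ h y‖ ≤ B := fun y hy =>
    (le_of_lt (hball hy).2.2).trans hB2
  refine ⟨R, hR, B, fun y hy => (hball hy).1.1, fun y hy => (le_of_lt (hball hy).2.1).trans hB1,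
    hbd, ?_, ?_⟩
  · exact (convex_closedBall y₀ R).lipschitzOnWith_of_nnnorm_fderiv_le hd hbd
  · intro y hy k hyk
    have hseg : segment ℝ y (y + k) ⊆ closedBall y₀ R :=
      (convex_closedBall y₀ R).segment_subset hy hyk
    have := (convex_segment y (y + k)).norm_image_sub_le_of_norm_hasFDerivWithin_le'
      (f := h) (f' := fderiv ℝ h) (φ := fderiv ℝ h y) (C := B * ‖k‖)
      (fun z hz => (hd z (hseg hz)).hasFDerivAt.hasFDerivWithinAt) ?_
      (left_mem_segment ℝ y (y + k)) (right_mem_segment ℝ y (y + k))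
    · simpa [pow_two, mul_assoc] using this
    · intro z hz
      calc ‖fderiv ℝ h z - fderiv ℝ h y‖ ≤ K * ‖z - y‖ := by
            simpa [dist_eq_norm] using hK.dist_le_mul z (hball (hseg hz)).1.2 y (hball hy).1.2
        _ ≤ B * ‖k‖ := by
            gcongr
            obtain ⟨θ, hθ, rfl⟩ := (segment_eq_image' ℝ y (y + k)).subset hz
            simp only [add_sub_cancel_left, norm_smul, Real.norm_eq_abs, abs_of_nonneg hθ.1]
            exact mul_le_of_le_one_left (norm_nonneg _) hθ.2

/-- The Frobenius theorem for total differential equations `u'(x) = h(u(x))`: if the integrability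
condition `Dh(y)(h(y)a) b = Dh(y)(h(y)b) a` holds, there is a solution with given value at `0`.
The solution `u(x)` is the value at time `1` of the solution of the ordinary differential equation
`α' = h(α) x`; if `α` is the solution for `x`, then by integrability `α(t) + h(α(t))(t k)` solves
the equation for `x + k` up to an error of order `‖k‖²`, so that `u` has derivative `h(u(x))` by
Grönwall's inequality. -/
theorem exists_solution_total_differential_equation [CompleteSpace F] {h : F → E →L[ℝ] F}
    {V : Set F} (hV : IsOpen V) (hh : ContDiffOn ℝ ∞ h V)
    (hsymm : ∀ y ∈ V, ∀ a b, fderiv ℝ h y (h y a) b = fderiv ℝ h y (h y b) a)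
    {y₀ : F} (hy₀ : y₀ ∈ V) :
    ∃ ε > 0, ∃ u : E → F, u 0 = y₀ ∧ MapsTo u (ball 0 ε) V ∧ ContDiffOn ℝ ∞ u (ball 0 ε) ∧
      ∀ x ∈ ball (0 : E) ε, HasFDerivAt u (h (u x)) x := by
  obtain ⟨R, hR, B, hRV, hb, hb', hlip, htay⟩ :=
    exists_closedBall_taylor_estimate hV (hh.of_le (by norm_cast)) hy₀
  have hB0 : (0 : ℝ) ≤ B := B.2
  have hB1 : (0 : ℝ) < B + 1 := by positivity
  -- the solutions for `‖x‖ ≤ ε` move by at most `R / 2`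
  set ε : ℝ := min 1 (R / 2 / (B + 1)) with hε
  have hε0 : 0 < ε := by positivity
  have hε1 : ε ≤ 1 := min_le_left _ _
  have hεB : B * ε ≤ R / 2 := by
    calc B * ε ≤ (B + 1) * (R / 2 / (B + 1)) := by
          gcongr
          · linarith
          · exact min_le_right _ _
      _ = R / 2 := by field_simp
  have key : ∀ x : E, ∃ α : ℝ → F, x ∈ ball (0 : E) ε → α 0 = y₀ ∧
      (∀ t, α t ∈ closedBall y₀ (R / 2)) ∧
      ∀ t ∈ Icc (0 : ℝ) 1, HasDerivWithinAt α (h (α t) x) (Icc 0 1) t := by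
    intro x
    by_cases hx : x ∈ ball (0 : E) ε
    swap
    · exact ⟨0, fun h => absurd h hx⟩
    rw [mem_ball_zero_iff] at hx
    have hsub : closedBall y₀ (R / 2) ⊆ closedBall y₀ R :=
      closedBall_subset_closedBall (by linarith)
    have hPL : IsPicardLindelof (fun _ y => h y x) (⟨0, by simp⟩ : Icc (0 : ℝ) 1) y₀
        ⟨R / 2, by positivity⟩ 0 (B * ⟨ε, hε0.le⟩) B := by
      refine IsPicardLindelof.of_time_independent (fun y hy => ?_) ?_ ?_
      · calc ‖h y x‖ ≤ ‖h y‖ * ‖x‖ := (h y).le_opNorm x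
          _ ≤ B * ε := by
            gcongr
            exact hb y (hsub hy)
      · refine LipschitzOnWith.of_dist_le_mul fun y hy z hz => ?_
        rw [dist_eq_norm, ← sub_apply]
        calc ‖(h y - h z) x‖ ≤ ‖h y - h z‖ * ‖x‖ := ContinuousLinearMap.le_opNorm _ x
          _ ≤ (B * dist y z) * 1 := by
            gcongr
            · rw [← dist_eq_norm]
              exact hlip.dist_le_mul y (hsub hy) z (hsub hz)
            · linarith
          _ = B * dist y z := mul_one _
      · simp
        exact hεB
    obtain ⟨α, h1, h2, h3⟩ := exists_solution_mem_closedBall hPL (x := y₀) (by simp)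
    exact ⟨α, fun _ => ⟨h1, h2, h3⟩⟩
  choose α hα using key
  set u : E → F := fun x => α x 1 with hu
  have hubd : ∀ x ∈ ball (0 : E) ε, u x ∈ closedBall y₀ (R / 2) := fun x hx => (hα x hx).2.1 1
  have hhalf : closedBall y₀ (R / 2) ⊆ closedBall y₀ R := closedBall_subset_closedBall (by linarith)
  have hdh : ∀ y ∈ closedBall y₀ R, HasFDerivAt h (fderiv ℝ h y) y := fun y hy =>
    ((hh.contDiffAt (hV.mem_nhds (hRV hy))).differentiableAt (by simp)).hasFDerivAt
  have hderiv : ∀ x ∈ ball (0 : E) ε, HasFDerivAt u (h (u x)) x := by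
    intro x hx
    set C : ℝ := B ^ 2 + B ^ 3 with hC
    -- the second order estimate given by Grönwall's inequality
    have hest : ∀ k : E, x + k ∈ ball (0 : E) ε → B * ‖k‖ ≤ R / 2 →
        ‖u (x + k) - u x - h (u x) k‖ ≤ gronwallBound 0 B 1 1 * C * ‖k‖ ^ 2 := by
      intro k hxk hk
      obtain ⟨a0, am, ad⟩ := hα x hx
      obtain ⟨c0, cm, cd⟩ := hα (x + k) hxk
      have hxk1 : ‖x + k‖ ≤ 1 := by rw [mem_ball_zero_iff] at hxk; linarith
      set a := α x
      set c := α (x + k)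
      -- the candidate for the solution `c`, an approximate solution up to an error `C * ‖k‖ ^ 2`
      set b : ℝ → F := fun t => a t + t • h (a t) k with hbdef
      have hbm : ∀ t ∈ Icc (0 : ℝ) 1, b t ∈ closedBall y₀ R := by
        intro t ht
        rw [mem_closedBall, dist_eq_norm]
        calc ‖b t - y₀‖ = ‖(a t - y₀) + t • h (a t) k‖ := by
              rw [add_sub_right_comm]
          _ ≤ ‖a t - y₀‖ + ‖t • h (a t) k‖ := norm_add_le _ _
          _ ≤ R / 2 + 1 * (B * ‖k‖) := by
            gcongr
            · rw [← dist_eq_norm]; exact am t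
            · rw [norm_smul, Real.norm_eq_abs, abs_of_nonneg ht.1]
              gcongr
              · exact ht.2
              · exact ((h (a t)).le_opNorm k).trans (by gcongr; exact hb _ (hhalf (am t)))
          _ ≤ R := by linarith
      set b' : ℝ → F := fun t => h (a t) x +
        (t • fderiv ℝ h (a t) (h (a t) x) k + h (a t) k) with hb'def
      have hbd' : ∀ t ∈ Icc (0 : ℝ) 1, HasDerivWithinAt b (b' t) (Icc 0 1) t := by
        intro t ht
        have e1 : HasDerivWithinAt (fun t => h (a t)) (fderiv ℝ h (a t) (h (a t) x)) (Icc 0 1) t :=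
          (hdh _ (hhalf (am t))).comp_hasDerivWithinAt t (ad t ht)
        have e2 : HasDerivWithinAt (fun t => h (a t) k) (fderiv ℝ h (a t) (h (a t) x) k)
            (Icc 0 1) t := by
          have := e1.clm_apply (hasDerivWithinAt_const t (Icc 0 1) k)
          simpa using this
        have e3 := (hasDerivWithinAt_id t (Icc (0 : ℝ) 1)).smul e2
        have := (ad t ht).add e3
        exact this.congr_deriv (by simp [hb'def])
      have hIci : ∀ {g : ℝ → F} {g'} {t : ℝ}, t ∈ Ico (0 : ℝ) 1 →
          HasDerivWithinAt g g' (Icc 0 1) t → HasDerivWithinAt g g' (Ici t) t := by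
        intro g g' t ht hg
        exact hg.mono_of_mem_nhdsWithin (Icc_mem_nhdsGE_of_mem ht)
      have hG := dist_le_of_approx_trajectories_ODE_of_mem (v := fun _ y => h y (x + k)) (K := B)
        (s := fun _ => closedBall y₀ R) (f := b) (f' := b') (g := c)
        (g' := fun t => h (c t) (x + k)) (a := 0) (b := 1) (εf := C * ‖k‖ ^ 2) (εg := 0) (δ := 0)
        ?_ ?_ (fun t ht => hIci ht (hbd' t (Ico_subset_Icc_self ht))) ?_
        (fun t ht => hbm t (Ico_subset_Icc_self ht)) ?_
        (fun t ht => hIci ht (cd t (Ico_subset_Icc_self ht))) ?_ (fun t _ => hhalf (cm t)) ?_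
        1 (by simp)
      · have e : gronwallBound 0 B (C * ‖k‖ ^ 2 + 0) (1 - 0) =
            gronwallBound 0 B 1 1 * C * ‖k‖ ^ 2 := by
          unfold gronwallBound
          split_ifs <;> simp
          ring
        rw [e, dist_comm, dist_eq_norm] at hG
        have e2 : c 1 - b 1 = u (x + k) - u x - h (u x) k := by
          change α (x + k) 1 - (α x 1 + (1 : ℝ) • h (α x 1) k) = _
          rw [one_smul, sub_add_eq_sub_sub]
        rwa [e2] at hG
      · intro t _
        refine LipschitzOnWith.of_dist_le_mul fun y hy z hz => ?_
        rw [dist_eq_norm, ← sub_apply]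
        calc ‖(h y - h z) (x + k)‖ ≤ ‖h y - h z‖ * ‖x + k‖ := ContinuousLinearMap.le_opNorm _ _
          _ ≤ (B * dist y z) * 1 := by
            gcongr
            rw [← dist_eq_norm]
            exact hlip.dist_le_mul y hy z hz
          _ = B * dist y z := mul_one _
      · exact fun t ht => (hbd' t ht).continuousWithinAt
      · intro t ht
        have ht' := Ico_subset_Icc_self ht
        have hat := hhalf (am t)
        have hbt := hbm t ht'
        have hthk : ‖t • h (a t) k‖ ≤ B * ‖k‖ := by
          rw [norm_smul, Real.norm_eq_abs, abs_of_nonneg ht'.1]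
          calc t * ‖h (a t) k‖ ≤ 1 * (‖h (a t)‖ * ‖k‖) := by
                gcongr
                · exact ht'.2
                · exact (h (a t)).le_opNorm k
            _ ≤ B * ‖k‖ := by rw [one_mul]; gcongr; exact hb _ hat
        have hT := htay (a t) hat (t • h (a t) k) hbt
        set rem := h (a t + t • h (a t) k) - h (a t) - fderiv ℝ h (a t) (t • h (a t) k) with hrem
        have hsy := hsymm (a t) (hRV hat) x k
        have heq : b' t - h (b t) (x + k) =
            -(fderiv ℝ h (a t) (t • h (a t) k) k) - rem (x + k) := by
          have : h (b t) = rem + h (a t) + fderiv ℝ h (a t) (t • h (a t) k) := by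
            rw [hrem, hbdef]; abel
          rw [this, hb'def]
          simp only [map_add, map_smul, add_apply,
            smul_apply, hsy]
          abel
        rw [dist_eq_norm, heq]
        calc ‖-(fderiv ℝ h (a t) (t • h (a t) k) k) - rem (x + k)‖
            ≤ ‖fderiv ℝ h (a t) (t • h (a t) k) k‖ + ‖rem (x + k)‖ := by
              refine (norm_sub_le _ _).trans ?_
              rw [norm_neg]
          _ ≤ (B * (B * ‖k‖)) * ‖k‖ + (B * (B * ‖k‖) ^ 2) * 1 := by
              gcongr
              · refine (ContinuousLinearMap.le_opNorm _ _).trans ?_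
                gcongr
                refine (ContinuousLinearMap.le_opNorm _ _).trans ?_
                gcongr
                exact hb' _ hat
              · refine (ContinuousLinearMap.le_opNorm _ _).trans ?_
                gcongr
                exact hT.trans (by gcongr)
          _ = C * ‖k‖ ^ 2 := by rw [hC]; ring
      · exact fun t ht => (cd t ht).continuousWithinAt
      · intro t _; simp
      · simp [hbdef, a0, c0]
    rw [hasFDerivAt_iff_isLittleO_nhds_zero]
    refine Asymptotics.IsBigO.trans_isLittleO (g := fun k : E => ‖k‖ ^ 2) ?_ ?_
    · refine Asymptotics.IsBigO.of_bound (gronwallBound 0 B 1 1 * C) ?_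
      have e1 : ∀ᶠ k in 𝓝 (0 : E), x + k ∈ ball (0 : E) ε := by
        refine (continuous_const.add continuous_id).continuousAt.eventually_mem
          (isOpen_ball.mem_nhds (by simpa using hx))
      have e2 : ∀ᶠ k in 𝓝 (0 : E), B * ‖k‖ < R / 2 :=
        (continuous_const.mul continuous_norm).continuousAt.eventually_lt continuousAt_const
          (by simp; positivity)
      filter_upwards [e1, e2] with k hk1 hk2
      simpa using hest k hk1 hk2.le
    · exact Asymptotics.isLittleO_norm_pow_id one_lt_two
  refine ⟨ε, hε0, u, ?_, fun x hx => hRV (hhalf (hubd x hx)), ?_, hderiv⟩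
  · -- at `x = 0` the solution is constant
    obtain ⟨a0, -, ad⟩ := hα 0 (by simpa using hε0)
    have := (convex_Icc (0 : ℝ) 1).is_const_of_fderivWithin_eq_zero (𝕜 := ℝ) (f := α 0)
      (fun t ht => (ad t ht).differentiableWithinAt) (fun t ht => ?_) (x := 0) (y := 1)
      (by simp) (by simp)
    · rw [hu]; simp only; rw [← this, a0]
    · have hz := ad t ht
      rw [map_zero] at hz
      have hud : UniqueDiffWithinAt ℝ (Icc (0 : ℝ) 1) t := uniqueDiffOn_Icc one_pos t ht
      have := hz.hasFDerivWithinAt.fderivWithin hud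
      rw [this]; ext; simp
  · -- bootstrapping: `u` is as smooth as its derivative `h ∘ u`
    have hnat : ∀ n : ℕ, ContDiffOn ℝ n u (ball 0 ε) := by
      intro n
      induction n with
      | zero =>
        exact contDiffOn_zero.2 fun x hx => (hderiv x hx).continuousAt.continuousWithinAt
      | succ n ih =>
        rw [show ((n + 1 : ℕ) : WithTop ℕ∞) = (n : WithTop ℕ∞) + 1 by push_cast; rfl,
          contDiffOn_succ_iff_fderiv_of_isOpen isOpen_ball]
        refine ⟨fun x hx => (hderiv x hx).differentiableAt.differentiableWithinAt, by simp, ?_⟩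
        refine ((hh.of_le (by exact_mod_cast le_top)).comp ih
          fun x hx => hRV (hhalf (hubd x hx))).congr fun x hx => (hderiv x hx).fderiv
    exact contDiffOn_infty.2 hnat

end Frobenius

/-! ### Right actions -/

section RightAction

variable {G Q : Type*} [Group G] [MulAction Gᵐᵒᵖ Q]

theorem act_one (q : Q) : q <• (1 : G) = q := by
  rw [MulOpposite.op_one, one_smul]

end RightAction

/-! ### Principal bundles: difference of points in a fibre, smoothness of the action -/

section BundleBasics

open scoped Topology
open Filter

variable
    {EM : Type*} [NormedAddCommGroup EM] [NormedSpace ℝ EM]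
    {M : Type*} [TopologicalSpace M] [ChartedSpace EM M]
    {EG : Type*} [NormedAddCommGroup EG] [NormedSpace ℝ EG]
    {G : Type*} [Group G] [TopologicalSpace G] [ChartedSpace EG G]
    {EQ : Type*} [NormedAddCommGroup EQ] [NormedSpace ℝ EQ]
    {Q : Type*} [TopologicalSpace Q] [ChartedSpace EQ Q] [MulAction Gᵐᵒᵖ Q]
    {π : Q → M}

namespace IsPrincipalBundle

/-- The difference of two points of the same fibre: the element `g` of `G` with `p <• g = q`,
see `IsPrincipalBundle.act_div`. It is computed in a trivialization around `π p`. -/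
noncomputable def div (hπ : IsPrincipalBundle EM EG G EQ π) (p q : Q) : G :=
  ((hπ.locally_trivial (π p)).choose p).2⁻¹ * ((hπ.locally_trivial (π p)).choose q).2

variable (hπ : IsPrincipalBundle EM EG G EQ π)
include hπ

theorem act_div {p q : Q} (h : π p = π q) : p <• hπ.div p q = q := by
  obtain ⟨hx, -, -, he⟩ := (hπ.locally_trivial (π p)).choose_spec
  set e := (hπ.locally_trivial (π p)).choose with he'
  have hp : p ∈ e.source := e.mem_source.2 hx
  have hq : q ∈ e.source := e.mem_source.2 (h ▸ hx)
  refine e.injOn (e.mem_source.2 (by rwa [hπ.proj_act])) hq ?_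
  change e _ = e _
  rw [he p hp, div, ← he']
  refine Prod.ext ?_ (by simp)
  simp only [e.coe_fst hp, e.coe_fst hq, h]

theorem act_injective (q : Q) : Function.Injective (fun g : G => q <• g) := by
  intro g k h
  obtain ⟨e, hx, -, -, he⟩ := hπ.locally_trivial (π q)
  have hq : q ∈ e.source := e.mem_source.2 hx
  have := congrArg (fun p => (e p).2) h
  simpa [he q hq] using this

theorem div_act (p : Q) (g : G) : hπ.div p (p <• g) = g :=
  hπ.act_injective p (hπ.act_div (hπ.proj_act p g).symm)

theorem div_eq_of_act_eq {p q : Q} {g : G} (h : p <• g = q) : hπ.div p q = g := by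
  rw [← h, hπ.div_act]

theorem div_self (p : Q) : hπ.div p p = 1 := hπ.div_eq_of_act_eq (act_one p)

theorem contMDiff_proj : ContMDiff 𝓘(ℝ, EQ) 𝓘(ℝ, EM) ∞ π := by
  intro q
  obtain ⟨e, hx, hes, -, -⟩ := hπ.locally_trivial (π q)
  have hq : e.source ∈ 𝓝 q := e.open_source.mem_nhds (e.mem_source.2 hx)
  exact (contMDiffAt_fst.comp q (hes.contMDiffAt hq)).congr_of_eventuallyEq
    (eventually_of_mem hq fun p hp => (e.coe_fst hp).symm)

/-- Through every point there is a smooth local section. -/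
theorem exists_section (q : Q) : ∃ (U : Set M) (s : M → Q), IsOpen U ∧ π q ∈ U ∧
    ContMDiffOn 𝓘(ℝ, EM) 𝓘(ℝ, EQ) ∞ s U ∧ (∀ y ∈ U, π (s y) = y) ∧ s (π q) = q := by
  obtain ⟨e, hx, -, hes, -⟩ := hπ.locally_trivial (π q)
  refine ⟨e.baseSet, fun y => e.toOpenPartialHomeomorph.symm (y, (e q).2), e.open_baseSet, hx,
    hes.comp (contMDiffOn_id.prodMk contMDiffOn_const) fun y hy => e.mem_target.2 hy,
    fun y hy => e.proj_symm_apply (e.mem_target.2 hy), ?_⟩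
  exact e.symm_apply_mk_proj (e.mem_source.2 hx)

variable {E' H' : Type*} [NormedAddCommGroup E'] [NormedSpace ℝ E'] [TopologicalSpace H']
  {I : ModelWithCorners ℝ E' H'} {N : Type*} [TopologicalSpace N] [ChartedSpace H' N]

variable [LieGroup 𝓘(ℝ, EG) ∞ G]

theorem contMDiffWithinAt_act {f : N → Q} {k : N → G} {A : Set N} {x : N}
    (hf : ContMDiffWithinAt I 𝓘(ℝ, EQ) ∞ f A x) (hk : ContMDiffWithinAt I 𝓘(ℝ, EG) ∞ k A x) :
    ContMDiffWithinAt I 𝓘(ℝ, EQ) ∞ (fun y => f y <• k y) A x := by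
  obtain ⟨e, hx, hes, hes', he⟩ := hπ.locally_trivial (π (f x))
  have hfx : f x ∈ e.source := e.mem_source.2 hx
  have h1 : ContMDiffWithinAt I (𝓘(ℝ, EM).prod 𝓘(ℝ, EG)) ∞ (fun y => e (f y)) A x :=
    (hes.contMDiffAt (e.open_source.mem_nhds hfx)).comp_contMDiffWithinAt x hf
  have h2 : ContMDiffWithinAt I (𝓘(ℝ, EM).prod 𝓘(ℝ, EG)) ∞
      (fun y => ((e (f y)).1, (e (f y)).2 * k y)) A x :=
    h1.fst.prodMk (h1.snd.mul hk)
  have key : ∀ y, f y ∈ e.source →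
      e.toOpenPartialHomeomorph.symm ((e (f y)).1, (e (f y)).2 * k y) = f y <• k y := by
    intro y hy
    have hy' : f y <• k y ∈ e.source :=
      e.mem_source.2 ((hπ.proj_act (f y) (k y)).symm ▸ e.mem_source.1 hy)
    rw [← he _ hy (k y)]
    exact e.toOpenPartialHomeomorph.left_inv hy'
  have ht : ((e (f x)).1, (e (f x)).2 * k x) ∈ e.target := by
    rw [e.mem_target, e.coe_fst hfx]; exact hx
  have h3 := (hes'.contMDiffAt (e.open_target.mem_nhds ht)).comp_contMDiffWithinAt x h2
  refine h3.congr_of_eventuallyEq ?_ (key x hfx).symm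
  filter_upwards [hf.continuousWithinAt.preimage_mem_nhdsWithin (e.open_source.mem_nhds hfx)]
    with y hy
  exact (key y hy).symm

theorem contMDiffWithinAt_div {f f' : N → Q} {A : Set N} {x : N}
    (hf : ContMDiffWithinAt I 𝓘(ℝ, EQ) ∞ f A x) (hf' : ContMDiffWithinAt I 𝓘(ℝ, EQ) ∞ f' A x)
    (h : ∀ᶠ y in 𝓝[A] x, π (f y) = π (f' y)) (hx : π (f x) = π (f' x)) :
    ContMDiffWithinAt I 𝓘(ℝ, EG) ∞ (fun y => hπ.div (f y) (f' y)) A x := by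
  obtain ⟨e, hxe, hes, hes', he⟩ := hπ.locally_trivial (π (f x))
  have hfx : f x ∈ e.source := e.mem_source.2 hxe
  have hfx' : f' x ∈ e.source := e.mem_source.2 (hx ▸ hxe)
  have h1 : ContMDiffWithinAt I (𝓘(ℝ, EM).prod 𝓘(ℝ, EG)) ∞ (fun y => e (f y)) A x :=
    (hes.contMDiffAt (e.open_source.mem_nhds hfx)).comp_contMDiffWithinAt x hf
  have h2 : ContMDiffWithinAt I (𝓘(ℝ, EM).prod 𝓘(ℝ, EG)) ∞ (fun y => e (f' y)) A x :=
    (hes.contMDiffAt (e.open_source.mem_nhds hfx')).comp_contMDiffWithinAt x hf'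
  have key : ∀ y, f y ∈ e.source → π (f y) = π (f' y) →
      hπ.div (f y) (f' y) = (e (f y)).2⁻¹ * (e (f' y)).2 := by
    intro y hy hyy
    have hy' : f' y ∈ e.source := e.mem_source.2 (hyy ▸ e.mem_source.1 hy)
    have := he (f y) hy (hπ.div (f y) (f' y))
    rw [hπ.act_div hyy] at this
    rw [this]
    simp
  refine (h1.snd.inv.mul h2.snd).congr_of_eventuallyEq ?_ (key x hfx hx)
  filter_upwards [hf.continuousWithinAt.preimage_mem_nhdsWithin (e.open_source.mem_nhds hfx), h]
    with y hy hyy using key y hy hyy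

theorem contMDiffAt_act {f : N → Q} {k : N → G} {x : N}
    (hf : ContMDiffAt I 𝓘(ℝ, EQ) ∞ f x) (hk : ContMDiffAt I 𝓘(ℝ, EG) ∞ k x) :
    ContMDiffAt I 𝓘(ℝ, EQ) ∞ (fun y => f y <• k y) x :=
  hπ.contMDiffWithinAt_act hf hk

theorem contMDiff_act_right (g : G) : ContMDiff 𝓘(ℝ, EQ) 𝓘(ℝ, EQ) ∞ (fun q : Q => q <• g) :=
  fun _ => hπ.contMDiffAt_act contMDiffAt_id contMDiffAt_const

theorem contMDiff_act_left (q : Q) : ContMDiff 𝓘(ℝ, EG) 𝓘(ℝ, EQ) ∞ (fun g : G => q <• g) :=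
  fun _ => hπ.contMDiffAt_act contMDiffAt_const contMDiffAt_id

theorem contMDiffAt_div {f f' : N → Q} {x : N}
    (hf : ContMDiffAt I 𝓘(ℝ, EQ) ∞ f x) (hf' : ContMDiffAt I 𝓘(ℝ, EQ) ∞ f' x)
    (h : ∀ᶠ y in 𝓝 x, π (f y) = π (f' y)) :
    ContMDiffAt I 𝓘(ℝ, EG) ∞ (fun y => hπ.div (f y) (f' y)) x :=
  hπ.contMDiffWithinAt_div hf hf' (by simpa using h) h.self_of_nhds

end IsPrincipalBundle

end BundleBasics

/-! ### Piecewise smooth paths and continuity -/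

section Pieces

open scoped Topology
open Filter

/-- A map on `A × [a, b]` which is continuous on `A × [c, d]` for all subintervals without break
points in the interior is continuous. -/
theorem continuousOn_prod_Icc_of_pieces {X Y : Type*} [TopologicalSpace X] [TopologicalSpace Y]
    {A : Set X} {f : X × ℝ → Y} {a b : ℝ} (hab : a < b) (F : Finset ℝ)
    (h : ∀ c d, a ≤ c → c < d → d ≤ b → Disjoint (F : Set ℝ) (Ioo c d) →
      ContinuousOn f (A ×ˢ Icc c d)) :
    ContinuousOn f (A ×ˢ Icc a b) := by
  rintro ⟨x, t⟩ ⟨hx, ht⟩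
  -- no other break point is `ε`-close to `t`
  obtain ⟨ε, hε, hF⟩ : ∃ ε > 0, ∀ s ∈ F, |s - t| < ε → s = t := by
    have hfin : ((F : Set ℝ) \ {t}).Finite := F.finite_toSet.subset sdiff_subset
    have : ((F : Set ℝ) \ {t})ᶜ ∈ 𝓝 t := hfin.isClosed.isOpen_compl.mem_nhds (by simp)
    obtain ⟨ε, hε, hsub⟩ := Metric.mem_nhds_iff.1 this
    refine ⟨ε, hε, fun s hs hst => ?_⟩
    have := hsub (show s ∈ Metric.ball t ε by simpa [Real.dist_eq] using hst)
    by_contra hne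
    exact this ⟨hs, hne⟩
  have hright : t < b → ContinuousWithinAt f (A ×ˢ Icc t b) (x, t) := by
    intro htb
    have hlt : t < min b (t + ε) := lt_min htb (by linarith)
    have hc := h t (min b (t + ε)) ht.1 hlt (min_le_left _ _) (by
      rw [Set.disjoint_left]
      intro s hs hs'
      have h1 : s < t + ε := hs'.2.trans_le (min_le_right _ _)
      have := hF s hs (by rw [abs_lt]; constructor <;> linarith [hs'.1])
      linarith [hs'.1])
    refine (hc (x, t) ⟨hx, le_rfl, hlt.le⟩).mono_of_mem_nhdsWithin ?_
    rw [nhdsWithin_prod_eq]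
    refine prod_mem_prod self_mem_nhdsWithin ?_
    filter_upwards [self_mem_nhdsWithin, nhdsWithin_le_nhds (Iio_mem_nhds hlt)] with s hs hs'
    exact ⟨hs.1, le_of_lt hs'⟩
  have hleft : a < t → ContinuousWithinAt f (A ×ˢ Icc a t) (x, t) := by
    intro hat
    have hlt : max a (t - ε) < t := max_lt hat (by linarith)
    have hc := h (max a (t - ε)) t (le_max_left _ _) hlt ht.2 (by
      rw [Set.disjoint_left]
      intro s hs hs'
      have h1 : t - ε < s := (le_max_right _ _).trans_lt hs'.1
      have := hF s hs (by rw [abs_lt]; constructor <;> linarith [hs'.2])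
      linarith [hs'.2])
    refine (hc (x, t) ⟨hx, hlt.le, le_rfl⟩).mono_of_mem_nhdsWithin ?_
    rw [nhdsWithin_prod_eq]
    refine prod_mem_prod self_mem_nhdsWithin ?_
    filter_upwards [self_mem_nhdsWithin, nhdsWithin_le_nhds (Ioi_mem_nhds hlt)] with s hs hs'
    exact ⟨le_of_lt hs', hs.2⟩
  rcases eq_or_lt_of_le ht.1 with rfl | hat
  · exact hright hab
  rcases eq_or_lt_of_le ht.2 with rfl | htb
  · exact hleft hat
  refine ((hleft hat).union (hright htb)).mono ?_
  rw [← prod_union, Icc_union_Icc_eq_Icc ht.1 ht.2]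

namespace PSPath

variable {EM : Type*} [NormedAddCommGroup EM] [NormedSpace ℝ EM]
  {M : Type*} [TopologicalSpace M] [ChartedSpace EM M]

theorem continuousOn (γ : PSPath EM M) : ContinuousOn γ (Icc γ.a γ.b) := by
  obtain ⟨F, hF⟩ := γ.piecewise_smooth
  have := continuousOn_prod_Icc_of_pieces (A := (univ : Set Unit)) (f := fun z => γ z.2) γ.lt F
    (fun c d h1 h2 h3 h4 => (hF c d h1 h2 h3 h4).continuousOn.comp continuousOn_snd
      fun z hz => hz.2)
  exact this.comp (f := fun t => ((), t)) (by fun_prop) fun t ht => ⟨mem_univ _, ht⟩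

/-- A function on `ℝ` which is constant on `(-∞, a]` and on `[b, ∞)` factors through the
retraction of `ℝ` onto `[a, b]`. -/
theorem apply_clamp {Y : Type*} {f : ℝ → Y} {a b : ℝ} (hab : a ≤ b) (ha : ∀ t ≤ a, f t = f a)
    (hb : ∀ t, b ≤ t → f t = f b) (t : ℝ) : f (max a (min b t)) = f t := by
  rcases le_total t a with h | h
  · rw [max_eq_left ((min_le_right _ _).trans h), ha t h]
  · rcases le_total t b with h' | h'
    · rw [min_eq_right h', max_eq_right h]
    · rw [min_eq_left h', max_eq_right hab, hb t h']

theorem clamp_mem {a b : ℝ} (hab : a ≤ b) (t : ℝ) : max a (min b t) ∈ Icc a b :=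
  ⟨le_max_left _ _, max_le hab (min_le_left _ _)⟩

protected theorem continuous (γ : PSPath EM M) : Continuous γ := by
  have : Continuous fun t => γ (max γ.a (min γ.b t)) :=
    γ.continuousOn.comp_continuous (by fun_prop) fun t => clamp_mem γ.lt.le t
  simpa only [apply_clamp γ.lt.le γ.eq_left γ.eq_right] using this

/-- A path is smooth at all interior times outside of a finite set. -/
theorem exists_contMDiffAt (γ : PSPath EM M) : ∃ F : Finset ℝ, ∀ t ∈ Ioo γ.a γ.b, t ∉ F →
    ContMDiffAt 𝓘(ℝ, ℝ) 𝓘(ℝ, EM) ∞ γ t := by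
  obtain ⟨F, hF⟩ := γ.piecewise_smooth
  refine ⟨F, fun t ht htF => ?_⟩
  have hmem : (F : Set ℝ)ᶜ ∩ Ioo γ.a γ.b ∈ 𝓝 t :=
    inter_mem (F.finite_toSet.isClosed.isOpen_compl.mem_nhds (by simpa using htF))
      (Ioo_mem_nhds ht.1 ht.2)
  obtain ⟨c, d, htcd, hsub⟩ := mem_nhds_iff_exists_Ioo_subset.1 hmem
  obtain ⟨c', hc⟩ := exists_between htcd.1
  obtain ⟨d', hd⟩ := exists_between htcd.2
  have hsub' : Icc c' d' ⊆ Ioo c d := fun s hs => ⟨hc.1.trans_le hs.1, hs.2.trans_lt hd.2⟩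
  have hlt : c' < d' := hc.2.trans hd.1
  refine (hF c' d' (hsub (hsub' ⟨le_rfl, hlt.le⟩)).2.1.le hlt
    (hsub (hsub' ⟨hlt.le, le_rfl⟩)).2.2.le ?_).contMDiffAt (Icc_mem_nhds hc.2 hd.1)
  rw [Set.disjoint_left]
  exact fun s hs hs' => (hsub (hsub' (Ioo_subset_Icc_self hs'))).1 hs

end PSPath

/-- A continuous curve in a manifold with vanishing derivative outside of a finite set is
constant. -/
theorem eq_of_hasMFDerivAt_zero {E : Type*} [NormedAddCommGroup E] [NormedSpace ℝ E]
    [CompleteSpace E] {N : Type*} [TopologicalSpace N] [ChartedSpace E N] [IsManifold 𝓘(ℝ, E) 1 N]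
    {k : ℝ → N} {a b : ℝ} (hk : ContinuousOn k (Icc a b)) (F : Finset ℝ)
    (hd : ∀ t ∈ Ioo a b, t ∉ F → HasMFDerivAt 𝓘(ℝ, ℝ) 𝓘(ℝ, E) k t 0)
    {s t : ℝ} (hs : s ∈ Icc a b) (ht : t ∈ Icc a b) : k s = k t := by
  refine isPreconnected_Icc.induction₂ (fun s t => k s = k t) (fun t₀ ht₀ => ?_)
    (fun _ _ _ _ _ _ h h' => h.trans h') (fun _ _ _ _ h => h.symm) hs ht
  set φ := extChartAt 𝓘(ℝ, E) (k t₀) with hφ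
  have hmem : k ⁻¹' φ.source ∈ 𝓝[Icc a b] t₀ :=
    (hk t₀ ht₀).preimage_mem_nhdsWithin (extChartAt_source_mem_nhds (I := 𝓘(ℝ, E)) (k t₀))
  obtain ⟨ε, hε, hsub⟩ := Metric.mem_nhdsWithin_iff.1 hmem
  filter_upwards [self_mem_nhdsWithin, nhdsWithin_le_nhds (Metric.ball_mem_nhds t₀ hε)]
    with t ht htε
  have hI : uIcc t₀ t ⊆ Icc a b := ordConnected_Icc.uIcc_subset ht₀ ht
  have hB : uIcc t₀ t ⊆ k ⁻¹' φ.source := fun r hr => hsub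
    ⟨(convex_ball t₀ ε).ordConnected.uIcc_subset (Metric.mem_ball_self hε) htε hr, hI hr⟩
  have hsrc : φ.source = (chartAt E (k t₀)).source := extChartAt_source _ _
  have hd' : ∀ r ∈ Ioo (min t₀ t) (max t₀ t) \ (F : Set ℝ),
      HasDerivAt (fun r => φ (k r)) ((fun _ => 0) r) r := by
    intro r hr
    have hr' : r ∈ uIcc t₀ t := Ioo_subset_Icc_self hr.1
    have h1 : HasMFDerivAt 𝓘(ℝ, ℝ) 𝓘(ℝ, E) k r 0 :=
      hd r ⟨(hI ⟨le_rfl, inf_le_sup⟩).1.trans_lt hr.1.1,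
        hr.1.2.trans_le (hI ⟨inf_le_sup, le_rfl⟩).2⟩ (by simpa using hr.2)
    have h2 := (mdifferentiableAt_extChartAt (I := 𝓘(ℝ, E)) (x := k t₀)
      (hsrc ▸ hB hr')).hasMFDerivAt.comp r h1
    rw [ContinuousLinearMap.comp_zero] at h2
    have h3 : HasFDerivAt (fun r => φ (k r)) (0 : ℝ →L[ℝ] E) r := h2.hasFDerivAt
    simpa using h3.hasDerivAt
  have hc : ContinuousOn (fun r => φ (k r)) (uIcc t₀ t) :=
    (continuousOn_extChartAt (I := 𝓘(ℝ, E)) (k t₀)).comp (hk.mono hI) hB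
  have := MeasureTheory.integral_eq_of_hasDerivAt_off_countable _ _
    F.countable_toSet hc hd' (by simp)
  simp only [intervalIntegral.integral_zero] at this
  exact φ.injOn (hB left_mem_uIcc) (hB right_mem_uIcc) (sub_eq_zero.1 this.symm).symm

end Pieces

/-! ### Uniqueness of horizontal curves -/

section HorizontalCurves

open scoped Topology
open Filter

variable
    {EM : Type*} [NormedAddCommGroup EM] [NormedSpace ℝ EM]
    {M : Type*} [TopologicalSpace M] [ChartedSpace EM M]
    {EG : Type*} [NormedAddCommGroup EG] [NormedSpace ℝ EG]
    {G : Type*} [Group G] [TopologicalSpace G] [ChartedSpace EG G] [LieGroup 𝓘(ℝ, EG) ∞ G]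
    {EQ : Type*} [NormedAddCommGroup EQ] [NormedSpace ℝ EQ]
    {Q : Type*} [TopologicalSpace Q] [ChartedSpace EQ Q] [MulAction Gᵐᵒᵖ Q]
    {π : Q → M}

namespace IsPrincipalBundle

variable (hπ : IsPrincipalBundle EM EG G EQ π)

section
include hπ

omit [LieGroup 𝓘(ℝ, EG) ∞ G] in
theorem mdifferentiableAt_proj (q : Q) : MDifferentiableAt 𝓘(ℝ, EQ) 𝓘(ℝ, EM) π q :=
  (hπ.contMDiff_proj q).mdifferentiableAt (by simp)

theorem mdifferentiableAt_act_right (g : G) (q : Q) :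
    MDifferentiableAt 𝓘(ℝ, EQ) 𝓘(ℝ, EQ) (fun q : Q => q <• g) q :=
  (hπ.contMDiff_act_right g q).mdifferentiableAt (by simp)

theorem mdifferentiableAt_act_left (q : Q) (g : G) :
    MDifferentiableAt 𝓘(ℝ, EG) 𝓘(ℝ, EQ) (fun g : G => q <• g) g :=
  (hπ.contMDiff_act_left q g).mdifferentiableAt (by simp)

omit [LieGroup 𝓘(ℝ, EG) ∞ G] in
theorem mfderiv_proj_section {s : M → Q} {y : M}
    (hs : MDifferentiableAt 𝓘(ℝ, EM) 𝓘(ℝ, EQ) s y) (h : ∀ᶠ z in 𝓝 y, π (s z) = z) (w : EM) :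
    (mfderiv 𝓘(ℝ, EQ) 𝓘(ℝ, EM) π (s y) (mfderiv 𝓘(ℝ, EM) 𝓘(ℝ, EQ) s y w) : EM) = w := by
  have h1 : HasMFDerivAt 𝓘(ℝ, EM) 𝓘(ℝ, EM) (π ∘ s) y
      (ContinuousLinearMap.id ℝ (TangentSpace 𝓘(ℝ, EM) y)) :=
    (hasMFDerivAt_id y).congr_of_eventuallyEq h
  have h2 := (hπ.mdifferentiableAt_proj (s y)).hasMFDerivAt.comp y hs.hasMFDerivAt
  exact DFunLike.congr_fun (hasMFDerivAt_unique h2 h1) w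

omit [LieGroup 𝓘(ℝ, EG) ∞ G] in
theorem mfderiv_proj_surjective (q : Q) (w : EM) :
    ∃ v : EQ, (mfderiv 𝓘(ℝ, EQ) 𝓘(ℝ, EM) π q v : EM) = w := by
  obtain ⟨U, s, hU, hq, hs, hsec, hsq⟩ := hπ.exists_section q
  have := hπ.mfderiv_proj_section
    ((hs.contMDiffAt (hU.mem_nhds hq)).mdifferentiableAt (by simp))
    (eventually_of_mem (hU.mem_nhds hq) hsec) w
  rw [hsq] at this
  exact ⟨_, this⟩

theorem mfderiv_proj_act_left (q : Q) (g : G) (w : EG) :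
    (mfderiv 𝓘(ℝ, EQ) 𝓘(ℝ, EM) π (q <• g)
      (mfderiv 𝓘(ℝ, EG) 𝓘(ℝ, EQ) (fun g : G => q <• g) g w) : EM) = 0 := by
  have h2 := (hπ.mdifferentiableAt_proj (q <• g)).hasMFDerivAt.comp g
    (hπ.mdifferentiableAt_act_left q g).hasMFDerivAt
  have h1 : HasMFDerivAt 𝓘(ℝ, EG) 𝓘(ℝ, EM) (π ∘ fun g : G => q <• g) g 0 :=
    (hasMFDerivAt_const (π q) g).congr_of_eventuallyEq
      (Eventually.of_forall fun k => hπ.proj_act q k)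
  exact DFunLike.congr_fun (hasMFDerivAt_unique h2 h1) w

/-- The action is infinitesimally free: `g ↦ q <• g` has a smooth left inverse near `q <• g`,
the difference to a local section through `q`. -/
theorem mfderiv_act_left_injective (q : Q) (g : G) {w : EG}
    (hw : (mfderiv 𝓘(ℝ, EG) 𝓘(ℝ, EQ) (fun g : G => q <• g) g w : EQ) = 0) : w = 0 := by
  obtain ⟨U, s, hU, hq, hs, hsec, hsq⟩ := hπ.exists_section q
  have hqg : π (q <• g) = π q := hπ.proj_act q g
  have hc : ContMDiffAt 𝓘(ℝ, EQ) 𝓘(ℝ, EG) ∞ (fun p => hπ.div (s (π p)) p) (q <• g) := by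
    refine hπ.contMDiffAt_div ?_ contMDiffAt_id ?_
    · exact ContMDiffAt.comp _ (hs.contMDiffAt (hU.mem_nhds (hqg ▸ hq)))
        (hπ.contMDiff_proj _)
    · filter_upwards [(hU.preimage hπ.contMDiff_proj.continuous).mem_nhds
        (show q <• g ∈ π ⁻¹' U from by rwa [mem_preimage, hqg])] with p hp
      exact hsec _ hp
  have h2 := (hc.mdifferentiableAt (by simp)).hasMFDerivAt.comp g
    (hπ.mdifferentiableAt_act_left q g).hasMFDerivAt
  have h1 : HasMFDerivAt 𝓘(ℝ, EG) 𝓘(ℝ, EG) ((fun p => hπ.div (s (π p)) p) ∘ fun g : G => q <• g)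
      g (ContinuousLinearMap.id ℝ (TangentSpace 𝓘(ℝ, EG) g)) := by
    refine (hasMFDerivAt_id g).congr_of_eventuallyEq (Eventually.of_forall fun k => ?_)
    simp only [Function.comp, hπ.proj_act, hsq, hπ.div_act, id]
  have h3 : mfderiv 𝓘(ℝ, EQ) 𝓘(ℝ, EG) (fun p => hπ.div (s (π p)) p) (q <• g)
      (mfderiv 𝓘(ℝ, EG) 𝓘(ℝ, EQ) (fun g : G => q <• g) g w) = w :=
    DFunLike.congr_fun (hasMFDerivAt_unique h2 h1) w
  have h4 : mfderiv 𝓘(ℝ, EG) 𝓘(ℝ, EQ) (fun g : G => q <• g) g w = 0 := hw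
  rw [h4, map_zero] at h3
  exact h3.symm

variable {E' H' : Type*} [NormedAddCommGroup E'] [NormedSpace ℝ E'] [TopologicalSpace H']
  {I : ModelWithCorners ℝ E' H'} {N : Type*} [TopologicalSpace N] [ChartedSpace H' N]

/-- The Leibniz rule for the product of a map to `Q` and a map to `G`. -/
theorem mfderiv_act {f : N → Q} {k : N → G} {x : N} (hf : MDifferentiableAt I 𝓘(ℝ, EQ) f x)
    (hk : MDifferentiableAt I 𝓘(ℝ, EG) k x) (v : TangentSpace I x) :
    (mfderiv I 𝓘(ℝ, EQ) (fun y => f y <• k y) x v : EQ) =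
      (mfderiv 𝓘(ℝ, EQ) 𝓘(ℝ, EQ) (fun q : Q => q <• k x) (f x) (mfderiv I 𝓘(ℝ, EQ) f x v) : EQ) +
      (mfderiv 𝓘(ℝ, EG) 𝓘(ℝ, EQ) (fun g : G => f x <• g) (k x)
        (mfderiv I 𝓘(ℝ, EG) k x v) : EQ) := by
  have hA : MDifferentiableAt (𝓘(ℝ, EQ).prod 𝓘(ℝ, EG)) 𝓘(ℝ, EQ)
      (fun z : Q × G => z.1 <• z.2) (f x, k x) :=
    (hπ.contMDiffAt_act contMDiffAt_fst contMDiffAt_snd).mdifferentiableAt (by simp)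
  have h1 := mfderiv_comp_apply x (g := fun z : Q × G => z.1 <• z.2) (f := fun y => (f y, k y))
    hA (hf.prodMk hk) v
  rw [mfderiv_prodMk hf hk, mfderiv_prod_eq_add_apply hA] at h1
  exact h1

end

end IsPrincipalBundle

variable [IsManifold 𝓘(ℝ, EQ) ∞ Q]

namespace Connection

omit [TopologicalSpace G] [ChartedSpace EG G] [LieGroup 𝓘(ℝ, EG) ∞ G] in
theorem eq_zero_of_mem_hor (H : Connection EM G EQ π) {p : Q} {v : EQ} (hv : v ∈ H.hor p)
    (h : (mfderiv 𝓘(ℝ, EQ) 𝓘(ℝ, EM) π p v : EM) = 0) : v = 0 :=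
  (Submodule.disjoint_def.1 (H.isCompl p).disjoint) v hv (LinearMap.mem_ker.2 h)

omit [TopologicalSpace G] [ChartedSpace EG G] [LieGroup 𝓘(ℝ, EG) ∞ G] in
theorem mfderiv_act_mem_hor (H : Connection EM G EQ π) {p : Q} {v : EQ} (hv : v ∈ H.hor p)
    (g : G) : (mfderiv 𝓘(ℝ, EQ) 𝓘(ℝ, EQ) (fun q : Q => q <• g) p v : EQ) ∈ H.hor (p <• g) := by
  rw [H.invariant p g]
  exact Submodule.mem_map_of_mem hv

end Connection

/-- Two horizontal curves over the same curve in the base differ by a constant element of `G`. -/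
theorem IsPrincipalBundle.div_eq_of_horizontal [CompleteSpace EG]
    (hπ : IsPrincipalBundle EM EG G EQ π) (H : Connection EM G EQ π)
    {δ δ' : ℝ → Q} {a b : ℝ} (hδ : ContinuousOn δ (Icc a b)) (hδ' : ContinuousOn δ' (Icc a b))
    (F : Finset ℝ)
    (hd : ∀ t ∈ Ioo a b, t ∉ F → MDifferentiableAt 𝓘(ℝ, ℝ) 𝓘(ℝ, EQ) δ t ∧
      mfderiv 𝓘(ℝ, ℝ) 𝓘(ℝ, EQ) δ t (1 : ℝ) ∈ H.hor (δ t))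
    (hd' : ∀ t ∈ Ioo a b, t ∉ F → MDifferentiableAt 𝓘(ℝ, ℝ) 𝓘(ℝ, EQ) δ' t ∧
      mfderiv 𝓘(ℝ, ℝ) 𝓘(ℝ, EQ) δ' t (1 : ℝ) ∈ H.hor (δ' t))
    (hp : ∀ t ∈ Icc a b, π (δ t) = π (δ' t)) {s t : ℝ} (hs : s ∈ Icc a b) (ht : t ∈ Icc a b) :
    hπ.div (δ s) (δ' s) = hπ.div (δ t) (δ' t) := by
  have : IsManifold 𝓘(ℝ, EG) 1 G := IsManifold.of_le (n := ∞) (by norm_cast)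
  -- the difference is smooth on the fibre product `Q ×_M Q`
  have hdiv : ∀ p q : Q, π p = π q → ContMDiffWithinAt (𝓘(ℝ, EQ).prod 𝓘(ℝ, EQ)) 𝓘(ℝ, EG) ∞
      (fun z : Q × Q => hπ.div z.1 z.2) {z | π z.1 = π z.2} (p, q) := fun p q h =>
    hπ.contMDiffWithinAt_div contMDiffWithinAt_fst contMDiffWithinAt_snd
      (eventually_of_mem self_mem_nhdsWithin fun z hz => hz) h
  refine eq_of_hasMFDerivAt_zero (E := EG) (k := fun t => hπ.div (δ t) (δ' t)) ?_ F ?_ hs ht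
  · intro t ht
    exact (hdiv _ _ (hp t ht)).continuousWithinAt.comp (f := fun t => (δ t, δ' t))
      ((hδ t ht).prodMk (hδ' t ht)) fun r hr => hp r hr
  intro t ht htF
  obtain ⟨h1, h1'⟩ := hd t ht htF
  obtain ⟨h2, h2'⟩ := hd' t ht htF
  have hnhds : Icc a b ∈ 𝓝 t := Icc_mem_nhds ht.1 ht.2
  have hk : MDifferentiableAt 𝓘(ℝ, ℝ) 𝓘(ℝ, EG) (fun t => hπ.div (δ t) (δ' t)) t := by
    have := MDifferentiableWithinAt.comp (f := fun t => (δ t, δ' t)) (s := Icc a b) t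
      ((hdiv _ _ (hp t (Ioo_subset_Icc_self ht))).mdifferentiableWithinAt (by simp))
      (h1.prodMk h2).mdifferentiableWithinAt fun r hr => hp r hr
    exact this.mdifferentiableAt hnhds
  have hev : δ' =ᶠ[𝓝 t] fun t => δ t <• hπ.div (δ t) (δ' t) := by
    filter_upwards [hnhds] with r hr using (hπ.act_div (hp r hr)).symm
  have hlei := hπ.mfderiv_act h1 hk (1 : ℝ)
  have heq : δ t <• hπ.div (δ t) (δ' t) = δ' t := hπ.act_div (hp t (Ioo_subset_Icc_self ht))
  rw [← hev.mfderiv_eq] at hlei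
  have hm1 := H.mfderiv_act_mem_hor h1' (hπ.div (δ t) (δ' t))
  rw [heq] at hm1
  have hz : (mfderiv 𝓘(ℝ, EG) 𝓘(ℝ, EQ) (fun g : G => δ t <• g) (hπ.div (δ t) (δ' t))
      (mfderiv 𝓘(ℝ, ℝ) 𝓘(ℝ, EG) (fun t => hπ.div (δ t) (δ' t)) t (1 : ℝ)) : EQ) = 0 := by
    refine H.eq_zero_of_mem_hor (p := δ' t) ?_ ?_
    · have := (H.hor (δ' t)).sub_mem h2' hm1
      rw [eq_sub_of_add_eq' hlei.symm]
      exact this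
    · have := hπ.mfderiv_proj_act_left (δ t) (hπ.div (δ t) (δ' t))
        (mfderiv 𝓘(ℝ, ℝ) 𝓘(ℝ, EG) (fun t => hπ.div (δ t) (δ' t)) t (1 : ℝ))
      rwa [heq] at this
  have h0 := hπ.mfderiv_act_left_injective _ _ hz
  have : mfderiv 𝓘(ℝ, ℝ) 𝓘(ℝ, EG) (fun t => hπ.div (δ t) (δ' t)) t = 0 := by
    refine ContinuousLinearMap.ext_ring ?_
    exact h0
  rw [← this]
  exact hk.hasMFDerivAt

end HorizontalCurves

/-! ### Lie brackets of vector fields related to constant fields -/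

section LieBrackets

open scoped Topology
open Filter VectorField

/-- If two vector fields are mapped by the derivative of `f` to constant fields, then their Lie
bracket is mapped to zero: differentiating `Df(V) = a` along `W` and `Df(W) = b` along `V`, the
difference is `Df([V, W])` by the symmetry of the second derivative. -/
theorem fderiv_lieBracket_eq_zero {E F : Type*} [NormedAddCommGroup E] [NormedSpace ℝ E]
    [NormedAddCommGroup F] [NormedSpace ℝ F] {f : E → F} {V W : E → E} {x : E}
    (hf : ContDiffAt ℝ 2 f x) (hV : DifferentiableAt ℝ V x) (hW : DifferentiableAt ℝ W x)
    {a b : F} (ha : ∀ᶠ y in 𝓝 x, fderiv ℝ f y (V y) = a)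
    (hb : ∀ᶠ y in 𝓝 x, fderiv ℝ f y (W y) = b) :
    fderiv ℝ f x (lieBracket ℝ V W x) = 0 := by
  have hf' : DifferentiableAt ℝ (fderiv ℝ f) x :=
    (hf.fderiv_right (m := 1) (by norm_num)).differentiableAt (by norm_num)
  have key : ∀ {V : E → E} {a : F}, DifferentiableAt ℝ V x →
      (∀ᶠ y in 𝓝 x, fderiv ℝ f y (V y) = a) →
      ∀ w, fderiv ℝ f x (fderiv ℝ V x w) = -(fderiv ℝ (fderiv ℝ f) x w (V x)) := by
    intro V a hV ha w
    have h1 : HasFDerivAt (fun y => fderiv ℝ f y (V y)) (0 : E →L[ℝ] F) x :=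
      (hasFDerivAt_const a x).congr_of_eventuallyEq ha
    have h2 := hf'.hasFDerivAt.clm_apply hV.hasFDerivAt
    have h3 := DFunLike.congr_fun (h2.unique h1) w
    simp only [add_apply, ContinuousLinearMap.comp_apply, ContinuousLinearMap.flip_apply,
      zero_apply] at h3
    exact eq_neg_of_add_eq_zero_left h3
  have hsymm := hf.isSymmSndFDerivAt (by simp)
  rw [lieBracket, map_sub, key hW hb, key hV ha, hsymm.eq (V x) (W x), sub_self]

variable {E F : Type*} [NormedAddCommGroup E] [NormedSpace ℝ E] [FiniteDimensional ℝ E]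
  [NormedAddCommGroup F] [NormedSpace ℝ F]
  {N : Type*} [TopologicalSpace N] [ChartedSpace E N] [IsManifold 𝓘(ℝ, E) ∞ N]

section
omit [FiniteDimensional ℝ E]

theorem contMDiffAt_extChartAt_symm {p : N} {y : E} (hy : y ∈ (extChartAt 𝓘(ℝ, E) p).target) :
    ContMDiffAt 𝓘(ℝ, E) 𝓘(ℝ, E) ∞ (extChartAt 𝓘(ℝ, E) p).symm y :=
  (contMDiffOn_extChartAt_symm p).contMDiffAt ((isOpen_extChartAt_target p).mem_nhds hy)

theorem isInvertible_mfderiv_extChartAt_symm {p : N} {y : E}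
    (hy : y ∈ (extChartAt 𝓘(ℝ, E) p).target) :
    (mfderiv 𝓘(ℝ, E) 𝓘(ℝ, E) (extChartAt 𝓘(ℝ, E) p).symm y).IsInvertible := by
  have : IsManifold 𝓘(ℝ, E) 1 N := IsManifold.of_le (n := ∞) (by norm_cast)
  have := isInvertible_mfderivWithin_extChartAt_symm (I := 𝓘(ℝ, E)) hy
  simpa using this

theorem mfderiv_extChartAt_symm_mpullback {p : N} {y : E}
    (hy : y ∈ (extChartAt 𝓘(ℝ, E) p).target) (X : ∀ q : N, TangentSpace 𝓘(ℝ, E) q) :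
    mfderiv 𝓘(ℝ, E) 𝓘(ℝ, E) (extChartAt 𝓘(ℝ, E) p).symm y
      (mpullback 𝓘(ℝ, E) 𝓘(ℝ, E) (extChartAt 𝓘(ℝ, E) p).symm X y) =
      X ((extChartAt 𝓘(ℝ, E) p).symm y) := by
  obtain ⟨e, he⟩ := isInvertible_mfderiv_extChartAt_symm hy
  rw [mpullback_apply, ← he, ContinuousLinearMap.inverse_equiv]
  exact e.apply_symm_apply _

end

/-- The Lie bracket in a chart. -/
theorem mpullback_extChartAt_symm_mlieBracket {p : N} {y : E}
    (hy : y ∈ (extChartAt 𝓘(ℝ, E) p).target) {X Y : ∀ q : N, TangentSpace 𝓘(ℝ, E) q}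
    (hX : ContMDiffAt 𝓘(ℝ, E) 𝓘(ℝ, E).tangent ∞
      (fun q => (⟨q, X q⟩ : TangentBundle 𝓘(ℝ, E) N)) ((extChartAt 𝓘(ℝ, E) p).symm y))
    (hY : ContMDiffAt 𝓘(ℝ, E) 𝓘(ℝ, E).tangent ∞
      (fun q => (⟨q, Y q⟩ : TangentBundle 𝓘(ℝ, E) N)) ((extChartAt 𝓘(ℝ, E) p).symm y)) :
    mpullback 𝓘(ℝ, E) 𝓘(ℝ, E) (extChartAt 𝓘(ℝ, E) p).symm (mlieBracket 𝓘(ℝ, E) X Y) y =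
      lieBracket ℝ (mpullback 𝓘(ℝ, E) 𝓘(ℝ, E) (extChartAt 𝓘(ℝ, E) p).symm X)
        (mpullback 𝓘(ℝ, E) 𝓘(ℝ, E) (extChartAt 𝓘(ℝ, E) p).symm Y) y := by
  have : CompleteSpace E := FiniteDimensional.complete ℝ E
  have : IsManifold 𝓘(ℝ, E) (minSmoothness ℝ 3) N := IsManifold.of_le (n := ∞) (by simp; norm_cast)
  rw [mpullback_mlieBracket (n := ∞) (hX.mdifferentiableAt (by simp))
    (hY.mdifferentiableAt (by simp)) (contMDiffAt_extChartAt_symm hy) (by simp; norm_cast),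
    ← mlieBracketWithin_univ, mlieBracketWithin_eq_lieBracketWithin]
  exact congrFun lieBracketWithin_univ y

theorem contDiffAt_mpullback_extChartAt_symm {p : N} {y : E}
    (hy : y ∈ (extChartAt 𝓘(ℝ, E) p).target) {X : ∀ q : N, TangentSpace 𝓘(ℝ, E) q}
    (hX : ContMDiffAt 𝓘(ℝ, E) 𝓘(ℝ, E).tangent ∞
      (fun q => (⟨q, X q⟩ : TangentBundle 𝓘(ℝ, E) N)) ((extChartAt 𝓘(ℝ, E) p).symm y)) :
    ContDiffAt ℝ ∞ (mpullback 𝓘(ℝ, E) 𝓘(ℝ, E) (extChartAt 𝓘(ℝ, E) p).symm X : E → E) y := by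
  have : CompleteSpace E := FiniteDimensional.complete ℝ E
  have : IsManifold 𝓘(ℝ, E) (∞ + 1) N := inferInstanceAs (IsManifold 𝓘(ℝ, E) ∞ N)
  have : IsManifold 𝓘(ℝ, E) 1 N := IsManifold.of_le (n := ∞) (by norm_cast)
  rw [← contMDiffAt_vectorSpace_iff_contDiffAt]
  exact ContMDiffAt.mpullback_vectorField_preimage (n := ∞) hX (contMDiffAt_extChartAt_symm hy)
    (isInvertible_mfderiv_extChartAt_symm hy) le_rfl

/-- If two vector fields are mapped by the derivative of a vector-valued function to constants,
then the derivative of the function annihilates their Lie bracket. -/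
theorem mfderiv_mlieBracket_eq_zero {f : N → F} {X Y : ∀ q : N, TangentSpace 𝓘(ℝ, E) q} {p : N}
    (hf : ContMDiffAt 𝓘(ℝ, E) 𝓘(ℝ, F) ∞ f p)
    (hX : ContMDiffAt 𝓘(ℝ, E) 𝓘(ℝ, E).tangent ∞
      (fun q => (⟨q, X q⟩ : TangentBundle 𝓘(ℝ, E) N)) p)
    (hY : ContMDiffAt 𝓘(ℝ, E) 𝓘(ℝ, E).tangent ∞
      (fun q => (⟨q, Y q⟩ : TangentBundle 𝓘(ℝ, E) N)) p)
    {a b : F} (ha : ∀ᶠ q in 𝓝 p, (mfderiv 𝓘(ℝ, E) 𝓘(ℝ, F) f q (X q) : F) = a)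
    (hb : ∀ᶠ q in 𝓝 p, (mfderiv 𝓘(ℝ, E) 𝓘(ℝ, F) f q (Y q) : F) = b) :
    (mfderiv 𝓘(ℝ, E) 𝓘(ℝ, F) f p (mlieBracket 𝓘(ℝ, E) X Y p) : F) = 0 := by
  have : IsManifold 𝓘(ℝ, E) 1 N := IsManifold.of_le (n := ∞) (by norm_cast)
  set ψ := extChartAt 𝓘(ℝ, E) p with hψ
  have hy : ψ p ∈ ψ.target := mem_extChartAt_target p
  have hp : ψ.symm (ψ p) = p := extChartAt_to_inv p
  have hsm := contMDiffAt_extChartAt_symm hy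
  have hcont : Tendsto ψ.symm (𝓝 (ψ p)) (𝓝 p) := by
    have := hsm.continuousAt.tendsto
    rwa [hp] at this
  have key : ∀ {Z : ∀ q : N, TangentSpace 𝓘(ℝ, E) q} {y : E}, y ∈ ψ.target →
      MDifferentiableAt 𝓘(ℝ, E) 𝓘(ℝ, F) f (ψ.symm y) →
      fderiv ℝ (f ∘ ψ.symm) y (mpullback 𝓘(ℝ, E) 𝓘(ℝ, E) ψ.symm Z y) =
        mfderiv 𝓘(ℝ, E) 𝓘(ℝ, F) f (ψ.symm y) (Z (ψ.symm y)) := by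
    intro Z y hy hfy
    have h1 := mfderiv_comp_apply y hfy ((contMDiffAt_extChartAt_symm hy).mdifferentiableAt
      (by simp)) (mpullback 𝓘(ℝ, E) 𝓘(ℝ, E) ψ.symm Z y)
    rw [mfderiv_extChartAt_symm_mpullback hy] at h1
    rw [← h1, mfderiv_eq_fderiv]
    rfl
  have hfd : ∀ᶠ q in 𝓝 p, MDifferentiableAt 𝓘(ℝ, E) 𝓘(ℝ, F) f q := by
    have h1 : ContMDiffAt 𝓘(ℝ, E) 𝓘(ℝ, F) 1 f p := hf.of_le (by norm_cast)
    filter_upwards [(contMDiffAt_iff_contMDiffAt_nhds (by simp)).1 h1] with q hq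
    exact hq.mdifferentiableAt (by simp)
  have hev : ∀ {Z : ∀ q : N, TangentSpace 𝓘(ℝ, E) q} {c : F},
      (∀ᶠ q in 𝓝 p, (mfderiv 𝓘(ℝ, E) 𝓘(ℝ, F) f q (Z q) : F) = c) →
      ∀ᶠ y in 𝓝 (ψ p), fderiv ℝ (f ∘ ψ.symm) y (mpullback 𝓘(ℝ, E) 𝓘(ℝ, E) ψ.symm Z y) = c := by
    intro Z c hc
    filter_upwards [hcont.eventually hc, hcont.eventually hfd,
      (isOpen_extChartAt_target p).mem_nhds hy] with y h1 h2 h3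
    rw [key h3 h2]
    exact h1
  have hfc : ContDiffAt ℝ 2 (f ∘ ψ.symm) (ψ p) := by
    rw [← contMDiffAt_iff_contDiffAt]
    refine ContMDiffAt.comp (I' := 𝓘(ℝ, E)) (ψ p) ?_ (hsm.of_le (by norm_cast))
    rw [hp]
    exact hf.of_le (by norm_cast)
  have hXd := hX
  have hYd := hY
  rw [← hp] at hXd hYd
  have := fderiv_lieBracket_eq_zero hfc
    ((contDiffAt_mpullback_extChartAt_symm hy hXd).differentiableAt (by simp))
    ((contDiffAt_mpullback_extChartAt_symm hy hYd).differentiableAt (by simp)) (hev ha) (hev hb)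
  rw [← mpullback_extChartAt_symm_mlieBracket hy hXd hYd,
    key hy (by rw [hp]; exact hfd.self_of_nhds)] at this
  rwa [hp] at this

end LieBrackets

/-! ### Horizontal sections -/

section FlatSections

open scoped Topology
open Filter VectorField

variable
    {EM : Type*} [NormedAddCommGroup EM] [NormedSpace ℝ EM]
    {M : Type*} [TopologicalSpace M] [ChartedSpace EM M]
    {EG : Type*} [NormedAddCommGroup EG] [NormedSpace ℝ EG]
    {G : Type*} [Group G] [TopologicalSpace G] [ChartedSpace EG G]
    {EQ : Type*} [NormedAddCommGroup EQ] [NormedSpace ℝ EQ]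
    {Q : Type*} [TopologicalSpace Q] [ChartedSpace EQ Q] [IsManifold 𝓘(ℝ, EQ) ∞ Q]
    [MulAction Gᵐᵒᵖ Q] {π : Q → M}

/-- `s` is a horizontal smooth section of `π` over the open set `U`. -/
structure Connection.IsFlatSection (H : Connection EM G EQ π) (s : M → Q) (U : Set M) : Prop where
  isOpen : IsOpen U
  contMDiffOn : ContMDiffOn 𝓘(ℝ, EM) 𝓘(ℝ, EQ) ∞ s U
  proj_apply : ∀ y ∈ U, π (s y) = y
  mfderiv_mem : ∀ y ∈ U, ∀ w : EM, (mfderiv 𝓘(ℝ, EM) 𝓘(ℝ, EQ) s y w : EQ) ∈ H.hor (s y)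

/-- Through every point of `Q` there is a local horizontal section. -/
def Connection.HasFlatSections (H : Connection EM G EQ π) : Prop :=
  ∀ q : Q, ∃ (U : Set M) (s : M → Q), π q ∈ U ∧ s (π q) = q ∧ H.IsFlatSection s U

variable (H : Connection EM G EQ π)

omit [TopologicalSpace G] [ChartedSpace EG G] in
theorem Connection.mfderiv_component (X : ∀ p : Q, TangentSpace 𝓘(ℝ, EQ) p) (q : Q) :
    (mfderiv 𝓘(ℝ, EQ) 𝓘(ℝ, EM) π q (H.horizontalPart X q) : EM) =
      mfderiv 𝓘(ℝ, EQ) 𝓘(ℝ, EM) π q (X q) := by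
  have h : X q - H.horizontalPart X q ∈ verticalSpace EM EQ π q := by
    rw [← Submodule.projectionOnto_apply_eq_zero_iff (H.isCompl q), map_sub]
    exact sub_eq_zero.2 (Submodule.projectionOnto_apply_left (H.isCompl q) _).symm
  have h' := LinearMap.mem_ker.1 h
  rw [map_sub] at h'
  exact (sub_eq_zero.1 h').symm

omit [TopologicalSpace G] [ChartedSpace EG G] in
theorem Connection.horizontalPart_mem (X : ∀ p : Q, TangentSpace 𝓘(ℝ, EQ) p) (q : Q) :
    H.horizontalPart X q ∈ H.hor q :=
  Subtype.property _

omit [TopologicalSpace G] [ChartedSpace EG G] in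
theorem Connection.horizontalPart_eq_self {X : ∀ p : Q, TangentSpace 𝓘(ℝ, EQ) p}
    (hX : ∀ q, X q ∈ H.hor q) : H.horizontalPart X = X := by
  ext q
  exact congrArg Subtype.val (Submodule.projectionOnto_apply_left (H.isCompl q) ⟨X q, hX q⟩)

omit [TopologicalSpace G] [ChartedSpace EG G] in
theorem Connection.curvature_eq_zero_iff (X Y : ∀ p : Q, TangentSpace 𝓘(ℝ, EQ) p) (q : Q) :
    H.curvature X Y q = 0 ↔
      mlieBracket 𝓘(ℝ, EQ) (H.horizontalPart X) (H.horizontalPart Y) q ∈ H.hor q := by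
  rw [← Submodule.projectionOnto_apply_eq_zero_iff (H.isCompl q).symm, ← Submodule.coe_eq_zero]
  exact neg_eq_zero

theorem mfderiv_extChartAt_inverse {E : Type*} [NormedAddCommGroup E] [NormedSpace ℝ E]
    {N : Type*} [TopologicalSpace N] [ChartedSpace E N] [IsManifold 𝓘(ℝ, E) ∞ N]
    {p : N} {y : E} (hy : y ∈ (extChartAt 𝓘(ℝ, E) p).target) (v : E) :
    ((mfderiv 𝓘(ℝ, E) 𝓘(ℝ, E) (extChartAt 𝓘(ℝ, E) p)
      ((extChartAt 𝓘(ℝ, E) p).symm y)).inverse v : E) =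
      mfderiv 𝓘(ℝ, E) 𝓘(ℝ, E) (extChartAt 𝓘(ℝ, E) p).symm y v := by
  have : IsManifold 𝓘(ℝ, E) 1 N := IsManifold.of_le (n := ∞) (by norm_cast)
  have h3 := mfderiv_extChartAt_comp_mfderivWithin_extChartAt_symm (I := 𝓘(ℝ, E)) hy
  have h4 := mfderivWithin_extChartAt_symm_comp_mfderiv_extChartAt (I := 𝓘(ℝ, E)) hy
  have h5 := ContinuousLinearMap.inverse_eq h3 h4
  have h6 := DFunLike.congr_fun h5 v
  simp only [modelWithCornersSelf_coe, range_id, mfderivWithin_univ] at h6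
  exact h6

omit [TopologicalSpace G] [ChartedSpace EG G] in
/-- In a chart of `Q`, the projection to the horizontal space depends smoothly on the point. -/
theorem Connection.exists_chart_projection [FiniteDimensional ℝ EQ] (q₀ : Q) :
    ∃ P : EQ → EQ →L[ℝ] EQ, ContDiffOn ℝ ∞ P (extChartAt 𝓘(ℝ, EQ) q₀).target ∧
      ∀ y ∈ (extChartAt 𝓘(ℝ, EQ) q₀).target, ∀ v : EQ,
        (mfderiv 𝓘(ℝ, EQ) 𝓘(ℝ, EQ) (extChartAt 𝓘(ℝ, EQ) q₀).symm y (P y v) : EQ) ∈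
          H.hor ((extChartAt 𝓘(ℝ, EQ) q₀).symm y) ∧
        (mfderiv 𝓘(ℝ, EQ) 𝓘(ℝ, EM) π ((extChartAt 𝓘(ℝ, EQ) q₀).symm y)
          (mfderiv 𝓘(ℝ, EQ) 𝓘(ℝ, EQ) (extChartAt 𝓘(ℝ, EQ) q₀).symm y (P y v)) : EM) =
        mfderiv 𝓘(ℝ, EQ) 𝓘(ℝ, EM) π ((extChartAt 𝓘(ℝ, EQ) q₀).symm y)
          (mfderiv 𝓘(ℝ, EQ) 𝓘(ℝ, EQ) (extChartAt 𝓘(ℝ, EQ) q₀).symm y v) := by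
  have : CompleteSpace EQ := FiniteDimensional.complete ℝ EQ
  have : IsManifold 𝓘(ℝ, EQ) (∞ + 1) Q := inferInstanceAs (IsManifold 𝓘(ℝ, EQ) ∞ Q)
  have : IsManifold 𝓘(ℝ, EQ) 1 Q := IsManifold.of_le (n := ∞) (by norm_cast)
  set ψ := extChartAt 𝓘(ℝ, EQ) q₀ with hψ
  -- the constant vector fields of the chart
  set C : EQ → ∀ p : Q, TangentSpace 𝓘(ℝ, EQ) p := fun v =>
    mpullback 𝓘(ℝ, EQ) 𝓘(ℝ, EQ) ψ (fun _ => v) with hC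
  have hCsm : ∀ v, SmoothFieldOn (C v) ψ.source := by
    intro v p hp
    have hv : ContMDiffAt 𝓘(ℝ, EQ) 𝓘(ℝ, EQ).tangent ∞
        (fun y => (⟨y, v⟩ : TangentBundle 𝓘(ℝ, EQ) EQ)) (ψ p) :=
      contMDiffAt_vectorSpace_iff_contDiffAt.2 contDiffAt_const
    exact (ContMDiffAt.mpullback_vectorField_preimage (n := ∞) hv
      (contMDiffAt_extChartAt' (by rwa [hψ, extChartAt_source] at hp))
      (isInvertible_mfderiv_extChartAt hp) le_rfl).contMDiffWithinAt
  set D : EQ → EQ → EQ := fun y v =>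
    mpullback 𝓘(ℝ, EQ) 𝓘(ℝ, EQ) ψ.symm (H.horizontalPart (C v)) y with hD
  have hDsm : ∀ v, ContDiffOn ℝ ∞ (fun y => D y v) ψ.target := by
    intro v y hy
    have h1 : SmoothFieldOn (H.horizontalPart (C v)) ψ.source :=
      H.smooth _ (isOpen_extChartAt_source q₀) _ (hCsm v)
    exact (contDiffAt_mpullback_extChartAt_symm hy (h1.contMDiffAt
      ((isOpen_extChartAt_source q₀).mem_nhds (ψ.map_target hy)))).contDiffWithinAt
  -- `D y` is linear
  set P : EQ → EQ →L[ℝ] EQ := fun y => LinearMap.toContinuousLinearMap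
    (((mfderiv 𝓘(ℝ, EQ) 𝓘(ℝ, EQ) ψ.symm y).inverse.toLinearMap ∘ₗ
      ((H.hor (ψ.symm y)).subtype ∘ₗ (H.hor (ψ.symm y)).projectionOnto
        (verticalSpace EM EQ π (ψ.symm y)) (H.isCompl (ψ.symm y)))) ∘ₗ
      (mfderiv 𝓘(ℝ, EQ) 𝓘(ℝ, EQ) ψ (ψ.symm y)).inverse.toLinearMap : EQ →ₗ[ℝ] EQ) with hP
  have hPD : ∀ y v, P y v = D y v := fun y v => rfl
  refine ⟨P, contDiffOn_clm_apply.2 fun v => hDsm v, fun y hy v => ?_⟩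
  have h1 : (mfderiv 𝓘(ℝ, EQ) 𝓘(ℝ, EQ) ψ.symm y (P y v) : EQ) =
      H.horizontalPart (C v) (ψ.symm y) :=
    mfderiv_extChartAt_symm_mpullback hy (H.horizontalPart (C v))
  have h2 : (C v (ψ.symm y) : EQ) = mfderiv 𝓘(ℝ, EQ) 𝓘(ℝ, EQ) ψ.symm y v :=
     mfderiv_extChartAt_inverse hy v
  constructor
  · rw [h1]
    exact Subtype.property _
  · rw [h1, ← h2]
    exact H.mfderiv_component (C v) (ψ.symm y)

end FlatSections

/-! ### Horizontal lifts of coordinate fields -/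

section FlatImpliesSections

open scoped Topology
open Filter VectorField

variable
    {EM : Type*} [NormedAddCommGroup EM] [NormedSpace ℝ EM] [FiniteDimensional ℝ EM]
    {M : Type*} [TopologicalSpace M] [ChartedSpace EM M] [IsManifold 𝓘(ℝ, EM) ∞ M]
    {EG : Type*} [NormedAddCommGroup EG] [NormedSpace ℝ EG]
    {G : Type*} [Group G] [TopologicalSpace G] [ChartedSpace EG G]
    {EQ : Type*} [NormedAddCommGroup EQ] [NormedSpace ℝ EQ] [FiniteDimensional ℝ EQ]
    {Q : Type*} [TopologicalSpace Q] [ChartedSpace EQ Q] [IsManifold 𝓘(ℝ, EQ) ∞ Q]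
    [MulAction Gᵐᵒᵖ Q] {π : Q → M}

theorem fderiv_apply_of_hasMFDerivAt {E F : Type*} [NormedAddCommGroup E] [NormedSpace ℝ E]
    [NormedAddCommGroup F] [NormedSpace ℝ F] {f : E → F} {x : E} {L : E →L[ℝ] F}
    (h : HasMFDerivAt 𝓘(ℝ, E) 𝓘(ℝ, F) f x L) (v : E) : fderiv ℝ f x v = L v := by
  have h' : HasFDerivAt f L x := h.hasFDerivAt
  rw [h'.fderiv]

/-- In charts `ψ` of `Q` and `φ` of `M`, the horizontal lifts `h y a` of the constant vector fields
`a` of `φ` depend smoothly on `y`. With `P` the horizontal projection, `T = D(φ ∘ π ∘ ψ⁻¹)` and `R`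
a right inverse of `T` at the given point, they are `P ∘ R ∘ (T ∘ R)⁻¹`. -/
theorem Connection.exists_horizontal_lift (H : Connection EM G EQ π)
    (hπ : IsPrincipalBundle EM EG G EQ π) (q₀ : Q) :
    ∃ (V : Set EQ) (h : EQ → EM →L[ℝ] EQ), IsOpen V ∧ extChartAt 𝓘(ℝ, EQ) q₀ q₀ ∈ V ∧
      V ⊆ (extChartAt 𝓘(ℝ, EQ) q₀).target ∧
      (∀ y ∈ V, π ((extChartAt 𝓘(ℝ, EQ) q₀).symm y) ∈ (extChartAt 𝓘(ℝ, EM) (π q₀)).source) ∧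
      ContDiffOn ℝ ∞ h V ∧ ∀ y ∈ V, ∀ a : EM,
        (mfderiv 𝓘(ℝ, EQ) 𝓘(ℝ, EQ) (extChartAt 𝓘(ℝ, EQ) q₀).symm y (h y a) : EQ) ∈
          H.hor ((extChartAt 𝓘(ℝ, EQ) q₀).symm y) ∧
        fderiv ℝ (fun y => extChartAt 𝓘(ℝ, EM) (π q₀) (π ((extChartAt 𝓘(ℝ, EQ) q₀).symm y))) y
          (h y a) = a := by
  have : CompleteSpace EM := FiniteDimensional.complete ℝ EM
  have : IsManifold 𝓘(ℝ, EM) 1 M := IsManifold.of_le (n := ∞) (by norm_cast)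
  obtain ⟨P, hPsm, hP⟩ := H.exists_chart_projection q₀
  set ψ := extChartAt 𝓘(ℝ, EQ) q₀ with hψ
  set φ := extChartAt 𝓘(ℝ, EM) (π q₀) with hφ
  set f : EQ → EM := fun y => φ (π (ψ.symm y)) with hf
  have hy₀ : ψ q₀ ∈ ψ.target := mem_extChartAt_target q₀
  have hq₀ : ψ.symm (ψ q₀) = q₀ := extChartAt_to_inv q₀
  have hcont : ContinuousOn (fun y => π (ψ.symm y)) ψ.target :=
    hπ.contMDiff_proj.continuous.comp_continuousOn (continuousOn_extChartAt_symm q₀)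
  have hV₁ : IsOpen (ψ.target ∩ (fun y => π (ψ.symm y)) ⁻¹' φ.source) :=
    hcont.isOpen_inter_preimage (isOpen_extChartAt_target q₀) (isOpen_extChartAt_source _)
  set V₁ := ψ.target ∩ (fun y => π (ψ.symm y)) ⁻¹' φ.source with hV₁def
  have hyV₁ : ψ q₀ ∈ V₁ := ⟨hy₀, by
    simp only [mem_preimage, hq₀]; exact mem_extChartAt_source _⟩
  have hφd : ∀ x ∈ φ.source, ContMDiffAt 𝓘(ℝ, EM) 𝓘(ℝ, EM) ∞ φ x := fun x hx =>
    contMDiffAt_extChartAt' (by rwa [hφ, extChartAt_source] at hx)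
  have hfsm : ContDiffOn ℝ ∞ f V₁ := by
    intro y hy
    refine ContDiffAt.contDiffWithinAt ?_
    rw [← contMDiffAt_iff_contDiffAt]
    exact (hφd _ hy.2).comp y ((hπ.contMDiff_proj _).comp y (contMDiffAt_extChartAt_symm hy.1))
  -- the chain rule for `f`
  have hchain : ∀ y ∈ V₁, ∀ v : EQ, (fderiv ℝ f y v : EM) =
      mfderiv 𝓘(ℝ, EM) 𝓘(ℝ, EM) φ (π (ψ.symm y)) (mfderiv 𝓘(ℝ, EQ) 𝓘(ℝ, EM) π (ψ.symm y)
        (mfderiv 𝓘(ℝ, EQ) 𝓘(ℝ, EQ) ψ.symm y v)) := by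
    intro y hy v
    have h1 := (contMDiffAt_extChartAt_symm hy.1).mdifferentiableAt (by simp)
    have h2 := hπ.mdifferentiableAt_proj (ψ.symm y)
    have h3 := (hφd _ hy.2).mdifferentiableAt (by simp)
    have h4 := (h3.hasMFDerivAt.comp (ψ.symm y) h2.hasMFDerivAt).comp y h1.hasMFDerivAt
    exact fderiv_apply_of_hasMFDerivAt h4 v
  have hsurj : Function.Surjective (fderiv ℝ f (ψ q₀)) := by
    intro a
    obtain ⟨e, he⟩ := isInvertible_mfderiv_extChartAt (I := 𝓘(ℝ, EM)) hyV₁.2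
    obtain ⟨e', he'⟩ := isInvertible_mfderiv_extChartAt_symm hy₀
    obtain ⟨v, hv⟩ := hπ.mfderiv_proj_surjective (ψ.symm (ψ q₀)) (e.symm a)
    obtain ⟨w, hw⟩ : ∃ w : EQ, (mfderiv 𝓘(ℝ, EQ) 𝓘(ℝ, EQ) ψ.symm (ψ q₀) w : EQ) = v :=
      ⟨e'.symm v, (DFunLike.congr_fun he'.symm _).trans (e'.apply_symm_apply v)⟩
    have h2 := hchain _ hyV₁ w
    rw [hw, hv] at h2
    exact ⟨w, h2.trans ((DFunLike.congr_fun he.symm _).trans (e.apply_symm_apply a))⟩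
  obtain ⟨R, hR⟩ := ContinuousLinearMap.exists_rightInverse_of_surjective (fderiv ℝ f (ψ q₀))
    (LinearMap.range_eq_top.2 hsurj)
  set A : EQ → EM →L[ℝ] EM := fun y => (fderiv ℝ f y) ∘L R with hA
  have hf'sm : ContDiffOn ℝ ∞ (fderiv ℝ f) V₁ := hfsm.fderiv_of_isOpen hV₁ (by simp)
  have hAsm : ContDiffOn ℝ ∞ A V₁ := hf'sm.clm_comp contDiffOn_const
  have hV : IsOpen (V₁ ∩ A ⁻¹' range ((↑) : (EM ≃L[ℝ] EM) → EM →L[ℝ] EM)) :=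
    hAsm.continuousOn.isOpen_inter_preimage hV₁ ContinuousLinearEquiv.isOpen
  refine ⟨_, fun y => P y ∘L R ∘L (A y).inverse, hV, ⟨hyV₁, ?_⟩, fun y hy => hy.1.1,
    fun y hy => hy.1.2, ?_, ?_⟩
  · exact ⟨ContinuousLinearEquiv.refl ℝ EM, hR.symm⟩
  · refine (hPsm.mono fun y hy => hy.1.1).clm_comp (contDiffOn_const.clm_comp ?_)
    rintro y ⟨hy, e, he⟩
    refine ContDiffAt.contDiffWithinAt ?_
    have h1 : ContDiffAt ℝ ∞ ContinuousLinearMap.inverse (A y) := by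
      rw [← he]; exact contDiffAt_map_inverse e
    exact h1.comp y (hAsm.contDiffAt (hV₁.mem_nhds hy))
  · rintro y ⟨hy, e, he⟩ a
    refine ⟨(hP y hy.1 _).1, ?_⟩
    have h1 := (hP y hy.1 (R ((A y).inverse a))).2
    change fderiv ℝ f y (P y (R ((A y).inverse a))) = a
    have h2 : fderiv ℝ f y (P y (R ((A y).inverse a))) = fderiv ℝ f y (R ((A y).inverse a)) := by
      rw [hchain y hy, hchain y hy]
      exact congrArg _ h1
    rw [h2]
    change A y ((A y).inverse a) = a
    rw [← he, ContinuousLinearMap.inverse_equiv]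
    exact e.apply_symm_apply a

omit [FiniteDimensional ℝ EM] in
/-- The horizontal lifts of constant vector fields of a chart of `M` commute if the connection is
flat: their bracket is vertical, since they are `π`-related to commuting fields, and it is
horizontal by flatness. -/
theorem Connection.IsFlat.fderiv_lift_symm [T2Space Q] {H : Connection EM G EQ π}
    (hH : H.IsFlat) (hπ : IsPrincipalBundle EM EG G EQ π) {q₀ : Q} {V : Set EQ}
    {h : EQ → EM →L[ℝ] EQ} (hV : IsOpen V) (hVt : V ⊆ (extChartAt 𝓘(ℝ, EQ) q₀).target)
    (hVs : ∀ y ∈ V, π ((extChartAt 𝓘(ℝ, EQ) q₀).symm y) ∈ (extChartAt 𝓘(ℝ, EM) (π q₀)).source)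
    (hsm : ContDiffOn ℝ ∞ h V)
    (hmem : ∀ y ∈ V, ∀ a : EM,
      (mfderiv 𝓘(ℝ, EQ) 𝓘(ℝ, EQ) (extChartAt 𝓘(ℝ, EQ) q₀).symm y (h y a) : EQ) ∈
        H.hor ((extChartAt 𝓘(ℝ, EQ) q₀).symm y))
    (hlift : ∀ y ∈ V, ∀ a : EM,
      fderiv ℝ (fun y => extChartAt 𝓘(ℝ, EM) (π q₀) (π ((extChartAt 𝓘(ℝ, EQ) q₀).symm y))) y
        (h y a) = a) {y : EQ} (hy : y ∈ V) (a b : EM) :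
    fderiv ℝ h y (h y a) b = fderiv ℝ h y (h y b) a := by
  have : CompleteSpace EQ := FiniteDimensional.complete ℝ EQ
  have : IsManifold 𝓘(ℝ, EM) 1 M := IsManifold.of_le (n := ∞) (by norm_cast)
  have : IsManifold 𝓘(ℝ, EQ) 1 Q := IsManifold.of_le (n := ∞) (by norm_cast)
  have : IsManifold 𝓘(ℝ, EQ) (∞ + 1) Q := inferInstanceAs (IsManifold 𝓘(ℝ, EQ) ∞ Q)
  set ψ := extChartAt 𝓘(ℝ, EQ) q₀ with hψ
  set φ := extChartAt 𝓘(ℝ, EM) (π q₀) with hφ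
  set p := ψ.symm y with hp
  have hWo : IsOpen (ψ.source ∩ ψ ⁻¹' V) :=
    (continuousOn_extChartAt q₀).isOpen_inter_preimage (isOpen_extChartAt_source q₀) hV
  have hpW : p ∈ ψ.source ∩ ψ ⁻¹' V :=
    ⟨ψ.map_target (hVt hy), by rw [mem_preimage, hp, ψ.right_inv (hVt hy)]; exact hy⟩
  obtain ⟨χ, -, hχ⟩ := (SmoothBumpFunction.nhds_basis_tsupport (I := 𝓘(ℝ, EQ)) p).mem_iff.1
    (hWo.mem_nhds hpW)
  -- the lifts as fields on `Q`, and their extensions by a bump function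
  set Y : EM → ∀ q : Q, TangentSpace 𝓘(ℝ, EQ) q := fun a =>
    mpullback 𝓘(ℝ, EQ) 𝓘(ℝ, EQ) ψ (fun y => h y a) with hY
  set X : EM → ∀ q : Q, TangentSpace 𝓘(ℝ, EQ) q := fun a => (χ : Q → ℝ) • Y a with hX
  have hYsm : ∀ a, SmoothFieldOn (Y a) (ψ.source ∩ ψ ⁻¹' V) := by
    intro a q hq
    have hv : ContMDiffAt 𝓘(ℝ, EQ) 𝓘(ℝ, EQ).tangent ∞
        (fun y => (⟨y, h y a⟩ : TangentBundle 𝓘(ℝ, EQ) EQ)) (ψ q) :=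
      contMDiffAt_vectorSpace_iff_contDiffAt.2
        ((hsm.clm_apply contDiffOn_const).contDiffAt (hV.mem_nhds hq.2))
    exact (ContMDiffAt.mpullback_vectorField_preimage (n := ∞) hv
      (contMDiffAt_extChartAt' (by have := hq.1; rwa [hψ, extChartAt_source] at this))
      (isInvertible_mfderiv_extChartAt hq.1) le_rfl).contMDiffWithinAt
  have hYeq : ∀ a, ∀ q ∈ ψ.source ∩ ψ ⁻¹' V,
      (Y a q : EQ) = mfderiv 𝓘(ℝ, EQ) 𝓘(ℝ, EQ) ψ.symm (ψ q) (h (ψ q) a) := by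
    intro a q hq
    have := mfderiv_extChartAt_inverse (hVt hq.2) (h (ψ q) a)
    rwa [← hψ, ψ.left_inv hq.1] at this
  have hXsm : ∀ a, SmoothFieldOn (X a) univ := fun a => by
    have := ContMDiffOn.smul_section_of_tsupport (χ.contMDiff.contMDiffOn) hWo hχ (hYsm a)
    exact this.contMDiffOn
  have hXhor : ∀ a q, X a q ∈ H.hor q := by
    intro a q
    by_cases hq : q ∈ ψ.source ∩ ψ ⁻¹' V
    · refine (H.hor q).smul_mem _ ?_
      have h1 := hmem (ψ q) hq.2 a
      rw [ψ.left_inv hq.1] at h1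
      have h2 := hYeq a q hq
      exact Set.mem_of_eq_of_mem h2 h1
    · have : χ q = 0 := image_eq_zero_of_notMem_tsupport fun hq' => hq (hχ hq')
      have : X a q = 0 := by
        change χ q • Y a q = 0
        rw [this, zero_smul]
      rw [this]
      exact zero_mem _
  have hXY : ∀ a, ∀ᶠ q in 𝓝 p, X a q = Y a q ∧ q ∈ ψ.source ∩ ψ ⁻¹' V := by
    intro a
    filter_upwards [χ.eventuallyEq_one, hWo.mem_nhds hpW] with q hq hq'
    refine ⟨?_, hq'⟩
    change χ q • Y a q = Y a q
    rw [hq, Pi.one_apply, one_smul]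
  have hXp : ∀ a, ContMDiffAt 𝓘(ℝ, EQ) 𝓘(ℝ, EQ).tangent ∞
      (fun q => (⟨q, X a q⟩ : TangentBundle 𝓘(ℝ, EQ) Q)) p := fun a =>
    (hXsm a).contMDiffAt univ_mem
  set Z := mlieBracket 𝓘(ℝ, EQ) (X a) (X b) p with hZ
  have hZhor : Z ∈ H.hor p := by
    have := (H.curvature_eq_zero_iff _ _ p).1 (hH (X a) (X b) (hXsm a) (hXsm b) p)
    rwa [H.horizontalPart_eq_self (hXhor a), H.horizontalPart_eq_self (hXhor b)] at this
  have hπp : π p ∈ φ.source := hVs y hy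
  have hφd : ∀ x ∈ φ.source, ContMDiffAt 𝓘(ℝ, EM) 𝓘(ℝ, EM) ∞ φ x := fun x hx =>
    contMDiffAt_extChartAt' (by rwa [hφ, extChartAt_source] at hx)
  have hfd : ∀ q, π q ∈ φ.source → ContMDiffAt 𝓘(ℝ, EQ) 𝓘(ℝ, EM) ∞ (φ ∘ π) q := fun q hq =>
    (hφd _ hq).comp q (hπ.contMDiff_proj q)
  have hrel : ∀ a, ∀ᶠ q in 𝓝 p, (mfderiv 𝓘(ℝ, EQ) 𝓘(ℝ, EM) (φ ∘ π) q (X a q) : EM) = a := by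
    intro a
    filter_upwards [hXY a] with q hq
    have hq2 := hVs _ hq.2.2
    have h1 := (hfd q (by rwa [ψ.left_inv hq.2.1] at hq2)).mdifferentiableAt (by simp)
    have h2 := (contMDiffAt_extChartAt_symm (hVt hq.2.2)).mdifferentiableAt (by simp)
    have h3 : MDifferentiableAt 𝓘(ℝ, EQ) 𝓘(ℝ, EM) (φ ∘ π) (ψ.symm (ψ q)) := by
      rwa [ψ.left_inv hq.2.1]
    have h5 := fderiv_apply_of_hasMFDerivAt (h3.hasMFDerivAt.comp (ψ q) h2.hasMFDerivAt)
      (h (ψ q) a)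
    have h6 := hlift (ψ q) hq.2.2 a
    have h7 := h5.symm.trans h6
    rw [hq.1]
    have h8 := hYeq a q hq.2
    rw [h8]
    have h9 : ψ.symm (ψ q) = q := ψ.left_inv hq.2.1
    rw [← hψ, h9] at h7
    exact h7
  have hZ0 : Z = 0 := by
    refine H.eq_zero_of_mem_hor hZhor ?_
    have h1 := mfderiv_mlieBracket_eq_zero (hfd p hπp) (hXp a) (hXp b) (hrel a) (hrel b)
    have h2 := mfderiv_comp_apply p ((hφd _ hπp).mdifferentiableAt (by simp))
      (hπ.mdifferentiableAt_proj p) Z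
    obtain ⟨e, he⟩ := isInvertible_mfderiv_extChartAt (I := 𝓘(ℝ, EM)) hπp
    rw [← he] at h2
    exact e.map_eq_zero_iff.1 (h2.symm.trans h1)
  have hbr := mpullback_extChartAt_symm_mlieBracket (hVt hy) (hXp a) (hXp b)
  have hbr0 : mpullback 𝓘(ℝ, EQ) 𝓘(ℝ, EQ) ψ.symm (mlieBracket 𝓘(ℝ, EQ) (X a) (X b)) y = 0 := by
    rw [mpullback_apply]
    exact (congrArg (mfderiv 𝓘(ℝ, EQ) 𝓘(ℝ, EQ) ψ.symm y).inverse hZ0).trans (map_zero _)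
  have hpull : ∀ a, (mpullback 𝓘(ℝ, EQ) 𝓘(ℝ, EQ) ψ.symm (X a) : EQ → EQ) =ᶠ[𝓝 y]
      fun y => h y a := by
    intro a
    have hc : Tendsto ψ.symm (𝓝 y) (𝓝 p) :=
      (contMDiffAt_extChartAt_symm (hVt hy)).continuousAt.tendsto
    filter_upwards [hc.eventually (hXY a), hV.mem_nhds hy] with z hz hzV
    obtain ⟨e, he⟩ := isInvertible_mfderiv_extChartAt_symm (hVt hzV)
    have h1 := hYeq a _ hz.2
    rw [ψ.right_inv (hVt hzV)] at h1
    have h2 : ∀ v : EQ, ((mfderiv 𝓘(ℝ, EQ) 𝓘(ℝ, EQ) ψ.symm z).inverse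
        (mfderiv 𝓘(ℝ, EQ) 𝓘(ℝ, EQ) ψ.symm z v) : EQ) = v := fun v => by
      have h3 : mfderiv 𝓘(ℝ, EQ) 𝓘(ℝ, EQ) ψ.symm z = e := he.symm
      rw [h3, ContinuousLinearMap.inverse_equiv]
      exact e.symm_apply_apply v
    exact (congrArg (mfderiv 𝓘(ℝ, EQ) 𝓘(ℝ, EQ) ψ.symm z).inverse (hz.1.trans h1)).trans
      (h2 (h z a))
  rw [hbr0] at hbr
  have hbr' : lieBracket ℝ (fun y => h y a) (fun y => h y b) y = 0 := by
    rw [← (hpull a).lieBracket_vectorField_eq (hpull b)]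
    exact hbr.symm
  have hd : HasFDerivAt h (fderiv ℝ h y) y :=
    ((hsm.contDiffAt (hV.mem_nhds hy)).differentiableAt (by simp)).hasFDerivAt
  have hda : ∀ c w, fderiv ℝ (fun y => h y c) y w = fderiv ℝ h y w c := by
    intro c w
    rw [(hd.clm_apply (hasFDerivAt_const c y)).fderiv]
    simp
  rw [lieBracket, hda, hda] at hbr'
  exact sub_eq_zero.1 hbr'

end FlatImpliesSections

/-! ### Flatness and local horizontal sections -/

section FlatIffSections

open scoped Topology
open Filter VectorField

variable
    {EM : Type*} [NormedAddCommGroup EM] [NormedSpace ℝ EM]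
    {M : Type*} [TopologicalSpace M] [ChartedSpace EM M]
    {EG : Type*} [NormedAddCommGroup EG] [NormedSpace ℝ EG]
    {G : Type*} [Group G] [TopologicalSpace G] [ChartedSpace EG G]
    {EQ : Type*} [NormedAddCommGroup EQ] [NormedSpace ℝ EQ] [FiniteDimensional ℝ EQ]
    {Q : Type*} [TopologicalSpace Q] [T2Space Q] [ChartedSpace EQ Q] [IsManifold 𝓘(ℝ, EQ) ∞ Q]
    [MulAction Gᵐᵒᵖ Q] {π : Q → M}

/-- Frobenius' theorem for a flat connection. In charts, a horizontal section is a solution `u` of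
the total differential equation `du = h(u)`, where `h` lifts tangent vectors horizontally. -/
theorem Connection.IsFlat.hasFlatSections [FiniteDimensional ℝ EM] [IsManifold 𝓘(ℝ, EM) ∞ M]
    {H : Connection EM G EQ π} (hH : H.IsFlat) (hπ : IsPrincipalBundle EM EG G EQ π) :
    H.HasFlatSections := by
  have : CompleteSpace EQ := FiniteDimensional.complete ℝ EQ
  intro q₀
  obtain ⟨V, h, hV, hqV, hVt, hVs, hsm, hlift⟩ := H.exists_horizontal_lift hπ q₀
  obtain ⟨ε, hε, u, hu0, hmaps, husm, hu⟩ := exists_solution_total_differential_equation hV hsm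
    (fun y hy a b => hH.fderiv_lift_symm hπ hV hVt hVs hsm (fun y hy a => (hlift y hy a).1)
      (fun y hy a => (hlift y hy a).2) hy a b) hqV
  set ψ := extChartAt 𝓘(ℝ, EQ) q₀ with hψ
  set φ := extChartAt 𝓘(ℝ, EM) (π q₀) with hφ
  have hq₀ : ψ.symm (ψ q₀) = q₀ := extChartAt_to_inv q₀
  have hφd : ∀ x ∈ φ.source, ContMDiffAt 𝓘(ℝ, EM) 𝓘(ℝ, EM) ∞ φ x := fun x hx =>
    contMDiffAt_extChartAt' (by rwa [hφ, extChartAt_source] at hx)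
  -- `u` is a section of `f` up to the translation by `φ (π q₀)`
  set f : EQ → EM := fun y => φ (π (ψ.symm y)) with hf
  have hfd : ∀ y ∈ V, DifferentiableAt ℝ f y := by
    intro y hy
    rw [← mdifferentiableAt_iff_differentiableAt]
    exact (((hφd _ (hVs y hy)).comp y ((hπ.contMDiff_proj _).comp y
      (contMDiffAt_extChartAt_symm (hVt hy)))).mdifferentiableAt (by simp))
  have hfu : ∀ z ∈ Metric.ball (0 : EM) ε, f (u z) = φ (π q₀) + z := by
    have hd : ∀ z ∈ Metric.ball (0 : EM) ε, HasFDerivAt (fun z => f (u z) - z)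
        (0 : EM →L[ℝ] EM) z := by
      intro z hz
      have h1 := ((hfd _ (hmaps hz)).hasFDerivAt.comp z (hu z hz)).sub (hasFDerivAt_id z)
      refine h1.congr_fderiv ?_
      ext a
      have := (hlift _ (hmaps hz) a).2
      simpa [sub_eq_zero] using this
    intro z hz
    have h1 := Metric.isOpen_ball.is_const_of_fderiv_eq_zero (𝕜 := ℝ)
      (convex_ball (0 : EM) ε).isPreconnected
      (fun z hz => (hd z hz).differentiableAt.differentiableWithinAt)
      (fun z hz => (hd z hz).fderiv) hz (Metric.mem_ball_self hε)
    have h2 : f (u 0) = φ (π q₀) := by rw [hu0, hf]; simp only [hq₀]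
    rw [h2, sub_zero] at h1
    rw [← h1]; abel
  set U : Set M := φ.source ∩ φ ⁻¹' Metric.ball (φ (π q₀)) ε with hU
  have hUo : IsOpen U :=
    (continuousOn_extChartAt _).isOpen_inter_preimage (isOpen_extChartAt_source _)
      Metric.isOpen_ball
  have hUball : ∀ x ∈ U, φ x - φ (π q₀) ∈ Metric.ball (0 : EM) ε := fun x hx => by
    have := hx.2
    rwa [mem_preimage, mem_ball_iff_norm, ← mem_ball_zero_iff] at this
  have hsms : ∀ x ∈ U, ContMDiffAt 𝓘(ℝ, EM) 𝓘(ℝ, EM) ∞ (fun x => φ x - φ (π q₀)) x :=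
    fun x hx => (hφd x hx.1).sub contMDiffAt_const
  have husm' : ∀ x ∈ U, ContMDiffAt 𝓘(ℝ, EM) 𝓘(ℝ, EQ) ∞ u (φ x - φ (π q₀)) := fun x hx =>
    (husm.contDiffAt (Metric.isOpen_ball.mem_nhds (hUball x hx))).contMDiffAt
  have hψsm : ∀ x ∈ U, ContMDiffAt 𝓘(ℝ, EQ) 𝓘(ℝ, EQ) ∞ ψ.symm (u (φ x - φ (π q₀))) :=
    fun x hx => contMDiffAt_extChartAt_symm (hVt (hmaps (hUball x hx)))
  refine ⟨U, fun x => ψ.symm (u (φ x - φ (π q₀))), ⟨mem_extChartAt_source _,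
    Metric.mem_ball_self hε⟩, ?_, hUo, ?_, ?_, ?_⟩
  · simp only [sub_self, hu0, hq₀]
  · intro x hx
    exact ((hψsm x hx).comp x ((husm' x hx).comp x (hsms x hx))).contMDiffWithinAt
  · intro x hx
    refine φ.injOn (hVs _ (hmaps (hUball x hx))) hx.1 ?_
    have := hfu _ (hUball x hx)
    rwa [add_sub_cancel] at this
  · intro x hx w
    have h1 := ((hψsm x hx).mdifferentiableAt (by simp)).hasMFDerivAt.comp x
      ((hu _ (hUball x hx)).hasMFDerivAt.comp x
        ((hsms x hx).mdifferentiableAt (by simp)).hasMFDerivAt)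
    have h2 := DFunLike.congr_fun h1.mfderiv w
    exact Set.mem_of_eq_of_mem h2 (hlift _ (hmaps (hUball x hx)) _).1

omit [FiniteDimensional ℝ EQ] [T2Space Q] in
/-- The fibre coordinate `c` defined by `q = s (π q) <• c q`, for a horizontal section `s`. A
tangent vector is horizontal if and only if `dc` kills it. -/
theorem Connection.IsFlatSection.mfderiv_div_eq_zero_iff [LieGroup 𝓘(ℝ, EG) ∞ G]
    {H : Connection EM G EQ π}
    {s : M → Q} {U : Set M} (hs : H.IsFlatSection s U) (hπ : IsPrincipalBundle EM EG G EQ π)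
    {q : Q} (hq : π q ∈ U) (v : EQ) :
    (mfderiv 𝓘(ℝ, EQ) 𝓘(ℝ, EG) (fun q => hπ.div (s (π q)) q) q v : EG) = 0 ↔ v ∈ H.hor q := by
  have hUo : π ⁻¹' U ∈ 𝓝 q := (hs.isOpen.preimage hπ.contMDiff_proj.continuous).mem_nhds hq
  have hsπ : ContMDiffAt 𝓘(ℝ, EQ) 𝓘(ℝ, EQ) ∞ (fun q => s (π q)) q :=
    (hs.contMDiffOn.contMDiffAt (hs.isOpen.mem_nhds hq)).comp q (hπ.contMDiff_proj q)
  have hc : ContMDiffAt 𝓘(ℝ, EQ) 𝓘(ℝ, EG) ∞ (fun q => hπ.div (s (π q)) q) q :=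
    hπ.contMDiffAt_div hsπ contMDiffAt_id (by
      filter_upwards [hUo] with p hp using hs.proj_apply _ hp)
  have hev : (id : Q → Q) =ᶠ[𝓝 q] fun q => s (π q) <• hπ.div (s (π q)) q := by
    filter_upwards [hUo] with p hp using (hπ.act_div (hs.proj_apply _ hp)).symm
  have heq : s (π q) <• hπ.div (s (π q)) q = q := hev.self_of_nhds.symm
  have hlei := hπ.mfderiv_act (hsπ.mdifferentiableAt (by simp)) (hc.mdifferentiableAt (by simp)) v
  rw [← hev.mfderiv_eq, mfderiv_id] at hlei
  have h1 : (mfderiv 𝓘(ℝ, EQ) 𝓘(ℝ, EQ) (fun q => s (π q)) q v : EQ) ∈ H.hor (s (π q)) := by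
    have := mfderiv_comp_apply q (g := s) (f := π)
      ((hs.contMDiffOn.contMDiffAt (hs.isOpen.mem_nhds hq)).mdifferentiableAt (by simp))
      (hπ.mdifferentiableAt_proj q) v
    exact Set.mem_of_eq_of_mem this (hs.mfderiv_mem _ hq _)
  have h2 := H.mfderiv_act_mem_hor h1 (hπ.div (s (π q)) q)
  rw [heq] at h2
  constructor
  · intro h0
    have h3 : (mfderiv 𝓘(ℝ, EG) 𝓘(ℝ, EQ) (fun g : G => s (π q) <• g) (hπ.div (s (π q)) q)
        (mfderiv 𝓘(ℝ, EQ) 𝓘(ℝ, EG) (fun q => hπ.div (s (π q)) q) q v) : EQ) = 0 :=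
      (congrArg _ h0).trans (map_zero _)
    rw [h3, add_zero] at hlei
    exact Set.mem_of_eq_of_mem hlei h2
  · intro hv
    refine hπ.mfderiv_act_left_injective (s (π q)) (hπ.div (s (π q)) q)
      (H.eq_zero_of_mem_hor (p := q) ?_ ?_)
    · exact Set.mem_of_eq_of_mem (eq_sub_of_add_eq' hlei.symm) ((H.hor q).sub_mem hv h2)
    · have := hπ.mfderiv_proj_act_left (s (π q)) (hπ.div (s (π q)) q)
        (mfderiv 𝓘(ℝ, EQ) 𝓘(ℝ, EG) (fun q => hπ.div (s (π q)) q) q v)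
      rwa [heq] at this

omit [T2Space Q] in
/-- A connection with local horizontal sections is flat: the fibre coordinate relative to a
horizontal section is constant along horizontal fields, hence along their bracket. -/
theorem Connection.HasFlatSections.isFlat [LieGroup 𝓘(ℝ, EG) ∞ G]
    {H : Connection EM G EQ π} (hH : H.HasFlatSections)
    (hπ : IsPrincipalBundle EM EG G EQ π) : H.IsFlat := by
  have : CompleteSpace EQ := FiniteDimensional.complete ℝ EQ
  have : IsManifold 𝓘(ℝ, EG) ∞ G := inferInstance
  have : IsManifold 𝓘(ℝ, EG) 1 G := IsManifold.of_le (n := ∞) (by norm_cast)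
  intro X Y hX hY p
  rw [H.curvature_eq_zero_iff]
  obtain ⟨U, s, hpU, -, hs⟩ := hH p
  have hUo : π ⁻¹' U ∈ 𝓝 p := (hs.isOpen.preimage hπ.contMDiff_proj.continuous).mem_nhds hpU
  have hsm : ∀ {X : ∀ p : Q, TangentSpace 𝓘(ℝ, EQ) p}, SmoothFieldOn X univ →
      ContMDiffAt 𝓘(ℝ, EQ) 𝓘(ℝ, EQ).tangent ∞
        (fun q => (⟨q, H.horizontalPart X q⟩ : TangentBundle 𝓘(ℝ, EQ) Q)) p := fun hX =>
    (H.smooth univ isOpen_univ _ hX).contMDiffAt univ_mem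
  set c : Q → G := fun q => hπ.div (s (π q)) q with hc
  have hcsm : ∀ q, π q ∈ U → ContMDiffAt 𝓘(ℝ, EQ) 𝓘(ℝ, EG) ∞ c q := by
    intro q hq
    refine hπ.contMDiffAt_div ((hs.contMDiffOn.contMDiffAt (hs.isOpen.mem_nhds hq)).comp q
      (hπ.contMDiff_proj q)) contMDiffAt_id ?_
    filter_upwards [(hs.isOpen.preimage hπ.contMDiff_proj.continuous).mem_nhds hq] with q hq
    exact hs.proj_apply _ hq
  set φ := extChartAt 𝓘(ℝ, EG) (c p) with hφ
  have hφd : ∀ x ∈ φ.source, ContMDiffAt 𝓘(ℝ, EG) 𝓘(ℝ, EG) ∞ φ x := fun x hx =>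
    contMDiffAt_extChartAt' (by rwa [hφ, extChartAt_source] at hx)
  have hcp : c p ∈ φ.source := mem_extChartAt_source _
  have hev : ∀ᶠ q in 𝓝 p, π q ∈ U ∧ c q ∈ φ.source :=
    (eventually_of_mem hUo fun q hq => hq).and
      ((hcsm p hpU).continuousAt.eventually ((isOpen_extChartAt_source _).mem_nhds hcp))
  have hcomp : ∀ q, π q ∈ U → c q ∈ φ.source → ∀ v : EQ,
      (mfderiv 𝓘(ℝ, EQ) 𝓘(ℝ, EG) (φ ∘ c) q v : EG) =
        mfderiv 𝓘(ℝ, EG) 𝓘(ℝ, EG) φ (c q) (mfderiv 𝓘(ℝ, EQ) 𝓘(ℝ, EG) c q v) := fun q h1 h2 v =>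
    mfderiv_comp_apply q ((hφd _ h2).mdifferentiableAt (by simp))
      ((hcsm q h1).mdifferentiableAt (by simp)) v
  have hzero : ∀ X : (∀ p : Q, TangentSpace 𝓘(ℝ, EQ) p), ∀ᶠ q in 𝓝 p,
      (mfderiv 𝓘(ℝ, EQ) 𝓘(ℝ, EG) (φ ∘ c) q (H.horizontalPart X q) : EG) = 0 := by
    intro X
    filter_upwards [hev] with q hq
    refine (hcomp q hq.1 hq.2 _).trans ?_
    have := (hs.mfderiv_div_eq_zero_iff hπ hq.1 _).2 (H.horizontalPart_mem X q)
    exact (congrArg _ this).trans (map_zero _)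
  have h1 := mfderiv_mlieBracket_eq_zero (a := (0 : EG)) (b := (0 : EG))
    ((hφd _ hcp).comp p (hcsm p hpU)) (hsm hX) (hsm hY) (hzero X) (hzero Y)
  have h2 := (hcomp p hpU hcp _).symm.trans h1
  obtain ⟨e, he⟩ := isInvertible_mfderiv_extChartAt (I := 𝓘(ℝ, EG)) hcp
  rw [← he] at h2
  exact (hs.mfderiv_div_eq_zero_iff hπ hpU _).1 (e.map_eq_zero_iff.1 h2)

end FlatIffSections

/-! ### Neighbourhoods diffeomorphic to a vector space -/

section Parametrizations

open scoped Topology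
open Filter

variable {E : Type*} [NormedAddCommGroup E] [NormedSpace ℝ E]
  {EM : Type*} [NormedAddCommGroup EM] [NormedSpace ℝ EM]
  {M : Type*} [TopologicalSpace M] [ChartedSpace EM M]

/-- `θ` is a diffeomorphism, with inverse `κ`, of the whole vector space `E` onto the open subset
`U` of the manifold `M`. Straight line segments of `E` then give paths in `U`. -/
structure IsParametrization (θ : E → M) (κ : M → E) (U : Set M) : Prop where
  isOpen : IsOpen U
  contMDiff : ContMDiff 𝓘(ℝ, E) 𝓘(ℝ, EM) ∞ θ
  contMDiffOn : ContMDiffOn 𝓘(ℝ, EM) 𝓘(ℝ, E) ∞ κ U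
  mem : ∀ z, θ z ∈ U
  left_inv : ∀ z, κ (θ z) = z
  right_inv : ∀ y ∈ U, θ (κ y) = y

/-- Every point of a manifold has arbitrarily small neighbourhoods diffeomorphic to the model
space: a ball in a chart is diffeomorphic to the whole space. -/
theorem exists_isParametrization {E : Type*} [NormedAddCommGroup E] [InnerProductSpace ℝ E]
    [IsManifold 𝓘(ℝ, EM) ∞ M] (e : EM ≃L[ℝ] E) (x : M) {W : Set M} (hW : W ∈ 𝓝 x) :
    ∃ (θ : E → M) (κ : M → E) (U : Set M),
      IsParametrization (EM := EM) θ κ U ∧ U ⊆ W ∧ x ∈ U ∧ θ 0 = x := by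
  set φ := extChartAt 𝓘(ℝ, EM) x with hφ
  set c := e (φ x) with hc
  have hec : e.symm c = φ x := e.symm_apply_apply _
  have hnhds : e.symm ⁻¹' (φ.target ∩ φ.symm ⁻¹' W) ∈ 𝓝 c := by
    refine e.symm.continuous.continuousAt ?_
    rw [hec]
    refine inter_mem ((isOpen_extChartAt_target x).mem_nhds (mem_extChartAt_target x)) ?_
    refine (continuousAt_extChartAt_symm x) ?_
    rwa [← hφ, hφ, extChartAt_to_inv]
  obtain ⟨r, hr, hball⟩ := Metric.mem_nhds_iff.1 hnhds
  have hmem : ∀ z : E, OpenPartialHomeomorph.univBall c r z ∈ Metric.ball c r := fun z => by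
    have := (OpenPartialHomeomorph.univBall c r).map_source (x := z) (by simp)
    rwa [OpenPartialHomeomorph.univBall_target c hr] at this
  have hright : ∀ z ∈ Metric.ball c r, OpenPartialHomeomorph.univBall c r
      ((OpenPartialHomeomorph.univBall c r).symm z) = z := fun z hz =>
    (OpenPartialHomeomorph.univBall c r).right_inv
      (by rwa [OpenPartialHomeomorph.univBall_target c hr])
  have hφd : ∀ y ∈ φ.source, ContMDiffAt 𝓘(ℝ, EM) 𝓘(ℝ, EM) ∞ φ y := fun y hy =>
    contMDiffAt_extChartAt' (by rwa [hφ, extChartAt_source] at hy)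
  refine ⟨fun z => φ.symm (e.symm (OpenPartialHomeomorph.univBall c r z)),
    fun y => (OpenPartialHomeomorph.univBall c r).symm (e (φ y)),
    φ.source ∩ φ ⁻¹' (e ⁻¹' Metric.ball c r), ⟨?_, ?_, ?_, ?_, ?_, ?_⟩, ?_, ?_, ?_⟩
  · exact (continuousOn_extChartAt _).isOpen_inter_preimage (isOpen_extChartAt_source _)
      (Metric.isOpen_ball.preimage e.continuous)
  · intro z
    refine (contMDiffAt_extChartAt_symm (hball (hmem z)).1).comp z ?_
    exact (e.symm.contDiff.comp OpenPartialHomeomorph.contDiff_univBall).contMDiff z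
  · rintro y ⟨hy, hy'⟩
    have h1 : ContMDiffAt 𝓘(ℝ, EM) 𝓘(ℝ, E) ∞ (fun y => e (φ y)) y :=
      e.contDiff.contMDiff.contMDiffAt.comp y (hφd y hy)
    have h2 : ContMDiffAt 𝓘(ℝ, E) 𝓘(ℝ, E) ∞ (OpenPartialHomeomorph.univBall c r).symm
        (e (φ y)) :=
      (OpenPartialHomeomorph.contDiffOn_univBall_symm.contDiffAt
        (Metric.isOpen_ball.mem_nhds hy')).contMDiffAt
    exact (h2.comp y h1).contMDiffWithinAt
  · intro z
    refine ⟨φ.map_target (hball (hmem z)).1, ?_⟩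
    simp only [mem_preimage, φ.right_inv (hball (hmem z)).1, e.apply_symm_apply]
    exact hmem z
  · intro z
    simp only [φ.right_inv (hball (hmem z)).1, e.apply_symm_apply]
    exact (OpenPartialHomeomorph.univBall c r).left_inv (by simp)
  · rintro y ⟨hy, hy'⟩
    simp only [hright _ hy', e.symm_apply_apply, φ.left_inv hy]
  · rintro y ⟨hy, hy'⟩
    have := (hball hy').2
    rwa [mem_preimage, e.symm_apply_apply, φ.left_inv hy] at this
  · exact ⟨mem_extChartAt_source x, Metric.mem_ball_self hr⟩
  · simp only [OpenPartialHomeomorph.univBall_apply_zero, hec]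
    exact extChartAt_to_inv x

end Parametrizations

/-! ### The leaf topology of a flat connection -/

section FlatCovering

open scoped Topology
open Filter

variable
    {EM : Type*} [NormedAddCommGroup EM] [NormedSpace ℝ EM]
    {M : Type*} [TopologicalSpace M] [ChartedSpace EM M]
    {EG : Type*} [NormedAddCommGroup EG] [NormedSpace ℝ EG]
    {G : Type*} [Group G] [TopologicalSpace G] [ChartedSpace EG G] [LieGroup 𝓘(ℝ, EG) ∞ G]
    {EQ : Type*} [NormedAddCommGroup EQ] [NormedSpace ℝ EQ]
    {Q : Type*} [TopologicalSpace Q] [ChartedSpace EQ Q] [IsManifold 𝓘(ℝ, EQ) ∞ Q]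
    [MulAction Gᵐᵒᵖ Q] {π : Q → M} {H : Connection EM G EQ π}

namespace Connection.IsFlatSection

theorem act (hπ : IsPrincipalBundle EM EG G EQ π) {s : M → Q} {U : Set M}
    (hs : H.IsFlatSection s U) (g : G) : H.IsFlatSection (fun y => s y <• g) U where
  isOpen := hs.isOpen
  contMDiffOn := (hπ.contMDiff_act_right g).comp_contMDiffOn hs.contMDiffOn
  proj_apply y hy := (hπ.proj_act _ g).trans (hs.proj_apply y hy)
  mfderiv_mem y hy w := by
    have h1 := mfderiv_comp_apply y (g := fun q : Q => q <• g) (f := s)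
      (hπ.mdifferentiableAt_act_right g (s y))
      ((hs.contMDiffOn.contMDiffAt (hs.isOpen.mem_nhds hy)).mdifferentiableAt (by simp)) w
    exact Set.mem_of_eq_of_mem h1 (H.mfderiv_act_mem_hor (hs.mfderiv_mem y hy w) g)

omit [TopologicalSpace G] [ChartedSpace EG G] [LieGroup 𝓘(ℝ, EG) ∞ G] in
theorem mfderiv_comp_mem_hor {s : M → Q} {U : Set M} (hs : H.IsFlatSection s U) {γ : ℝ → M}
    {t : ℝ} (hγ : MDifferentiableAt 𝓘(ℝ, ℝ) 𝓘(ℝ, EM) γ t) (ht : γ t ∈ U) :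
    MDifferentiableAt 𝓘(ℝ, ℝ) 𝓘(ℝ, EQ) (s ∘ γ) t ∧
      mfderiv 𝓘(ℝ, ℝ) 𝓘(ℝ, EQ) (s ∘ γ) t (1 : ℝ) ∈ H.hor (s (γ t)) := by
  have h1 : MDifferentiableAt 𝓘(ℝ, EM) 𝓘(ℝ, EQ) s (γ t) :=
    (hs.contMDiffOn.contMDiffAt (hs.isOpen.mem_nhds ht)).mdifferentiableAt (by simp)
  refine ⟨h1.comp t hγ, ?_⟩
  have h2 := mfderiv_comp_apply t h1 hγ (1 : ℝ)
  exact Set.mem_of_eq_of_mem h2 (hs.mfderiv_mem _ ht _)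

/-- Two horizontal sections differ locally by a constant element of `G`. -/
theorem eventually_eq_act [FiniteDimensional ℝ EM] [IsManifold 𝓘(ℝ, EM) ∞ M] [CompleteSpace EG]
    (hπ : IsPrincipalBundle EM EG G EQ π) {s s' : M → Q}
    {U U' : Set M} (hs : H.IsFlatSection s U) (hs' : H.IsFlatSection s' U') {x : M}
    (hx : x ∈ U) (hx' : x ∈ U') : ∀ᶠ y in 𝓝 x, s' y = s y <• hπ.div (s x) (s' x) := by
  obtain ⟨θ, κ, W, hθ, hWU, hxW, hθ0⟩ := exists_isParametrization (toEuclidean (E := EM)) x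
    (inter_mem (hs.isOpen.mem_nhds hx) (hs'.isOpen.mem_nhds hx'))
  filter_upwards [hθ.isOpen.mem_nhds hxW] with y hy
  -- compare the two sections along the segment from `x` to `y`
  set γ : ℝ → M := fun t => θ (t • κ y) with hγ
  have hγsm : ContMDiff 𝓘(ℝ, ℝ) 𝓘(ℝ, EM) ∞ γ :=
    hθ.contMDiff.comp (contDiff_id.smul contDiff_const).contMDiff
  have hγU : ∀ t, γ t ∈ U ∩ U' := fun t => hWU (hθ.mem _)
  have h0 : γ 0 = x := by rw [hγ]; simp only [zero_smul, hθ0]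
  have h1 : γ 1 = y := by rw [hγ]; simp only [one_smul, hθ.right_inv y hy]
  have hd : ∀ t, MDifferentiableAt 𝓘(ℝ, ℝ) 𝓘(ℝ, EM) γ t := fun t =>
    (hγsm t).mdifferentiableAt (by simp)
  have key := hπ.div_eq_of_horizontal H (δ := s ∘ γ) (δ' := s' ∘ γ) (a := 0) (b := 1)
    (fun t _ => (hs.mfderiv_comp_mem_hor (hd t) (hγU t).1).1.continuousAt.continuousWithinAt)
    (fun t _ => (hs'.mfderiv_comp_mem_hor (hd t) (hγU t).2).1.continuousAt.continuousWithinAt) ∅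
    (fun t _ _ => hs.mfderiv_comp_mem_hor (hd t) (hγU t).1)
    (fun t _ _ => hs'.mfderiv_comp_mem_hor (hd t) (hγU t).2)
    (fun t _ => (hs.proj_apply _ (hγU t).1).trans (hs'.proj_apply _ (hγU t).2).symm)
    (left_mem_Icc.2 zero_le_one) (right_mem_Icc.2 zero_le_one)
  simp only [Function.comp, h0, h1] at key
  have hy' := h1 ▸ hγU 1
  rw [key, hπ.act_div ((hs.proj_apply _ hy'.1).trans (hs'.proj_apply _ hy'.2).symm)]

end Connection.IsFlatSection

/-- The leaf topology of a connection on the total space: a set is open if its preimage under every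
local horizontal section is open. -/
@[reducible] def Connection.leafTopology (H : Connection EM G EQ π) : TopologicalSpace Q where
  IsOpen A := ∀ (s : M → Q) (U : Set M), H.IsFlatSection s U → IsOpen (U ∩ s ⁻¹' A)
  isOpen_univ s U hs := by simpa using hs.isOpen
  isOpen_inter A B hA hB s U hs := by
    rw [preimage_inter, inter_inter_distrib_left]
    exact (hA s U hs).inter (hB s U hs)
  isOpen_sUnion T hT s U hs := by
    rw [preimage_sUnion, inter_iUnion₂]
    exact isOpen_biUnion fun A hA => hT A hA s U hs

/-- The total space `Q` with the leaf topology of a connection. -/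
def Connection.Leaf (_ : Connection EM G EQ π) : Type _ := Q

instance : TopologicalSpace H.Leaf := H.leafTopology

omit [TopologicalSpace G] [ChartedSpace EG G] [LieGroup 𝓘(ℝ, EG) ∞ G] in
theorem Connection.isOpen_leaf_iff {A : Set H.Leaf} :
    IsOpen A ↔ ∀ (s : M → Q) (U : Set M), H.IsFlatSection s U → IsOpen (U ∩ s ⁻¹' A) := Iff.rfl

/-- A copy of `G` with the discrete topology: the fibre of the covering defined by the leaf
topology, without the manifold topology of `G`. -/
def DiscreteCopy (G : Type*) : Type _ := G

instance : TopologicalSpace (DiscreteCopy G) := ⊥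

instance : DiscreteTopology (DiscreteCopy G) := ⟨rfl⟩

/-- The translates of a horizontal section are open sheets in the leaf topology. -/
theorem Connection.IsFlatSection.isOpen_div_eq [FiniteDimensional ℝ EM] [IsManifold 𝓘(ℝ, EM) ∞ M]
    [CompleteSpace EG] (hπ : IsPrincipalBundle EM EG G EQ π) {s : M → Q} {U : Set M}
    (hs : H.IsFlatSection s U) (g : G) :
    IsOpen ({q : Q | π q ∈ U ∧ hπ.div (s (π q)) q = g} : Set H.Leaf) := by
  rw [Connection.isOpen_leaf_iff]
  intro s' U' hs'
  rw [isOpen_iff_mem_nhds]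
  rintro x ⟨hx', hx, hg⟩
  rw [hs'.proj_apply x hx'] at hx hg
  filter_upwards [hs.eventually_eq_act hπ hs' hx hx', hs.isOpen.mem_nhds hx,
    hs'.isOpen.mem_nhds hx'] with y hy hyU hyU'
  refine ⟨hyU', ?_, ?_⟩
  · rwa [hs'.proj_apply y hyU']
  · rw [hs'.proj_apply y hyU', hy, hπ.div_act, hg]

/-- In the leaf topology of a flat connection, `Q` is a covering space of `M`. -/
theorem Connection.HasFlatSections.isCoveringMap [FiniteDimensional ℝ EM]
    [IsManifold 𝓘(ℝ, EM) ∞ M] [CompleteSpace EG] (hH : H.HasFlatSections)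
    (hπ : IsPrincipalBundle EM EG G EQ π) : IsCoveringMap (fun q : H.Leaf => π q) := by
  have hcont : Continuous (fun q : H.Leaf => π q) := by
    refine continuous_def.2 fun O hO => Connection.isOpen_leaf_iff.2 fun s U hs => ?_
    have : U ∩ s ⁻¹' (π ⁻¹' O) = U ∩ O := by
      ext y
      refine and_congr_right fun hy => ?_
      change π (s y) ∈ O ↔ y ∈ O
      rw [hs.proj_apply y hy]
    exact this ▸ hs.isOpen.inter hO
  intro x
  obtain ⟨e, hx, -⟩ := hπ.locally_trivial x
  obtain ⟨U, s, hxU, -, hs⟩ := hH (e.toOpenPartialHomeomorph.symm (x, 1))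
  have hπe : π (e.toOpenPartialHomeomorph.symm (x, 1)) = x :=
    e.proj_symm_apply (e.mem_target.2 hx)
  rw [hπe] at hxU
  -- over `U`, the covering is `U × G` with `G` discrete, by `q = s (π q) <• g`
  let v : DiscreteCopy G → G := fun g => g
  refine IsEvenlyCovered.to_isEvenlyCovered_preimage (I := DiscreteCopy G)
    ⟨inferInstance, U, hxU, hs.isOpen, hs.isOpen.preimage hcont, ?_⟩
  refine ⟨{ toFun := fun q => (⟨π q.1, q.2⟩, hπ.div (s (π q.1)) q.1)
            invFun := fun z => ⟨s z.1 <• v z.2, ?_⟩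
            left_inv := ?_
            right_inv := ?_
            continuous_toFun := ?_
            continuous_invFun := ?_ }, fun q => rfl⟩
  · change π (s z.1 <• v z.2) ∈ U
    rw [hπ.proj_act, hs.proj_apply _ z.1.2]
    exact z.1.2
  · rintro ⟨q, hq⟩
    exact Subtype.ext (hπ.act_div (hs.proj_apply _ hq))
  · rintro ⟨⟨y, hy⟩, g⟩
    have h1 : π (s y <• v g) = y := by rw [hπ.proj_act, hs.proj_apply y hy]
    refine Prod.ext (Subtype.ext h1) ?_
    change hπ.div (s (π (s y <• v g))) (s y <• v g) = g
    rw [h1, hπ.div_act]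
  · refine ((hcont.comp continuous_subtype_val).subtype_mk _).prodMk
      (continuous_discrete_rng.2 fun g => ?_)
    convert! (hs.isOpen_div_eq hπ g).preimage continuous_subtype_val using 1
    ext q
    exact (and_iff_right q.2).symm
  · refine Continuous.subtype_mk (continuous_prod_of_discrete_right.2 fun g => ?_) _
    refine continuous_def.2 fun A hA => ?_
    have := (Connection.isOpen_leaf_iff.1 hA) _ _ (hs.act hπ g)
    convert! this.preimage continuous_subtype_val using 1
    ext y
    exact (and_iff_right y.2).symm

end FlatCovering

/-! ### Lifts to the leaf covering -/

section LeafLifts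

open scoped Topology
open Filter

variable
    {EM : Type*} [NormedAddCommGroup EM] [NormedSpace ℝ EM]
    {M : Type*} [TopologicalSpace M] [ChartedSpace EM M]
    {EG : Type*} [NormedAddCommGroup EG] [NormedSpace ℝ EG]
    {G : Type*} [Group G] [TopologicalSpace G] [ChartedSpace EG G] [LieGroup 𝓘(ℝ, EG) ∞ G]
    {EQ : Type*} [NormedAddCommGroup EQ] [NormedSpace ℝ EQ]
    {Q : Type*} [TopologicalSpace Q] [ChartedSpace EQ Q] [IsManifold 𝓘(ℝ, EQ) ∞ Q]
    [MulAction Gᵐᵒᵖ Q] {π : Q → M} {H : Connection EM G EQ π}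
    {A : Type*} [TopologicalSpace A] {C : Type*} [TopologicalSpace C]

/-- Continuity on `B` with respect to the leaf topology of `H`: the map stays in one leaf as long as
it moves continuously. -/
def Connection.LeafContinuousOn (H : Connection EM G EQ π) (F : A → Q) (B : Set A) : Prop :=
  @ContinuousOn A H.Leaf _ _ F B

namespace Connection.LeafContinuousOn

omit [TopologicalSpace G] [ChartedSpace EG G] [LieGroup 𝓘(ℝ, EG) ∞ G]

theorem const (q : Q) (B : Set A) : H.LeafContinuousOn (fun _ => q) B :=
  @continuousOn_const A H.Leaf _ _ B q

theorem mono {F : A → Q} {B B' : Set A} (hF : H.LeafContinuousOn F B) (h : B' ⊆ B) :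
    H.LeafContinuousOn F B' := ContinuousOn.mono hF h

theorem comp {F : A → Q} {B : Set A} (hF : H.LeafContinuousOn F B) {α : C → A} {D : Set C}
    (hα : ContinuousOn α D) (h : MapsTo α D B) : H.LeafContinuousOn (fun c => F (α c)) D :=
  ContinuousOn.comp hF hα h

end Connection.LeafContinuousOn

theorem Connection.LeafContinuousOn.act (hπ : IsPrincipalBundle EM EG G EQ π) {F : A → Q}
    {B : Set A} (hF : H.LeafContinuousOn F B) (g : G) :
    H.LeafContinuousOn (fun a => F a <• g) B := by
  have h : @Continuous H.Leaf H.Leaf _ _ (fun q : Q => q <• g) :=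
    continuous_def.2 fun O hO => Connection.isOpen_leaf_iff.2 fun s U hs =>
      Connection.isOpen_leaf_iff.1 hO _ _ (hs.act hπ g)
  exact h.comp_continuousOn hF

variable [FiniteDimensional ℝ EM] [IsManifold 𝓘(ℝ, EM) ∞ M] [CompleteSpace EG]

namespace Connection.LeafContinuousOn

/-- Locally, a leaf-continuous map is the composition of its projection to `M` with a horizontal
section. -/
theorem exists_section_eq (hH : H.HasFlatSections) (hπ : IsPrincipalBundle EM EG G EQ π)
    {F : A → Q} {B : Set A} (hF : H.LeafContinuousOn F B) {a : A} (ha : a ∈ B) :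
    ∃ (s : M → Q) (U : Set M), H.IsFlatSection s U ∧ π (F a) ∈ U ∧ s (π (F a)) = F a ∧
      ∀ᶠ b in 𝓝[B] a, s (π (F b)) = F b := by
  obtain ⟨U, s, hU, hsa, hs⟩ := hH (F a)
  refine ⟨s, U, hs, hU, hsa, ?_⟩
  have hopen := hs.isOpen_div_eq hπ (1 : G)
  filter_upwards [(hF a ha).eventually_mem (hopen.mem_nhds
    ⟨hU, by rw [hsa, hπ.div_self]⟩)] with b hb
  have h1 := hπ.act_div (hs.proj_apply _ hb.1)
  rwa [hb.2, act_one] at h1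

variable {E' H' : Type*} [NormedAddCommGroup E'] [NormedSpace ℝ E'] [TopologicalSpace H']
  {I : ModelWithCorners ℝ E' H'} {N : Type*} [TopologicalSpace N] [ChartedSpace H' N]

theorem contMDiffWithinAt (hH : H.HasFlatSections) (hπ : IsPrincipalBundle EM EG G EQ π)
    {F : N → Q} {B : Set N} (hF : H.LeafContinuousOn F B) {a : N} (ha : a ∈ B)
    (h : ContMDiffWithinAt I 𝓘(ℝ, EM) ∞ (fun x => π (F x)) B a) :
    ContMDiffWithinAt I 𝓘(ℝ, EQ) ∞ F B a := by
  obtain ⟨s, U, hs, hU, hsa, hev⟩ := hF.exists_section_eq hH hπ ha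
  refine ContMDiffWithinAt.congr_of_eventuallyEq (f := fun x => s (π (F x))) ?_
    (hev.mono fun b hb => hb.symm) hsa.symm
  exact (hs.contMDiffOn.contMDiffAt (hs.isOpen.mem_nhds hU)).comp_contMDiffWithinAt a h

theorem mfderiv_mem_hor (hH : H.HasFlatSections) (hπ : IsPrincipalBundle EM EG G EQ π)
    {F : ℝ → Q} (hF : H.LeafContinuousOn F univ) {t : ℝ}
    (h : MDifferentiableAt 𝓘(ℝ, ℝ) 𝓘(ℝ, EQ) F t) :
    mfderiv 𝓘(ℝ, ℝ) 𝓘(ℝ, EQ) F t (1 : ℝ) ∈ H.hor (F t) := by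
  obtain ⟨s, U, hs, hU, hsa, hev⟩ := hF.exists_section_eq hH hπ (mem_univ t)
  rw [nhdsWithin_univ] at hev
  have h1 := (hs.mfderiv_comp_mem_hor (γ := fun t => π (F t))
    ((hπ.mdifferentiableAt_proj (F t)).comp t h) hU).2
  have h2 : s ∘ (fun t => π (F t)) =ᶠ[𝓝 t] F := hev
  rw [h2.mfderiv_eq] at h1
  exact hsa ▸ h1

/-- Uniqueness of lifts to the covering space `H.Leaf`. -/
theorem eqOn (hH : H.HasFlatSections) (hπ : IsPrincipalBundle EM EG G EQ π)
    {F F' : A → Q} {B : Set A} (hF : H.LeafContinuousOn F B) (hF' : H.LeafContinuousOn F' B)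
    (hB : IsPreconnected B) (h : ∀ a ∈ B, π (F a) = π (F' a)) {a : A} (ha : a ∈ B)
    (haa : F a = F' a) : EqOn F F' B :=
  (hH.isCoveringMap hπ).eqOn_of_comp_eqOn (g₁ := F) (g₂ := F') hB hF hF' h ha haa

end Connection.LeafContinuousOn

/-- Existence of lifts to the covering space `H.Leaf`. -/
theorem Connection.HasFlatSections.exists_lift [SimplyConnectedSpace A]
    [LocallyPathConnectedSpace A] (hH : H.HasFlatSections) (hπ : IsPrincipalBundle EM EG G EQ π)
    {f : A → M} (hf : Continuous f) (a₀ : A) {q₀ : Q} (h : π q₀ = f a₀) :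
    ∃ F : A → Q, H.LeafContinuousOn F univ ∧ F a₀ = q₀ ∧ ∀ a, π (F a) = f a := by
  obtain ⟨F, ⟨h1, h2⟩, -⟩ := (hH.isCoveringMap hπ).existsUnique_continuousMap_lifts
    ⟨f, hf⟩ a₀ q₀ h
  exact ⟨F, continuousOn_univ.2 F.continuous, h1, fun a => congrFun h2 a⟩

end LeafLifts

/-! ### Parallel transport of a flat connection -/

section FlatTransport

open scoped Topology
open Filter

variable
    {EM : Type*} [NormedAddCommGroup EM] [NormedSpace ℝ EM] [FiniteDimensional ℝ EM]
    {M : Type*} [TopologicalSpace M] [ChartedSpace EM M] [IsManifold 𝓘(ℝ, EM) ∞ M]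
    {EG : Type*} [NormedAddCommGroup EG] [NormedSpace ℝ EG] [CompleteSpace EG]
    {G : Type*} [Group G] [TopologicalSpace G] [ChartedSpace EG G] [LieGroup 𝓘(ℝ, EG) ∞ G]
    {EQ : Type*} [NormedAddCommGroup EQ] [NormedSpace ℝ EQ]
    {Q : Type*} [TopologicalSpace Q] [ChartedSpace EQ Q] [IsManifold 𝓘(ℝ, EQ) ∞ Q]
    [MulAction Gᵐᵒᵖ Q] {π : Q → M} {H : Connection EM G EQ π}
    (hH : H.HasFlatSections) (hπ : IsPrincipalBundle EM EG G EQ π)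

namespace Connection.HasFlatSections

/-- The lift of a path `γ` starting at `q`, for a connection with local horizontal sections. -/
noncomputable def pathLift (γ : PSPath EM M) {q : Q} (hq : π q = γ.start) : ℝ → Q :=
  (hH.exists_lift hπ γ.continuous γ.a hq).choose

variable (γ : PSPath EM M) {q : Q} (hq : π q = γ.start)

theorem leafContinuousOn_pathLift (B : Set ℝ) :
    H.LeafContinuousOn (hH.pathLift hπ γ hq) B :=
  (hH.exists_lift hπ γ.continuous γ.a hq).choose_spec.1.mono (subset_univ _)

theorem pathLift_left : hH.pathLift hπ γ hq γ.a = q :=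
  (hH.exists_lift hπ γ.continuous γ.a hq).choose_spec.2.1

theorem proj_pathLift (t : ℝ) : π (hH.pathLift hπ γ hq t) = γ t :=
  (hH.exists_lift hπ γ.continuous γ.a hq).choose_spec.2.2 t

theorem eq_pathLift {F : ℝ → Q} (hF : H.LeafContinuousOn F (Icc γ.a γ.b))
    (hp : ∀ t ∈ Icc γ.a γ.b, π (F t) = γ t) (h0 : F γ.a = q) :
    ∀ t ∈ Icc γ.a γ.b, F t = hH.pathLift hπ γ hq t :=
  hF.eqOn hH hπ (hH.leafContinuousOn_pathLift hπ γ hq _) isPreconnected_Icc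
    (fun t ht => (hp t ht).trans (hH.proj_pathLift hπ γ hq t).symm)
    (left_mem_Icc.2 γ.lt.le) (h0.trans (hH.pathLift_left hπ γ hq).symm)

/-- Lifting a smooth family of paths amounts to lifting one map from `S × ℝ`, locally in `S`. -/
theorem contMDiff_pathLift {n : ℕ} {S : Type} [TopologicalSpace S]
    [ChartedSpace (EuclideanSpace ℝ (Fin n)) S] [IsManifold (𝓡 n) ∞ S]
    {γ : S → PSPath EM M} (hγ : PSPath.IsSmoothFamily (n := n) γ)
    {σ : S → Q} (hσ : ∀ s, π (σ s) = (γ s).start) (hσs : ContMDiff (𝓡 n) 𝓘(ℝ, EQ) ∞ σ) :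
    ContMDiff (𝓡 n) 𝓘(ℝ, EQ) ∞ (fun s => hH.pathLift hπ (γ s) (hσ s) (γ s).b) := by
  obtain ⟨a, b, F, hab, hF⟩ := hγ
  intro s₀
  have hlt : a < b := by have := (γ s₀).lt; rwa [(hab s₀).1, (hab s₀).2] at this
  obtain ⟨θ, κ, U, hθ, -, hs₀, hθ0⟩ := exists_isParametrization
    (ContinuousLinearEquiv.refl ℝ (EuclideanSpace ℝ (Fin n))) s₀ univ_mem
  -- the family in the coordinates `θ` on `S`
  set f : EuclideanSpace ℝ (Fin n) × ℝ → M := fun z => γ (θ z.1) z.2 with hf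
  have hfpiece : ∀ c d, a ≤ c → c < d → d ≤ b → Disjoint (F : Set ℝ) (Ioo c d) →
      ContMDiffOn ((𝓡 n).prod 𝓘(ℝ, ℝ)) 𝓘(ℝ, EM) ∞ f (univ ×ˢ Icc c d) := by
    intro c d h1 h2 h3 h4
    refine (hF c d h1 h2 h3 h4).comp
      (f := fun z : EuclideanSpace ℝ (Fin n) × ℝ => (θ z.1, z.2)) ?_ fun z hz => ⟨mem_univ _, hz.2⟩
    exact ((hθ.contMDiff.comp contMDiff_fst).prodMk contMDiff_snd).contMDiffOn
  have hfcont : Continuous f := by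
    have h1 : ContinuousOn f (univ ×ˢ Icc a b) :=
      continuousOn_prod_Icc_of_pieces hlt F fun c d h1 h2 h3 h4 =>
        (hfpiece c d h1 h2 h3 h4).continuousOn
    have h2 : Continuous fun z : EuclideanSpace ℝ (Fin n) × ℝ => f (z.1, max a (min b z.2)) :=
      h1.comp_continuous (by fun_prop) fun z => ⟨mem_univ _, PSPath.clamp_mem hlt.le _⟩
    refine h2.congr fun z => ?_
    have h3 := PSPath.apply_clamp (γ (θ z.1)).lt.le (γ (θ z.1)).eq_left (γ (θ z.1)).eq_right z.2
    rwa [(hab _).1, (hab _).2] at h3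
  obtain ⟨L, hL, hL0, hLp⟩ := hH.exists_lift hπ hfcont (0, a) (q₀ := σ s₀) (by
    rw [hσ s₀, PSPath.start, (hab s₀).1, hf]
    simp only [hθ0])
  -- the ends of the lifts depend smoothly on the parameter
  have hends : ∀ c, (ContMDiff (𝓡 n) 𝓘(ℝ, EM) ∞ fun z => f (z, c)) →
      ContMDiff (𝓡 n) 𝓘(ℝ, EQ) ∞ fun z => L (z, c) := by
    intro c hc z
    refine (hL.comp (α := fun z => (z, c)) (D := univ) (by fun_prop)
      (mapsTo_univ _ _)).contMDiffWithinAt hH hπ (mem_univ z) ?_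
    simp only [hLp]
    exact hc z
  have hfa : ContMDiff (𝓡 n) 𝓘(ℝ, EM) ∞ fun z => f (z, a) := by
    have h1 : (fun z => f (z, a)) = fun z => π (σ (θ z)) := by
      ext z
      rw [hσ, PSPath.start, (hab _).1]
    rw [h1]
    exact hπ.contMDiff_proj.comp (hσs.comp hθ.contMDiff)
  have hfb : ContMDiff (𝓡 n) 𝓘(ℝ, EM) ∞ fun z => f (z, b) := by
    obtain ⟨c, hc, hcb, hdisj⟩ : ∃ c, a ≤ c ∧ c < b ∧ Disjoint (F : Set ℝ) (Ioo c b) := by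
      have h1 : ((F : Set ℝ) \ {b})ᶜ ∈ 𝓝 b :=
        (F.finite_toSet.subset sdiff_subset).isClosed.isOpen_compl.mem_nhds (by simp)
      obtain ⟨l, hl, hlb⟩ := exists_Ioc_subset_of_mem_nhds h1 ⟨a, hlt⟩
      refine ⟨max a l, le_max_left _ _, max_lt hlt hl, disjoint_left.2 fun t ht ht' => ?_⟩
      exact hlb ⟨(le_max_right _ _).trans_lt ht'.1, ht'.2.le⟩ ⟨ht, ht'.2.ne⟩
    rw [← contMDiffOn_univ]
    exact (hfpiece c b hc hcb le_rfl hdisj).comp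
      (f := fun z : EuclideanSpace ℝ (Fin n) => (z, b))
      (contMDiff_id.prodMk contMDiff_const).contMDiffOn
      fun z _ => ⟨mem_univ _, right_mem_Icc.2 hcb.le⟩
  -- `L` starts at `σ s₀` over `s₀`; a translation of the lifts corrects the other starting points
  have hdiv : ContMDiff (𝓡 n) 𝓘(ℝ, EG) ∞ fun z => hπ.div (L (z, a)) (σ (θ z)) := fun z =>
    hπ.contMDiffAt_div (hends a hfa z) ((hσs.comp hθ.contMDiff) z) (Eventually.of_forall fun z => by
      rw [hLp, hσ, PSPath.start, (hab _).1])
  have hP : ∀ s ∈ U, hH.pathLift hπ (γ s) (hσ s) (γ s).b =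
      L (κ s, b) <• hπ.div (L (κ s, a)) (σ (θ (κ s))) := by
    intro s hs
    have h1 := hH.eq_pathLift hπ (γ s) (hσ s)
      (F := fun t => L (κ s, t) <• hπ.div (L (κ s, a)) (σ (θ (κ s))))
      ((hL.comp (α := fun t => (κ s, t)) (by fun_prop) (mapsTo_univ _ _)).act hπ _)
      (fun t _ => by rw [hπ.proj_act, hLp, hf]; simp only [hθ.right_inv s hs])
      (by
        rw [(hab s).1, hπ.act_div, hθ.right_inv s hs]
        rw [hLp, hσ, PSPath.start, (hab _).1])
    rw [← h1 _ (right_mem_Icc.2 (γ s).lt.le), (hab s).2]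
  refine ContMDiffAt.congr_of_eventuallyEq
    (f := fun s => L (κ s, b) <• hπ.div (L (κ s, a)) (σ (θ (κ s)))) ?_
    (eventually_of_mem (hθ.isOpen.mem_nhds hs₀) hP)
  have hκ : ContMDiffAt (𝓡 n) (𝓡 n) ∞ κ s₀ := hθ.contMDiffOn.contMDiffAt (hθ.isOpen.mem_nhds hs₀)
  exact hπ.contMDiffAt_act ((hends b hfb _).comp s₀ hκ) ((hdiv _).comp s₀ hκ)

/-- The parallel transport of a connection with local horizontal sections: transport along `γ` is
monodromy of the covering `H.Leaf → M`. -/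
noncomputable def parallelTransport : ParallelTransport EM G EQ π where
  toFun γ q := ⟨hH.pathLift hπ γ q.2 γ.b, hH.proj_pathLift hπ γ q.2 γ.b⟩
  equivariant γ q q' g h := by
    refine (hH.eq_pathLift hπ γ q'.2 ((hH.leafContinuousOn_pathLift hπ γ q.2 _).act hπ g)
      (fun t _ => (hπ.proj_act _ g).trans (hH.proj_pathLift hπ γ q.2 t)) ?_ _
      (right_mem_Icc.2 γ.lt.le)).symm
    rw [hH.pathLift_left, h]
  constant γ hγ q := by
    refine (hH.eq_pathLift hπ γ q.2 (.const q.1 _) (fun t ht => q.2.trans (hγ t ht).symm) rfl _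
      (right_mem_Icc.2 γ.lt.le)).symm
  reparametrization γ' γ := by
    rintro ⟨α, β, hα, hβ, hinv, hαs, -, hmono, hγ⟩ q h' h
    have ha' := left_mem_Icc.2 γ'.lt.le
    have hb' := right_mem_Icc.2 γ'.lt.le
    have ha := left_mem_Icc.2 γ.lt.le
    have hb := right_mem_Icc.2 γ.lt.le
    have hαa : α γ'.a = γ.a := by
      refine le_antisymm ?_ (hα ha').1
      rw [← hinv.2 ha]
      exact hmono.monotoneOn ha' (hβ ha) (hβ ha).1
    have hαb : α γ'.b = γ.b := by
      refine le_antisymm (hα hb').2 ?_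
      rw [← hinv.2 hb]
      exact hmono.monotoneOn (hβ hb) hb' (hβ hb).2
    have key := hH.eq_pathLift hπ γ' h' (F := fun t => hH.pathLift hπ γ h (α t))
      ((hH.leafContinuousOn_pathLift hπ γ h univ).comp hαs.continuousOn (mapsTo_univ _ _))
      (fun t ht => (hH.proj_pathLift hπ γ h _).trans (hγ t ht).symm)
      (by rw [hαa, hH.pathLift_left]) γ'.b hb'
    change hH.pathLift hπ γ' h' γ'.b = hH.pathLift hπ γ h γ.b
    rw [← key, hαb]
  juxtaposition γ γ₂ γ₁ := by
    rintro ⟨ha, hb, h1, h2⟩ q h h₁ h₂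
    have hlt := γ₂.lt
    have key1 := hH.eq_pathLift hπ γ₁ h₁ (hH.leafContinuousOn_pathLift hπ γ h _)
      (fun t ht => (hH.proj_pathLift hπ γ h t).trans (h1 t ht))
      (by rw [← ha, hH.pathLift_left]) γ₁.b (right_mem_Icc.2 γ₁.lt.le)
    have key2 := hH.eq_pathLift hπ γ₂ h₂
      (F := fun t => hH.pathLift hπ γ h (γ₁.b + (t - γ₂.a)))
      ((hH.leafContinuousOn_pathLift hπ γ h univ).comp (by fun_prop) (mapsTo_univ _ _))
      (fun t ht => (hH.proj_pathLift hπ γ h _).trans (h2 t ht))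
      (by rw [sub_self, add_zero, key1]) γ₂.b (right_mem_Icc.2 γ₂.lt.le)
    change hH.pathLift hπ γ h γ.b = hH.pathLift hπ γ₂ h₂ γ₂.b
    rw [← key2, hb]
  smooth n S _ _ _ _ _ γ hγ σ hσ hσs := hH.contMDiff_pathLift hπ hγ hσ hσs

theorem homotopyInvariant_parallelTransport : (hH.parallelTransport hπ).HomotopyInvariant := by
  rintro γ₀ γ₁ ⟨ha, hb, K, hK0, hK1, hends, F, hF⟩ q h₀ h₁
  have hlt := γ₀.lt
  have h01 : (0 : ℝ) ≤ 1 := zero_le_one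
  -- extend the homotopy to the plane by a retraction onto the rectangle, and lift it
  have hcont : Continuous fun z : ℝ × ℝ =>
      K (max 0 (min 1 z.1), max γ₀.a (min γ₀.b z.2)) :=
    (continuousOn_prod_Icc_of_pieces hlt F fun c d h1 h2 h3 h4 =>
      (hF c d h1 h2 h3 h4).continuousOn).comp_continuous (by fun_prop)
      fun z => ⟨PSPath.clamp_mem h01 _, PSPath.clamp_mem hlt.le _⟩
  have hclamp : ∀ {a b t : ℝ}, t ∈ Icc a b → max a (min b t) = t := fun ht => by
    rw [min_eq_right ht.2, max_eq_right ht.1]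
  have hz := left_mem_Icc.2 h01
  have ho := right_mem_Icc.2 h01
  have hal := left_mem_Icc.2 hlt.le
  have hbr := right_mem_Icc.2 hlt.le
  obtain ⟨L, hL, hL0, hLp⟩ := hH.exists_lift hπ hcont (0, γ₀.a) (q₀ := q) (by
    rw [h₀, hclamp hz, hclamp hal, (hends 0 hz).1])
  -- the sides of the rectangle on which the homotopy is constant lift to constant curves
  have hside : ∀ t, t = γ₀.a ∨ t = γ₀.b → L (0, t) = L (1, t) := by
    intro t ht
    have htm : t ∈ Icc γ₀.a γ₀.b := by rcases ht with rfl | rfl; exacts [hal, hbr]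
    have hc : ∀ s ∈ Icc (0 : ℝ) 1, π (L (s, t)) = π (L (0, t)) := by
      intro s hs
      rw [hLp, hLp, hclamp hs, hclamp hz, hclamp htm]
      rcases ht with rfl | rfl
      · rw [(hends s hs).1, (hends 0 hz).1]
      · rw [(hends s hs).2, (hends 0 hz).2]
    exact ((hL.comp (α := fun s => (s, t)) (D := Icc 0 1) (by fun_prop)
      (mapsTo_univ _ _)).eqOn hH hπ (.const (L (0, t)) _) isPreconnected_Icc hc hz rfl ho).symm
  have key0 := hH.eq_pathLift hπ γ₀ h₀ (F := fun t => L (0, t))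
    (hL.comp (by fun_prop) (mapsTo_univ _ _))
    (fun t ht => by rw [hLp, hclamp hz, hclamp ht, hK0 t ht]) hL0 _ hbr
  have key1 := hH.eq_pathLift hπ γ₁ h₁ (F := fun t => L (1, t))
    (hL.comp (by fun_prop) (mapsTo_univ _ _))
    (fun t ht => by
      rw [ha, hb] at ht
      rw [hLp, hclamp ho, hclamp ht, hK1 t ht])
    (by rw [ha, ← hside _ (Or.inl rfl), hL0]) _ (right_mem_Icc.2 γ₁.lt.le)
  change hH.pathLift hπ γ₀ h₀ γ₀.b = hH.pathLift hπ γ₁ h₁ γ₁.b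
  rw [← key0, ← key1, hb]
  exact hside _ (Or.inr rfl)

theorem hasParallelTransport : H.HasParallelTransport (hH.parallelTransport hπ) := by
  intro γ q
  have hconst : ∀ B : Set ℝ, IsPreconnected B → ∀ c ∈ B, (∀ t ∈ B, γ t = γ c) →
      ∀ t ∈ B, hH.pathLift hπ γ q.2 t = hH.pathLift hπ γ q.2 c := fun B hB c hc h t ht =>
    (hH.leafContinuousOn_pathLift hπ γ q.2 B).eqOn hH hπ (.const _ B) hB
      (fun t ht => by rw [hH.proj_pathLift, hH.proj_pathLift, h t ht]) hc rfl ht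
  obtain ⟨F, hF⟩ := γ.piecewise_smooth
  refine ⟨⟨γ.a, γ.b, γ.lt, hH.pathLift hπ γ q.2,
    hconst (Iic γ.a) isPreconnected_Iic γ.a self_mem_Iic γ.eq_left,
    hconst (Ici γ.b) isPreconnected_Ici γ.b self_mem_Ici γ.eq_right, F,
    fun c d h1 h2 h3 h4 t ht => ?_⟩, ⟨rfl, rfl, fun t _ => hH.proj_pathLift hπ γ q.2 t,
      fun t _ h => ?_⟩, hH.pathLift_left hπ γ q.2, rfl⟩
  · refine (hH.leafContinuousOn_pathLift hπ γ q.2 _).contMDiffWithinAt hH hπ ht ?_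
    simp only [hH.proj_pathLift]
    exact hF c d h1 h2 h3 h4 t ht
  · exact (hH.leafContinuousOn_pathLift hπ γ q.2 univ).mfderiv_mem_hor hH hπ h

end Connection.HasFlatSections

end FlatTransport

/-! ### Construction of paths and homotopies -/

section PathConstructions

variable {EM : Type*} [NormedAddCommGroup EM] [NormedSpace ℝ EM]
  {M : Type*} [TopologicalSpace M] [ChartedSpace EM M]

namespace PSPath

/-- The restriction to `[a, b]` of a map which is piecewise smooth on `[a, b]`, extended by its end
values. -/
def ofPieces (f : ℝ → M) {a b : ℝ} (hab : a < b) (hf : ∃ F : Finset ℝ, ∀ c d : ℝ, a ≤ c → c < d →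
    d ≤ b → Disjoint (F : Set ℝ) (Ioo c d) → ContMDiffOn 𝓘(ℝ, ℝ) 𝓘(ℝ, EM) ∞ f (Icc c d)) :
    PSPath EM M where
  a := a
  b := b
  lt := hab
  toFun t := f (max a (min b t))
  eq_left t ht := by
    rw [max_eq_left ((min_le_right b t).trans ht), max_eq_left (min_le_right b a)]
  eq_right t ht := by rw [min_eq_left ht, min_self]
  piecewise_smooth := by
    obtain ⟨F, hF⟩ := hf
    refine ⟨F, fun c d h1 h2 h3 h4 => (hF c d h1 h2 h3 h4).congr fun t ht => ?_⟩
    rw [min_eq_right (ht.2.trans h3), max_eq_right (h1.trans ht.1)]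

theorem ofPieces_apply {f : ℝ → M} {a b : ℝ} (hab : a < b) (hf : ∃ F : Finset ℝ, ∀ c d : ℝ,
    a ≤ c → c < d → d ≤ b → Disjoint (F : Set ℝ) (Ioo c d) →
    ContMDiffOn 𝓘(ℝ, ℝ) 𝓘(ℝ, EM) ∞ f (Icc c d)) {t : ℝ} (ht : t ∈ Icc a b) :
    ofPieces f hab hf t = f t := by
  change f (max a (min b t)) = f t
  rw [min_eq_right ht.2, max_eq_right ht.1]

/-- The restriction to `[a, b]` of a smooth curve. -/
def ofSmooth (f : ℝ → M) {a b : ℝ} (hab : a < b) (hf : ContMDiff 𝓘(ℝ, ℝ) 𝓘(ℝ, EM) ∞ f) :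
    PSPath EM M :=
  ofPieces f hab ⟨∅, fun _ _ _ _ _ _ => hf.contMDiffOn⟩

theorem ofSmooth_apply {f : ℝ → M} {a b : ℝ} (hab : a < b) (hf : ContMDiff 𝓘(ℝ, ℝ) 𝓘(ℝ, EM) ∞ f)
    {t : ℝ} (ht : t ∈ Icc a b) : ofSmooth f hab hf t = f t :=
  ofPieces_apply hab _ ht

/-- The restriction of a path to a subinterval `[c, d]`. -/
def restrict (γ : PSPath EM M) {c d : ℝ} (hc : γ.a ≤ c) (hcd : c < d) (hd : d ≤ γ.b) :
    PSPath EM M :=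
  ofPieces γ hcd (by
    obtain ⟨F, hF⟩ := γ.piecewise_smooth
    exact ⟨F, fun c' d' h1 h2 h3 h4 => hF c' d' (hc.trans h1) h2 (h3.trans hd) h4⟩)

theorem restrict_apply (γ : PSPath EM M) {c d : ℝ} (hc : γ.a ≤ c) (hcd : c < d) (hd : d ≤ γ.b)
    {t : ℝ} (ht : t ∈ Icc c d) : γ.restrict hc hcd hd t = γ t :=
  ofPieces_apply hcd _ ht

theorem start_restrict (γ : PSPath EM M) {c d : ℝ} (hc : γ.a ≤ c) (hcd : c < d) (hd : d ≤ γ.b) :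
    (γ.restrict hc hcd hd).start = γ c :=
  γ.restrict_apply hc hcd hd (left_mem_Icc.2 hcd.le)

theorem finish_restrict (γ : PSPath EM M) {c d : ℝ} (hc : γ.a ≤ c) (hcd : c < d) (hd : d ≤ γ.b) :
    (γ.restrict hc hcd hd).finish = γ d :=
  γ.restrict_apply hc hcd hd (right_mem_Icc.2 hcd.le)

theorem isJuxtaposition_restrict (γ : PSPath EM M) {c d e : ℝ} (hc : γ.a ≤ c) (hcd : c < d)
    (hde : d < e) (he : e ≤ γ.b) :
    (γ.restrict hc (hcd.trans hde) he).IsJuxtaposition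
      (γ.restrict (hc.trans hcd.le) hde he) (γ.restrict hc hcd (hde.le.trans he)) := by
  refine ⟨rfl, ?_, fun t ht => ?_, fun t ht => ?_⟩
  · change e = d + (e - d)
    ring
  · replace ht : t ∈ Icc c d := ht
    rw [γ.restrict_apply _ _ _ ht, γ.restrict_apply _ _ _ ⟨ht.1, ht.2.trans hde.le⟩]
  · replace ht : t ∈ Icc d e := ht
    change γ.restrict _ _ _ (d + (t - d)) = _
    rw [add_sub_cancel, γ.restrict_apply _ _ _ ht, γ.restrict_apply _ _ _ ⟨hcd.le.trans ht.1, ht.2⟩]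

/-- The juxtaposition of two paths exists. -/
theorem exists_isJuxtaposition (γ₁ γ₂ : PSPath EM M) (h : γ₁.finish = γ₂.start) :
    ∃ γ : PSPath EM M, γ.IsJuxtaposition γ₂ γ₁ := by
  have hlt₁ := γ₁.lt
  have hlt₂ := γ₂.lt
  obtain ⟨F₁, hF₁⟩ := γ₁.piecewise_smooth
  obtain ⟨F₂, hF₂⟩ := γ₂.piecewise_smooth
  set f : ℝ → M := fun t => if t ≤ γ₁.b then γ₁ t else γ₂ (γ₂.a + (t - γ₁.b)) with hf
  have hf₁ : ∀ t ≤ γ₁.b, f t = γ₁ t := fun t ht => if_pos ht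
  have hf₂ : ∀ t, γ₁.b ≤ t → f t = γ₂ (γ₂.a + (t - γ₁.b)) := by
    intro t ht
    rcases ht.eq_or_lt with rfl | ht
    · rw [hf₁ _ le_rfl, sub_self, add_zero]
      exact h
    · exact if_neg ht.not_ge
  have hlt : γ₁.a < γ₁.b + (γ₂.b - γ₂.a) := by linarith
  refine ⟨ofPieces f hlt ⟨F₁ ∪ F₂.image (fun t => γ₁.b + (t - γ₂.a)) ∪ {γ₁.b},
    fun c d h1 h2 h3 h4 => ?_⟩, rfl, rfl, fun t ht => ?_, fun t ht => ?_⟩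
  · have hb : γ₁.b ∉ Ioo c d := fun hb => disjoint_left.1 h4 (by simp) hb
    rcases le_or_gt d γ₁.b with hd | hd
    · refine (hF₁ c d h1 h2 hd ?_).congr fun t ht => hf₁ t (ht.2.trans hd)
      exact disjoint_left.2 fun t ht => disjoint_left.1 h4 (by simp [Finset.mem_coe.1 ht])
    · have hc : γ₁.b ≤ c := not_lt.1 fun hc => hb ⟨hc, hd⟩
      refine ContMDiffOn.congr (f := fun t => γ₂ (γ₂.a + (t - γ₁.b))) ?_
        fun t ht => hf₂ t (hc.trans ht.1)
      refine (hF₂ (γ₂.a + (c - γ₁.b)) (γ₂.a + (d - γ₁.b)) (by linarith) (by linarith)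
        (by linarith) ?_).comp (f := fun t => γ₂.a + (t - γ₁.b)) ?_ ?_
      · refine disjoint_left.2 fun t ht ht' => ?_
        have hmem : γ₁.b + (t - γ₂.a) ∈ Ioo c d := ⟨by linarith [ht'.1], by linarith [ht'.2]⟩
        have ht'' : t ∈ F₂ := ht
        exact disjoint_left.1 h4 (by simp [ht'']) hmem
      · exact (contDiff_const.add (contDiff_id.sub contDiff_const)).contMDiff.contMDiffOn
      · exact fun t ht => ⟨by linarith [ht.1], by linarith [ht.2]⟩
  · rw [ofPieces_apply _ _ ⟨ht.1, by linarith [ht.2]⟩, hf₁ t ht.2]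
  · rw [ofPieces_apply _ _ ⟨by linarith [ht.1], by linarith [ht.2]⟩,
      hf₂ _ (by linarith [ht.1])]
    congr 1
    ring

variable {E : Type*} [NormedAddCommGroup E] [NormedSpace ℝ E] {θ : E → M} {κ : M → E} {U : Set M}

/-- Paths in a coordinate domain are homotopic through straight lines in the coordinates. -/
theorem smoothlyHomotopic_of_isParametrization (hθ : IsParametrization (EM := EM) θ κ U)
    {γ₀ γ₁ : PSPath EM M} (ha : γ₁.a = γ₀.a) (hb : γ₁.b = γ₀.b)
    (h₀ : ∀ t ∈ Icc γ₀.a γ₀.b, γ₀ t ∈ U) (h₁ : ∀ t ∈ Icc γ₁.a γ₁.b, γ₁ t ∈ U)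
    (hs : γ₁.start = γ₀.start) (hf : γ₁.finish = γ₀.finish) : γ₀.SmoothlyHomotopic γ₁ := by
  obtain ⟨F₀, hF₀⟩ := γ₀.piecewise_smooth
  obtain ⟨F₁, hF₁⟩ := γ₁.piecewise_smooth
  rw [ha, hb] at h₁
  have hl := left_mem_Icc.2 γ₀.lt.le
  have hr := right_mem_Icc.2 γ₀.lt.le
  have hself : ∀ (r : ℝ) (x : E), (1 - r) • x + r • x = x := fun r x => by
    rw [← add_smul, sub_add_cancel, one_smul]
  refine ⟨ha, hb, fun z => θ ((1 - z.1) • κ (γ₀ z.2) + z.1 • κ (γ₁ z.2)), fun t ht => ?_,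
    fun t ht => ?_, fun r _ => ⟨?_, ?_⟩, F₀ ∪ F₁, fun c d h1 h2 h3 h4 => ?_⟩
  · simp only [sub_zero, one_smul, zero_smul, add_zero, hθ.right_inv _ (h₀ t ht)]
  · simp only [sub_self, one_smul, zero_smul, zero_add, hθ.right_inv _ (h₁ t ht)]
  · have : γ₁ γ₀.a = γ₀ γ₀.a := by
      rw [PSPath.start, PSPath.start, ha] at hs; exact hs
    simp only [this, hself, hθ.right_inv _ (h₀ _ hl)]
    rfl
  · have : γ₁ γ₀.b = γ₀ γ₀.b := by
      rw [PSPath.finish, PSPath.finish, hb] at hf; exact hf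
    simp only [this, hself, hθ.right_inv _ (h₀ _ hr)]
    rfl
  · rw [Finset.coe_union, disjoint_union_left] at h4
    have hmem : ∀ t ∈ Icc c d, t ∈ Icc γ₀.a γ₀.b := fun t ht => ⟨h1.trans ht.1, ht.2.trans h3⟩
    have k₀ : ContMDiffOn (𝓘(ℝ, ℝ).prod 𝓘(ℝ, ℝ)) 𝓘(ℝ, E) ∞ (fun z : ℝ × ℝ => κ (γ₀ z.2))
        (Icc 0 1 ×ˢ Icc c d) :=
      (hθ.contMDiffOn.comp (hF₀ c d h1 h2 h3 h4.1) fun t ht => h₀ t (hmem t ht)).comp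
        contMDiff_snd.contMDiffOn fun z hz => hz.2
    have k₁ : ContMDiffOn (𝓘(ℝ, ℝ).prod 𝓘(ℝ, ℝ)) 𝓘(ℝ, E) ∞ (fun z : ℝ × ℝ => κ (γ₁ z.2))
        (Icc 0 1 ×ˢ Icc c d) :=
      (hθ.contMDiffOn.comp (hF₁ c d (ha ▸ h1) h2 (hb ▸ h3) h4.2) fun t ht => h₁ t (hmem t ht)).comp
        contMDiff_snd.contMDiffOn fun z hz => hz.2
    have k : ContMDiffOn (𝓘(ℝ, ℝ).prod 𝓘(ℝ, ℝ)) 𝓘(ℝ, ℝ) ∞ (fun z : ℝ × ℝ => z.1)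
        (Icc 0 1 ×ˢ Icc c d) := contMDiff_fst.contMDiffOn
    exact hθ.contMDiff.comp_contMDiffOn (((contMDiffOn_const.sub k).smul k₀).add (k.smul k₁))

/-- The ray from `θ 0` to `θ z`. -/
noncomputable def ray (hθ : IsParametrization (EM := EM) θ κ U) (z : E) : PSPath EM M :=
  ofSmooth (fun t => θ (t • z)) zero_lt_one
    (hθ.contMDiff.comp (contDiff_id.smul contDiff_const).contMDiff)

variable (hθ : IsParametrization (EM := EM) θ κ U)

theorem ray_apply (z : E) {t : ℝ} (ht : t ∈ Icc (0 : ℝ) 1) : ray hθ z t = θ (t • z) :=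
  ofSmooth_apply _ _ ht

theorem start_ray (z : E) : (ray hθ z).start = θ 0 :=
  (ray_apply hθ z (left_mem_Icc.2 zero_le_one)).trans (by rw [zero_smul])

theorem finish_ray (z : E) : (ray hθ z).finish = θ z :=
  (ray_apply hθ z (right_mem_Icc.2 zero_le_one)).trans (by rw [one_smul])

theorem ray_mem (z : E) {t : ℝ} (ht : t ∈ Icc (0 : ℝ) 1) : ray hθ z t ∈ U := by
  rw [ray_apply hθ z ht]
  exact hθ.mem _

end PSPath

end PathConstructions

/-! ### Uniqueness of parallel transport -/

section TransportUniqueness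

variable
    {EM : Type*} [NormedAddCommGroup EM] [NormedSpace ℝ EM]
    {M : Type*} [TopologicalSpace M] [ChartedSpace EM M]
    {EG : Type*} [NormedAddCommGroup EG] [NormedSpace ℝ EG] [CompleteSpace EG]
    {G : Type*} [Group G] [TopologicalSpace G] [ChartedSpace EG G] [LieGroup 𝓘(ℝ, EG) ∞ G]
    {EQ : Type*} [NormedAddCommGroup EQ] [NormedSpace ℝ EQ]
    {Q : Type*} [TopologicalSpace Q] [ChartedSpace EQ Q] [IsManifold 𝓘(ℝ, EQ) ∞ Q]
    [MulAction Gᵐᵒᵖ Q] {π : Q → M} {H : Connection EM G EQ π}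

/-- A horizontal lift is determined by its initial point. -/
theorem Connection.IsHorizontalLift.eqOn (hπ : IsPrincipalBundle EM EG G EQ π)
    {γ : PSPath EM M} {δ δ' : PSPath EQ Q} (h : H.IsHorizontalLift γ δ)
    (h' : H.IsHorizontalLift γ δ') (hs : δ.start = δ'.start) : EqOn δ δ' (Icc γ.a γ.b) := by
  obtain ⟨ha, hb, hp, hd⟩ := h
  obtain ⟨ha', hb', hp', hd'⟩ := h'
  obtain ⟨F, hF⟩ := δ.exists_contMDiffAt
  obtain ⟨F', hF'⟩ := δ'.exists_contMDiffAt
  rw [ha, hb] at hF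
  rw [ha', hb'] at hF'
  intro t ht
  have hpp : ∀ t ∈ Icc γ.a γ.b, π (δ t) = π (δ' t) := fun t ht => (hp t ht).trans (hp' t ht).symm
  have key := hπ.div_eq_of_horizontal H (δ := δ) (δ' := δ') δ.continuous.continuousOn
    δ'.continuous.continuousOn (F ∪ F')
    (fun t ht htF => by
      have h1 := (hF t ht fun h => htF (Finset.mem_union_left _ h)).mdifferentiableAt (by simp)
      exact ⟨h1, hd t ht h1⟩)
    (fun t ht htF => by
      have h1 := (hF' t ht fun h => htF (Finset.mem_union_right _ h)).mdifferentiableAt (by simp)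
      exact ⟨h1, hd' t ht h1⟩) hpp (left_mem_Icc.2 γ.lt.le) ht
  have h0 : δ γ.a = δ' γ.a := by
    have h1 := hs
    rw [PSPath.start, PSPath.start, ha, ha'] at h1
    exact h1
  rw [h0, hπ.div_self] at key
  rw [← hπ.act_div (hpp t ht), ← key, act_one]

/-- A connection has at most one parallel transport. -/
theorem Connection.HasParallelTransport.unique (hπ : IsPrincipalBundle EM EG G EQ π)
    {P P' : ParallelTransport EM G EQ π} (h : H.HasParallelTransport P)
    (h' : H.HasParallelTransport P') : P = P' := by
  ext γ q
  obtain ⟨δ, hδ, hs, hf⟩ := h γ q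
  obtain ⟨δ', hδ', hs', hf'⟩ := h' γ q
  have h1 := hδ.eqOn hπ hδ' (hs.trans hs'.symm) (right_mem_Icc.2 γ.lt.le)
  rw [← hf, ← hf', PSPath.finish, PSPath.finish, hδ.2.1, hδ'.2.1]
  exact h1

end TransportUniqueness

/-! ### Parallel sections of a homotopy-invariant transport -/

section ParallelSections

open scoped Topology
open Filter

variable
    {EM : Type*} [NormedAddCommGroup EM] [NormedSpace ℝ EM]
    {M : Type*} [TopologicalSpace M] [ChartedSpace EM M]
    {EG : Type*} [NormedAddCommGroup EG] [NormedSpace ℝ EG]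
    {G : Type*} [Group G] [TopologicalSpace G] [ChartedSpace EG G]
    {EQ : Type*} [NormedAddCommGroup EQ] [NormedSpace ℝ EQ]
    {Q : Type*} [TopologicalSpace Q] [ChartedSpace EQ Q]
    [MulAction Gᵐᵒᵖ Q] {π : Q → M}

namespace ParallelTransport

/-- `s` is a smooth section over the open set `U` whose values are related by parallel transport
along every path in `U`. -/
structure IsParallelSection (P : ParallelTransport EM G EQ π) (s : M → Q) (U : Set M) : Prop where
  isOpen : IsOpen U
  contMDiffOn : ContMDiffOn 𝓘(ℝ, EM) 𝓘(ℝ, EQ) ∞ s U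
  proj_apply : ∀ y ∈ U, π (s y) = y
  transport : ∀ γ : PSPath EM M, (∀ t ∈ Icc γ.a γ.b, γ t ∈ U) →
    ∀ h : π (s γ.start) = γ.start, (P.toFun γ ⟨s γ.start, h⟩ : Q) = s γ.finish

variable (P : ParallelTransport EM G EQ π)

omit [TopologicalSpace G] [ChartedSpace EG G] in
/-- A homotopy-invariant parallel transport has parallel sections: transport along rays defines one,
since rays and paths between them span contractible triangles. -/
theorem HomotopyInvariant.exists_isParallelSection [FiniteDimensional ℝ EM]
    [IsManifold 𝓘(ℝ, EM) ∞ M] {P : ParallelTransport EM G EQ π} (hP : P.HomotopyInvariant) (q : Q) :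
    ∃ (U : Set M) (s : M → Q), π q ∈ U ∧ s (π q) = q ∧ P.IsParallelSection s U := by
  obtain ⟨θ, κ, U, hθ, -, hqU, hθ0⟩ := exists_isParametrization (toEuclidean (E := EM)) (π q)
    univ_mem
  have hstart : ∀ z, π q = (PSPath.ray hθ z).start := fun z => by rw [PSPath.start_ray, hθ0]
  set r : EuclideanSpace ℝ (Fin (Module.finrank ℝ EM)) → Q :=
    fun z => P.toFun (PSPath.ray hθ z) ⟨q, hstart z⟩ with hr
  have hπr : ∀ z, π (r z) = θ z := fun z =>
    (P.toFun (PSPath.ray hθ z) ⟨q, hstart z⟩).2.trans (PSPath.finish_ray hθ z)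
  have hrsm : ContMDiff (𝓡 (Module.finrank ℝ EM)) 𝓘(ℝ, EQ) ∞ r := by
    refine P.smooth _ _ (fun z => PSPath.ray hθ z) ⟨0, 1, ∅, fun _ => ⟨rfl, rfl⟩,
      fun c d h1 h2 h3 _ => ?_⟩ (fun _ => q) hstart contMDiff_const
    have h5 : ContMDiff ((𝓡 (Module.finrank ℝ EM)).prod 𝓘(ℝ, ℝ)) 𝓘(ℝ, EM) ∞
        (fun z : EuclideanSpace ℝ (Fin (Module.finrank ℝ EM)) × ℝ => θ (z.2 • z.1)) :=
      hθ.contMDiff.comp (contMDiff_snd.smul contMDiff_fst)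
    exact h5.contMDiffOn.congr fun z hz =>
      PSPath.ray_apply hθ z.1 ⟨h1.trans hz.2.1, hz.2.2.trans h3⟩
  refine ⟨U, fun y => r (κ y), hqU, ?_, hθ.isOpen, hrsm.comp_contMDiffOn hθ.contMDiffOn,
    fun y hy => (hπr _).trans (hθ.right_inv y hy), fun γ hγ h => ?_⟩
  · refine P.constant _ (fun t ht => ?_) _
    have h0 : κ (π q) = 0 := by rw [← hθ0, hθ.left_inv]
    rw [h0, PSPath.ray_apply hθ 0 ht, smul_zero]
    exact (PSPath.start_ray hθ 0).symm
  -- compare the ray to the start of `γ` followed by `γ` with the ray to the end of `γ`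
  have hγl := hγ _ (left_mem_Icc.2 γ.lt.le)
  have hγr := hγ _ (right_mem_Icc.2 γ.lt.le)
  have hjoin : (PSPath.ray hθ (κ γ.start)).finish = γ.start := by
    rw [PSPath.finish_ray]; exact hθ.right_inv _ hγl
  obtain ⟨c, hc⟩ := PSPath.exists_isJuxtaposition _ _ hjoin
  obtain ⟨hca, hcb, hc1, hc2⟩ := id hc
  replace hca : c.a = 0 := hca
  replace hcb : c.b = 1 + (γ.b - γ.a) := hcb
  set L : ℝ := 1 + (γ.b - γ.a) with hL
  have hL1 : 1 < L := by have := γ.lt; linarith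
  have hL0 : 0 < L := by linarith
  have hzL : (0 : ℝ) ∈ Icc 0 L := left_mem_Icc.2 hL0.le
  have hLL : L ∈ Icc 0 L := right_mem_Icc.2 hL0.le
  set c' : PSPath EM M := PSPath.ofSmooth (fun t => θ ((t / L) • κ γ.finish)) hL0
    (hθ.contMDiff.comp ((contDiff_id.div_const L).smul contDiff_const).contMDiff) with hc'
  have hc'_apply : ∀ t ∈ Icc 0 L, c' t = θ ((t / L) • κ γ.finish) := fun t ht =>
    PSPath.ofSmooth_apply _ _ ht
  have hc's : c'.start = θ 0 := (hc'_apply 0 hzL).trans (by rw [zero_div, zero_smul])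
  have hc'f : c'.finish = γ.finish :=
    (hc'_apply L hLL).trans (by rw [div_self hL0.ne', one_smul]; exact hθ.right_inv _ hγr)
  have hcs : c.start = θ 0 := by
    have := hc1 0 (left_mem_Icc.2 zero_le_one)
    rw [PSPath.start, hca, this]
    exact PSPath.start_ray hθ _
  have hcf : c.finish = γ.finish := by
    have := hc2 γ.b (right_mem_Icc.2 γ.lt.le)
    rw [PSPath.finish, hcb]
    exact this
  have hcU : ∀ t ∈ Icc c.a c.b, c t ∈ U := by
    intro t ht
    rw [hca, hcb] at ht
    rcases le_total t 1 with h1 | h1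
    · have := hc1 t ⟨ht.1, h1⟩
      rw [this]
      exact PSPath.ray_mem hθ _ ⟨ht.1, h1⟩
    · have h2 : t - 1 + γ.a ∈ Icc γ.a γ.b := ⟨by linarith, by linarith [ht.2]⟩
      have h3 := hc2 _ h2
      have h4 : (PSPath.ray hθ (κ γ.start)).b + (t - 1 + γ.a - γ.a) = t := by
        change 1 + (t - 1 + γ.a - γ.a) = t
        ring
      rw [h4] at h3
      rw [h3]
      exact hγ _ h2
  have hhom : c.SmoothlyHomotopic c' := by
    refine PSPath.smoothlyHomotopic_of_isParametrization hθ hca.symm hcb.symm hcU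
      (fun t ht => ?_) (hc's.trans hcs.symm) (hc'f.trans hcf.symm)
    rw [hc'_apply t ht]
    exact hθ.mem _
  have hrep : c'.IsReparametrization (PSPath.ray hθ (κ γ.finish)) := by
    refine ⟨fun t => t / L, fun t => t * L, fun t ht => ?_, fun t ht => ?_, ⟨fun t _ => ?_,
      fun t _ => ?_⟩, (contDiff_id.div_const L).contDiffOn,
      (contDiff_id.mul contDiff_const).contDiffOn, fun t _ t' _ htt => ?_, fun t ht => ?_⟩
    · exact ⟨div_nonneg ht.1 hL0.le, (div_le_one hL0).2 ht.2⟩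
    · exact ⟨mul_nonneg ht.1 hL0.le, by
        have := mul_le_mul_of_nonneg_right ht.2 hL0.le
        rwa [show (PSPath.ray hθ (κ γ.finish)).b = 1 from rfl, one_mul] at this⟩
    · exact div_mul_cancel₀ t hL0.ne'
    · exact mul_div_cancel_right₀ t hL0.ne'
    · exact div_lt_div_of_pos_right htt hL0
    · rw [hc'_apply t ht, PSPath.ray_apply hθ _
        ⟨div_nonneg ht.1 hL0.le, (div_le_one hL0).2 ht.2⟩]
  have e1 := P.juxtaposition c γ _ hc q (hθ0.symm.trans hcs.symm) (hstart _) h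
  have e2 := hP c c' hhom q (hθ0.symm.trans hcs.symm) (hθ0.symm.trans hc's.symm)
  have e3 := P.reparametrization c' _ hrep q (hθ0.symm.trans hc's.symm) (hstart _)
  exact e1.symm.trans (e2.trans e3)

end ParallelTransport

end ParallelSections

/-! ### The connection of a homotopy-invariant transport -/

section TransportConnection

open scoped Topology
open Filter

theorem projectionOnto_eq_of_sub_mem {E : Type*} [AddCommGroup E] [Module ℝ E]
    {A B : Submodule ℝ E} (h : IsCompl A B) {x v : E} (hv : v ∈ A) (hx : x - v ∈ B) :
    (A.projectionOnto B h x : E) = v := by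
  have h1 : A.projectionOnto B h x = A.projectionOnto B h v := by
    rw [← sub_eq_zero, ← map_sub]
    exact (Submodule.projectionOnto_apply_eq_zero_iff h).2 hx
  rw [h1]
  exact congrArg Subtype.val (Submodule.projectionOnto_apply_left h ⟨v, hv⟩)

variable
    {EM : Type*} [NormedAddCommGroup EM] [NormedSpace ℝ EM] [FiniteDimensional ℝ EM]
    {M : Type*} [TopologicalSpace M] [ChartedSpace EM M] [IsManifold 𝓘(ℝ, EM) ∞ M]
    {EG : Type*} [NormedAddCommGroup EG] [NormedSpace ℝ EG]
    {G : Type*} [Group G] [TopologicalSpace G] [ChartedSpace EG G] [LieGroup 𝓘(ℝ, EG) ∞ G]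
    {EQ : Type*} [NormedAddCommGroup EQ] [NormedSpace ℝ EQ]
    {Q : Type*} [TopologicalSpace Q] [ChartedSpace EQ Q] [IsManifold 𝓘(ℝ, EQ) ∞ Q]
    [MulAction Gᵐᵒᵖ Q] {π : Q → M} {P : ParallelTransport EM G EQ π}

namespace ParallelTransport

namespace IsParallelSection

omit [FiniteDimensional ℝ EM] [IsManifold 𝓘(ℝ, EM) ∞ M] [TopologicalSpace G] [ChartedSpace EG G]
  [LieGroup 𝓘(ℝ, EG) ∞ G] [IsManifold 𝓘(ℝ, EQ) ∞ Q] in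
theorem contMDiffAt {s : M → Q} {U : Set M} (hs : P.IsParallelSection s U) {x : M} (hx : x ∈ U) :
    ContMDiffAt 𝓘(ℝ, EM) 𝓘(ℝ, EQ) ∞ s x :=
  hs.contMDiffOn.contMDiffAt (hs.isOpen.mem_nhds hx)

omit [FiniteDimensional ℝ EM] [IsManifold 𝓘(ℝ, EM) ∞ M] [LieGroup 𝓘(ℝ, EG) ∞ G]
  [IsManifold 𝓘(ℝ, EQ) ∞ Q] in
theorem transport_act (hπ : IsPrincipalBundle EM EG G EQ π) {s : M → Q} {U : Set M}
    (hs : P.IsParallelSection s U) (γ : PSPath EM M) (hγ : ∀ t ∈ Icc γ.a γ.b, γ t ∈ U) {q : Q}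
    (hq : π q = γ.start) :
    (P.toFun γ ⟨q, hq⟩ : Q) = s γ.finish <• hπ.div (s γ.start) q := by
  have h := hs.proj_apply _ (hγ _ (left_mem_Icc.2 γ.lt.le))
  rw [← hs.transport γ hγ h]
  exact P.equivariant γ ⟨s γ.start, h⟩ ⟨q, hq⟩ _ (hπ.act_div (h.trans hq.symm)).symm

omit [FiniteDimensional ℝ EM] [IsManifold 𝓘(ℝ, EM) ∞ M] [IsManifold 𝓘(ℝ, EQ) ∞ Q] in
theorem act (hπ : IsPrincipalBundle EM EG G EQ π) {s : M → Q} {U : Set M}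
    (hs : P.IsParallelSection s U) (g : G) : P.IsParallelSection (fun y => s y <• g) U where
  isOpen := hs.isOpen
  contMDiffOn := (hπ.contMDiff_act_right g).comp_contMDiffOn hs.contMDiffOn
  proj_apply y hy := (hπ.proj_act _ g).trans (hs.proj_apply y hy)
  transport γ hγ h := by rw [hs.transport_act hπ γ hγ h, hπ.div_act]

omit [LieGroup 𝓘(ℝ, EG) ∞ G] [IsManifold 𝓘(ℝ, EQ) ∞ Q] in
/-- Two parallel sections differ locally by a constant element of `G`. -/
theorem eventually_eq_act (hπ : IsPrincipalBundle EM EG G EQ π) {s s' : M → Q}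
    {U U' : Set M} (hs : P.IsParallelSection s U) (hs' : P.IsParallelSection s' U') {x : M}
    (hx : x ∈ U) (hx' : x ∈ U') : ∀ᶠ y in 𝓝 x, s' y = s y <• hπ.div (s x) (s' x) := by
  obtain ⟨θ, κ, W, hθ, hWU, hxW, hθ0⟩ := exists_isParametrization (toEuclidean (E := EM)) x
    (inter_mem (hs.isOpen.mem_nhds hx) (hs'.isOpen.mem_nhds hx'))
  filter_upwards [hθ.isOpen.mem_nhds hxW] with y hy
  have h0 : (PSPath.ray hθ (κ y)).start = x := (PSPath.start_ray hθ _).trans hθ0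
  have h1 : (PSPath.ray hθ (κ y)).finish = y :=
    (PSPath.finish_ray hθ _).trans (hθ.right_inv y hy)
  have hU : ∀ t ∈ Icc (0 : ℝ) 1, PSPath.ray hθ (κ y) t ∈ U ∩ U' := fun t ht =>
    hWU (PSPath.ray_mem hθ _ ht)
  have hq : π (s' (PSPath.ray hθ (κ y)).start) = (PSPath.ray hθ (κ y)).start := by
    rw [h0, hs'.proj_apply x hx']
  have h2 := hs'.transport _ (fun t ht => (hU t ht).2) hq
  rw [hs.transport_act hπ _ (fun t ht => (hU t ht).1) hq, h0, h1] at h2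
  exact h2.symm

end IsParallelSection

namespace HomotopyInvariant

variable (hP : P.HomotopyInvariant)

/-- A parallel section through the point `q`. -/
noncomputable def localSection (q : Q) : M → Q := (hP.exists_isParallelSection q).choose_spec.choose

omit [TopologicalSpace G] [ChartedSpace EG G] [LieGroup 𝓘(ℝ, EG) ∞ G] [IsManifold 𝓘(ℝ, EQ) ∞ Q] in
theorem exists_localSection (q : Q) : ∃ U : Set M, π q ∈ U ∧ hP.localSection q (π q) = q ∧
    P.IsParallelSection (hP.localSection q) U :=
  ⟨(hP.exists_isParallelSection q).choose, (hP.exists_isParallelSection q).choose_spec.choose_spec⟩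

/-- The tangent vectors at `q` of the parallel section through `q`. -/
noncomputable def hor (q : Q) : Submodule ℝ (TangentSpace 𝓘(ℝ, EQ) q) where
  carrier := {v : EQ | ∃ w : EM,
    (mfderiv 𝓘(ℝ, EM) 𝓘(ℝ, EQ) (hP.localSection q) (π q) w : EQ) = v}
  add_mem' := by
    rintro _ _ ⟨w, rfl⟩ ⟨w', rfl⟩
    exact ⟨w + w', map_add _ w w'⟩
  zero_mem' := ⟨0, map_zero _⟩
  smul_mem' := by
    rintro c _ ⟨w, rfl⟩
    exact ⟨c • w, map_smul _ c w⟩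

omit [TopologicalSpace G] [ChartedSpace EG G] [LieGroup 𝓘(ℝ, EG) ∞ G] [IsManifold 𝓘(ℝ, EQ) ∞ Q] in
theorem mem_hor {q : Q} {v : EQ} : v ∈ hP.hor q ↔ ∃ w : EM,
    (mfderiv 𝓘(ℝ, EM) 𝓘(ℝ, EQ) (hP.localSection q) (π q) w : EQ) = v := Iff.rfl

variable (hπ : IsPrincipalBundle EM EG G EQ π)
include hπ

omit [LieGroup 𝓘(ℝ, EG) ∞ G] [IsManifold 𝓘(ℝ, EQ) ∞ Q] in
theorem mem_hor_iff {s : M → Q} {U : Set M} (hs : P.IsParallelSection s U) {q : Q}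
    (hq : π q ∈ U) (hsq : s (π q) = q) {v : EQ} :
    v ∈ hP.hor q ↔ ∃ w : EM, (mfderiv 𝓘(ℝ, EM) 𝓘(ℝ, EQ) s (π q) w : EQ) = v := by
  obtain ⟨U', hU', hsq', hs'⟩ := hP.exists_localSection q
  have h := hs.eventually_eq_act hπ hs' hq hU'
  rw [hsq, hsq', hπ.div_self] at h
  have h' : hP.localSection q =ᶠ[𝓝 (π q)] s := h.mono fun y hy => hy.trans (act_one _)
  rw [hP.mem_hor]
  refine exists_congr fun w => ?_
  rw [h'.mfderiv_eq]
  rfl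

omit [LieGroup 𝓘(ℝ, EG) ∞ G] [IsManifold 𝓘(ℝ, EQ) ∞ Q] in
theorem mfderiv_proj_localSection (q : Q) (w : EM) :
    (mfderiv 𝓘(ℝ, EQ) 𝓘(ℝ, EM) π q
      (mfderiv 𝓘(ℝ, EM) 𝓘(ℝ, EQ) (hP.localSection q) (π q) w) : EM) = w := by
  obtain ⟨U, hU, hsq, hs⟩ := hP.exists_localSection q
  have h := hπ.mfderiv_proj_section ((hs.contMDiffAt hU).mdifferentiableAt (by simp))
    (eventually_of_mem (hs.isOpen.mem_nhds hU) hs.proj_apply) w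
  rwa [hsq] at h

omit [LieGroup 𝓘(ℝ, EG) ∞ G] [IsManifold 𝓘(ℝ, EQ) ∞ Q] in
theorem isCompl_hor (q : Q) : IsCompl (hP.hor q) (verticalSpace EM EQ π q) := by
  constructor
  · rw [Submodule.disjoint_def]
    rintro v ⟨w, hw⟩ hv
    have h1 := hP.mfderiv_proj_localSection hπ q w
    have h2 : (mfderiv 𝓘(ℝ, EQ) 𝓘(ℝ, EM) π q v : EM) = 0 := LinearMap.mem_ker.1 hv
    have h3 : w = 0 := h1.symm.trans ((congrArg (mfderiv 𝓘(ℝ, EQ) 𝓘(ℝ, EM) π q) hw).trans h2)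
    rw [h3] at hw
    exact hw.symm.trans (map_zero _)
  · rw [Submodule.codisjoint_iff_exists_add_eq]
    intro (v : EQ)
    set w : EM := mfderiv 𝓘(ℝ, EQ) 𝓘(ℝ, EM) π q v with hw
    set v' : EQ := mfderiv 𝓘(ℝ, EM) 𝓘(ℝ, EQ) (hP.localSection q) (π q) w with hv'
    refine ⟨v', v - v', ⟨w, rfl⟩, LinearMap.mem_ker.2 ?_, add_sub_cancel _ _⟩
    exact (map_sub (mfderiv 𝓘(ℝ, EQ) 𝓘(ℝ, EM) π q) v v').trans
      (sub_eq_zero.2 (hP.mfderiv_proj_localSection hπ q w).symm)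

omit [LieGroup 𝓘(ℝ, EG) ∞ G] [IsManifold 𝓘(ℝ, EQ) ∞ Q] in
theorem component_hor_eq {s : M → Q} {U : Set M} (hs : P.IsParallelSection s U) {q : Q}
    (hq : π q ∈ U) (hsq : s (π q) = q) (X : ∀ p : Q, TangentSpace 𝓘(ℝ, EQ) p) :
    (component hP.hor (verticalSpace EM EQ π) (hP.isCompl_hor hπ) X q : EQ) =
      mfderiv 𝓘(ℝ, EM) 𝓘(ℝ, EQ) s (π q) (mfderiv 𝓘(ℝ, EQ) 𝓘(ℝ, EM) π q (X q)) := by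
  set w : EM := mfderiv 𝓘(ℝ, EQ) 𝓘(ℝ, EM) π q (X q) with hw
  set v : EQ := mfderiv 𝓘(ℝ, EM) 𝓘(ℝ, EQ) s (π q) w with hv
  have h1 : v ∈ hP.hor q := (hP.mem_hor_iff hπ hs hq hsq).2 ⟨w, rfl⟩
  have h2 : (mfderiv 𝓘(ℝ, EQ) 𝓘(ℝ, EM) π q v : EM) = w := by
    have h := hπ.mfderiv_proj_section ((hs.contMDiffAt hq).mdifferentiableAt (by simp))
      (eventually_of_mem (hs.isOpen.mem_nhds hq) hs.proj_apply) w
    rwa [hsq] at h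
  refine projectionOnto_eq_of_sub_mem (hP.isCompl_hor hπ q) (x := X q) (v := v) h1
    (LinearMap.mem_ker.2 ?_)
  exact (map_sub (mfderiv 𝓘(ℝ, EQ) 𝓘(ℝ, EM) π q) (X q) v).trans (sub_eq_zero.2 h2.symm)

omit [IsManifold 𝓘(ℝ, EQ) ∞ Q] in
theorem hor_act (q : Q) (g : G) : hP.hor (q <• g) = (hP.hor q).map
    (mfderiv 𝓘(ℝ, EQ) 𝓘(ℝ, EQ) (fun q : Q => q <• g) q).toLinearMap := by
  obtain ⟨U, hU, hsq, hs⟩ := hP.exists_localSection q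
  have hpr : π (q <• g) = π q := hπ.proj_act q g
  have hd : ∀ w : EM,
      (mfderiv 𝓘(ℝ, EM) 𝓘(ℝ, EQ) (fun y => hP.localSection q y <• g) (π q) w : EQ) =
      mfderiv 𝓘(ℝ, EQ) 𝓘(ℝ, EQ) (fun q : Q => q <• g) q
        (mfderiv 𝓘(ℝ, EM) 𝓘(ℝ, EQ) (hP.localSection q) (π q) w) := by
    intro w
    have h := mfderiv_comp_apply (π q) (g := fun q : Q => q <• g)
      (hπ.mdifferentiableAt_act_right g _) ((hs.contMDiffAt hU).mdifferentiableAt (by simp)) w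
    rw [hsq] at h
    exact h
  ext v
  refine (hP.mem_hor_iff hπ (hs.act hπ g) (by rwa [hpr]) (by rw [hpr, hsq])).trans ?_
  rw [hpr, Submodule.mem_map]
  constructor
  · rintro ⟨w, hw⟩
    exact ⟨_, ⟨w, rfl⟩, (hd w).symm.trans hw⟩
  · rintro ⟨_, ⟨w, rfl⟩, hw⟩
    exact ⟨w, (hd w).trans hw⟩

/-- The horizontal part of `X` at `p` is the derivative at `(p, p)` in the direction `(X p, 0)` of
the smooth map `(y, p) ↦ s (π y) <• c p`, where `s` is a parallel section and `p = s (π p) <• c p`;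
indeed `s <• c p` is the parallel section through `p`. -/
theorem smoothFieldOn_component {O : Set Q} {X : ∀ p : Q, TangentSpace 𝓘(ℝ, EQ) p}
    (hX : SmoothFieldOn X O) :
    SmoothFieldOn (component hP.hor (verticalSpace EM EQ π) (hP.isCompl_hor hπ) X) O := by
  have : IsManifold 𝓘(ℝ, EQ) 1 Q := IsManifold.of_le (n := ∞) (by norm_cast)
  have : IsManifold (𝓘(ℝ, EQ).prod 𝓘(ℝ, EQ)) 1 (Q × Q) := inferInstance
  have : IsManifold 𝓘(ℝ, EQ) (∞ + 1) Q := inferInstanceAs (IsManifold 𝓘(ℝ, EQ) ∞ Q)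
  intro p₀ hp₀
  obtain ⟨U, hU, hsq, hs⟩ := hP.exists_localSection p₀
  set s := hP.localSection p₀ with hsdef
  set W : Set Q := π ⁻¹' U with hW
  have hWo : IsOpen W := hs.isOpen.preimage hπ.contMDiff_proj.continuous
  set T : Q × Q → Q := fun z => s (π z.1) <• hπ.div (s (π z.2)) z.2 with hT
  have hTsm : ∀ z ∈ W ×ˢ W, ContMDiffAt (𝓘(ℝ, EQ).prod 𝓘(ℝ, EQ)) 𝓘(ℝ, EQ) ∞ T z := by
    rintro z ⟨hz1, hz2⟩
    have hsπ : ∀ p ∈ W, ContMDiffAt 𝓘(ℝ, EQ) 𝓘(ℝ, EQ) ∞ (fun p => s (π p)) p := fun p hp =>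
      (hs.contMDiffAt hp).comp p (hπ.contMDiff_proj p)
    have hc : ContMDiffAt 𝓘(ℝ, EQ) 𝓘(ℝ, EG) ∞ (fun p => hπ.div (s (π p)) p) z.2 :=
      hπ.contMDiffAt_div (hsπ _ hz2) contMDiffAt_id
        (eventually_of_mem (hWo.mem_nhds hz2) fun p hp => hs.proj_apply _ hp)
    exact hπ.contMDiffAt_act ((hsπ _ hz1).comp z contMDiffAt_fst) (hc.comp z contMDiffAt_snd)
  have hTan := ContMDiffOn.contMDiffOn_tangentMapWithin (m := ∞) (n := ∞)
    (fun z hz => (hTsm z hz).contMDiffWithinAt) (by simp) (hWo.prod hWo).uniqueMDiffOn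
  -- the vector field `(X, 0)` along the diagonal
  have hV : ContMDiffWithinAt 𝓘(ℝ, EQ) (𝓘(ℝ, EQ).prod 𝓘(ℝ, EQ)).tangent ∞
      (fun p => (⟨(p, p), (X p, (0 : EQ))⟩ :
        TangentBundle (𝓘(ℝ, EQ).prod 𝓘(ℝ, EQ)) (Q × Q))) O p₀ := by
    have h1 : ContMDiffWithinAt 𝓘(ℝ, EQ) 𝓘(ℝ, EQ).tangent ∞
        (fun p => (⟨p, (0 : EQ)⟩ : TangentBundle 𝓘(ℝ, EQ) Q)) O p₀ :=
      Bundle.contMDiffWithinAt_zeroSection ℝ (TangentSpace 𝓘(ℝ, EQ) : Q → Type _)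
    exact (contMDiff_equivTangentBundleProd_symm (n := ∞)
      (I := 𝓘(ℝ, EQ)) (I' := 𝓘(ℝ, EQ)) (M := Q) (M' := Q)).contMDiffAt.comp_contMDiffWithinAt p₀
      ((hX p₀ hp₀).prodMk h1)
  have hmem : Bundle.TotalSpace.proj ⁻¹' (W ×ˢ W) ∈ 𝓝 (⟨(p₀, p₀), (X p₀, (0 : EQ))⟩ :
      TangentBundle (𝓘(ℝ, EQ).prod 𝓘(ℝ, EQ)) (Q × Q)) :=
    ((hWo.prod hWo).preimage (FiberBundle.continuous_proj (EQ × EQ)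
      (TangentSpace (𝓘(ℝ, EQ).prod 𝓘(ℝ, EQ)) : Q × Q → Type _))).mem_nhds ⟨hU, hU⟩
  have hcomp := (hTan.contMDiffAt hmem).comp_contMDiffWithinAt p₀ hV
  -- its image under the derivative of `T` is the horizontal part of `X`
  have key : ∀ p ∈ W, (⟨p, component hP.hor (verticalSpace EM EQ π) (hP.isCompl_hor hπ) X p⟩ :
      TangentBundle 𝓘(ℝ, EQ) Q) = tangentMapWithin (𝓘(ℝ, EQ).prod 𝓘(ℝ, EQ)) 𝓘(ℝ, EQ) T (W ×ˢ W)
        ⟨(p, p), (X p, (0 : EQ))⟩ := by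
    intro p hp
    have hpp : s (π p) <• hπ.div (s (π p)) p = p := hπ.act_div (hs.proj_apply _ hp)
    have h1 := hP.component_hor_eq hπ (hs.act hπ (hπ.div (s (π p)) p)) hp hpp X
    have hsd := ((hs.act hπ (hπ.div (s (π p)) p)).contMDiffAt hp).mdifferentiableAt
      (show (∞ : WithTop ℕ∞) ≠ 0 by simp)
    have h2 := mfderiv_comp_apply p hsd (hπ.mdifferentiableAt_proj p) (X p)
    have hTd := (hTsm (p, p) ⟨hp, hp⟩).mdifferentiableAt (show (∞ : WithTop ℕ∞) ≠ 0 by simp)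
    have h3 := DFunLike.congr_fun (hTd.hasMFDerivAt.comp p (f := fun p' => (p', p))
      ((hasMFDerivAt_id p).prodMk (hasMFDerivAt_const p p))).mfderiv (X p)
    have h4 : mfderivWithin (𝓘(ℝ, EQ).prod 𝓘(ℝ, EQ)) 𝓘(ℝ, EQ) T (W ×ˢ W) (p, p) =
        mfderiv (𝓘(ℝ, EQ).prod 𝓘(ℝ, EQ)) 𝓘(ℝ, EQ) T (p, p) :=
      mfderivWithin_of_isOpen (hWo.prod hWo) ⟨hp, hp⟩
    refine Bundle.TotalSpace.ext hpp.symm (heq_of_eq ?_)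
    refine h1.trans (h2.symm.trans ?_)
    refine Eq.trans ?_ (DFunLike.congr_fun h4 (X p, (0 : EQ))).symm
    exact h3
  refine hcomp.congr_of_eventuallyEq ?_ (key p₀ hU)
  exact eventually_of_mem (mem_nhdsWithin_of_mem_nhds (hWo.mem_nhds hU)) key

/-- The connection of a homotopy-invariant parallel transport: its horizontal spaces are the tangent
spaces of the parallel sections. -/
noncomputable def connection : Connection EM G EQ π where
  hor := hP.hor
  isCompl := hP.isCompl_hor hπ
  invariant := hP.hor_act hπ
  smooth _ _ _ hX := hP.smoothFieldOn_component hπ hX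

theorem isFlatSection {s : M → Q} {U : Set M} (hs : P.IsParallelSection s U) :
    (hP.connection hπ).IsFlatSection s U where
  isOpen := hs.isOpen
  contMDiffOn := hs.contMDiffOn
  proj_apply := hs.proj_apply
  mfderiv_mem y hy w := by
    have h := hs.proj_apply y hy
    refine (hP.mem_hor_iff hπ hs (by rwa [h]) (by rw [h])).2 ⟨w, ?_⟩
    rw [h]

theorem hasFlatSections_connection : (hP.connection hπ).HasFlatSections := fun q =>
  let ⟨U, hU, hsq, hs⟩ := hP.exists_localSection q
  ⟨U, hP.localSection q, hU, hsq, hP.isFlatSection hπ hs⟩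

end HomotopyInvariant

end ParallelTransport

end TransportConnection

/-! ### Transport of this connection, and its uniqueness -/

section TransportOfConnection

open scoped Topology
open Filter

variable
    {EM : Type*} [NormedAddCommGroup EM] [NormedSpace ℝ EM]
    {M : Type*} [TopologicalSpace M] [ChartedSpace EM M]
    {EG : Type*} [NormedAddCommGroup EG] [NormedSpace ℝ EG]
    {G : Type*} [Group G] [TopologicalSpace G] [ChartedSpace EG G]
    {EQ : Type*} [NormedAddCommGroup EQ] [NormedSpace ℝ EQ]
    {Q : Type*} [TopologicalSpace Q] [ChartedSpace EQ Q]
    [MulAction Gᵐᵒᵖ Q] {π : Q → M}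

namespace ParallelTransport

omit [TopologicalSpace G] [ChartedSpace EG G] in
/-- Transporting `q` along the initial pieces of a path `γ` gives a curve in `Q` over `γ` whose
values are related by transport along the pieces of `γ`. -/
theorem exists_curve (P : ParallelTransport EM G EQ π) (γ : PSPath EM M) {q : Q}
    (hq : π q = γ.start) : ∃ D : ℝ → Q, D γ.a = q ∧ D γ.b = P.toFun γ ⟨q, hq⟩ ∧
      (∀ t ∈ Icc γ.a γ.b, π (D t) = γ t) ∧
      ∀ (c d : ℝ) (hc : γ.a ≤ c) (hcd : c < d) (hd : d ≤ γ.b)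
        (h : π (D c) = (γ.restrict hc hcd hd).start),
        (P.toFun (γ.restrict hc hcd hd) ⟨D c, h⟩ : Q) = D d := by
  classical
  have hq' : ∀ t (ht : γ.a < t ∧ t ≤ γ.b), π q = (γ.restrict le_rfl ht.1 ht.2).start :=
    fun t ht => by rw [PSPath.start_restrict]; exact hq
  set D : ℝ → Q := fun t => if ht : γ.a < t ∧ t ≤ γ.b then
    (P.toFun (γ.restrict le_rfl ht.1 ht.2) ⟨q, hq' t ht⟩ : Q) else q with hD
  have hDa : D γ.a = q := dif_neg fun h => lt_irrefl _ h.1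
  have hDt : ∀ t (h1 : γ.a < t) (h2 : t ≤ γ.b),
      D t = P.toFun (γ.restrict le_rfl h1 h2) ⟨q, hq' t ⟨h1, h2⟩⟩ := fun t h1 h2 =>
    dif_pos ⟨h1, h2⟩
  have hcongr : ∀ (γ' : PSPath EM M) (p p' : Q) (h : p = p') (hp : π p = γ'.start)
      (hp' : π p' = γ'.start), (P.toFun γ' ⟨p, hp⟩ : Q) = P.toFun γ' ⟨p', hp'⟩ := by
    rintro γ' p _ rfl _ _
    rfl
  refine ⟨D, hDa, ?_, fun t ht => ?_, fun c d hc hcd hd h => ?_⟩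
  · rw [hDt _ γ.lt le_rfl]
    refine P.reparametrization (γ.restrict le_rfl γ.lt le_rfl) γ ⟨id, id, mapsTo_id _,
      mapsTo_id _, ⟨fun _ _ => rfl, fun _ _ => rfl⟩, contDiffOn_id, contDiffOn_id,
      strictMono_id.strictMonoOn _,
      fun t ht => γ.restrict_apply _ _ _ ht⟩ q _ _
  · rcases ht.1.eq_or_lt with rfl | h1
    · rw [hDa]; exact hq
    · rw [hDt t h1 ht.2]
      exact (P.toFun (γ.restrict le_rfl h1 ht.2) ⟨q, _⟩).2.trans (γ.finish_restrict _ _ _)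
  · rcases hc.eq_or_lt with rfl | h1
    · rw [hDt d hcd hd]
      exact hcongr _ _ _ hDa _ _
    · rw [hDt d (h1.trans hcd) hd]
      have hDc := hDt c h1 (hcd.le.trans hd)
      have h' := h
      rw [hDc] at h'
      refine (hcongr _ _ _ hDc h h').trans ?_
      exact (P.juxtaposition _ _ _ (γ.isJuxtaposition_restrict le_rfl h1 hcd hd) q _ _ h').symm

variable {P : ParallelTransport EM G EQ π}

/-- Over the domain of a parallel section `s`, the curve obtained by transporting a point along `γ`
is a translate of `s ∘ γ`. -/
theorem IsParallelSection.eventually_curve_eq [FiniteDimensional ℝ EM] [IsManifold 𝓘(ℝ, EM) ∞ M]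
    (hπ : IsPrincipalBundle EM EG G EQ π) {s : M → Q}
    {U : Set M} (hs : P.IsParallelSection s U) (γ : PSPath EM M) {D : ℝ → Q}
    (hD : ∀ t ∈ Icc γ.a γ.b, π (D t) = γ t)
    (hstep : ∀ (c d : ℝ) (hc : γ.a ≤ c) (hcd : c < d) (hd : d ≤ γ.b)
      (h : π (D c) = (γ.restrict hc hcd hd).start),
      (P.toFun (γ.restrict hc hcd hd) ⟨D c, h⟩ : Q) = D d)
    {t₀ : ℝ} (ht₀ : t₀ ∈ Icc γ.a γ.b) (hU : γ t₀ ∈ U) :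
    ∀ᶠ t in 𝓝 t₀, γ t ∈ U ∧ (t ∈ Icc γ.a γ.b →
      D t = s (γ t) <• hπ.div (s (γ t₀)) (D t₀)) := by
  obtain ⟨ε, hε, hball⟩ := Metric.mem_nhds_iff.1
    (γ.continuous.continuousAt.preimage_mem_nhds (hs.isOpen.mem_nhds hU))
  have hconv : ∀ {c d t : ℝ}, c ∈ Metric.ball t₀ ε → d ∈ Metric.ball t₀ ε → t ∈ Icc c d →
      γ t ∈ U := fun hc hd ht => hball ((convex_ball t₀ ε).ordConnected.out hc hd ht)
  have key : ∀ c d, c ∈ Metric.ball t₀ ε → d ∈ Metric.ball t₀ ε → γ.a ≤ c → c < d → d ≤ γ.b →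
      D d = s (γ d) <• hπ.div (s (γ c)) (D c) := by
    intro c d hc hd h1 h2 h3
    have h4 : π (D c) = (γ.restrict h1 h2 h3).start := by
      rw [PSPath.start_restrict, hD c ⟨h1, h2.le.trans h3⟩]
    rw [← hstep c d h1 h2 h3 h4, hs.transport_act hπ _ (fun t ht => ?_) h4,
      PSPath.start_restrict, PSPath.finish_restrict]
    rw [γ.restrict_apply h1 h2 h3 ht]
    exact hconv hc hd ht
  have ht₀' := Metric.mem_ball_self (x := t₀) hε
  filter_upwards [Metric.ball_mem_nhds t₀ hε] with t ht
  refine ⟨hball ht, fun htI => ?_⟩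
  have hp : ∀ t ∈ Metric.ball t₀ ε, t ∈ Icc γ.a γ.b → π (s (γ t)) = π (D t) := fun t ht htI => by
    rw [hs.proj_apply _ (hball ht), hD t htI]
  rcases lt_trichotomy t₀ t with h | rfl | h
  · exact key t₀ t ht₀' ht ht₀.1 h htI.2
  · exact (hπ.act_div (hp _ ht htI)).symm
  · rw [key t t₀ ht ht₀' htI.1 h ht₀.2, hπ.div_act, hπ.act_div (hp t ht htI)]

variable [FiniteDimensional ℝ EM] [IsManifold 𝓘(ℝ, EM) ∞ M] [LieGroup 𝓘(ℝ, EG) ∞ G]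
  [IsManifold 𝓘(ℝ, EQ) ∞ Q]

/-- The curve obtained by transporting a point along `γ` is a horizontal lift of `γ`, because it
is locally a parallel section composed with `γ`. -/
theorem HomotopyInvariant.hasParallelTransport_connection (hP : P.HomotopyInvariant)
    (hπ : IsPrincipalBundle EM EG G EQ π) : (hP.connection hπ).HasParallelTransport P := by
  rintro γ ⟨q, hq⟩
  obtain ⟨D, hDa, hDb, hD, hstep⟩ := P.exists_curve γ hq
  -- locally `D` is a translate of a parallel section
  have hloc : ∀ t₀ ∈ Icc γ.a γ.b, ∃ (s : M → Q) (U : Set M), P.IsParallelSection s U ∧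
      γ t₀ ∈ U ∧ ∀ᶠ t in 𝓝 t₀, t ∈ Icc γ.a γ.b → D t = s (γ t) := by
    intro t₀ ht₀
    obtain ⟨U, hU, hsq, hs⟩ := hP.exists_localSection (D t₀)
    rw [hD t₀ ht₀] at hU hsq
    refine ⟨_, U, hs, hU, ?_⟩
    filter_upwards [hs.eventually_curve_eq hπ γ hD hstep ht₀ hU] with t ht htI
    rw [ht.2 htI, hsq, hπ.div_self, act_one]
  obtain ⟨F, hF⟩ := γ.piecewise_smooth
  have hsm : ∀ c d : ℝ, γ.a ≤ c → c < d → d ≤ γ.b → Disjoint (F : Set ℝ) (Ioo c d) →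
      ContMDiffOn 𝓘(ℝ, ℝ) 𝓘(ℝ, EQ) ∞ D (Icc c d) := by
    intro c d h1 h2 h3 h4 t₀ ht₀
    have hsub : ∀ t ∈ Icc c d, t ∈ Icc γ.a γ.b := fun t ht => ⟨h1.trans ht.1, ht.2.trans h3⟩
    obtain ⟨s, U, hs, hU, hev⟩ := hloc t₀ (hsub t₀ ht₀)
    refine ContMDiffWithinAt.congr_of_eventuallyEq (f := fun t => s (γ t)) ?_ ?_
      (hev.self_of_nhds (hsub t₀ ht₀))
    · exact (hs.contMDiffAt hU).comp_contMDiffWithinAt t₀ (hF c d h1 h2 h3 h4 t₀ ht₀)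
    · filter_upwards [mem_nhdsWithin_of_mem_nhds hev, self_mem_nhdsWithin] with t ht htI
      exact ht (hsub t htI)
  refine ⟨PSPath.ofPieces D γ.lt ⟨F, hsm⟩, ⟨rfl, rfl, fun t ht => ?_, fun t ht hd => ?_⟩, ?_, ?_⟩
  · rw [PSPath.ofPieces_apply _ _ ht, hD t ht]
  · set δ := PSPath.ofPieces D γ.lt ⟨F, hsm⟩ with hδ
    have htI := Ioo_subset_Icc_self ht
    obtain ⟨s, U, hs, hU, hev⟩ := hloc t htI
    have hI : ∀ᶠ r in 𝓝 t, r ∈ Icc γ.a γ.b := Icc_mem_nhds ht.1 ht.2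
    have hγ : (γ : ℝ → M) =ᶠ[𝓝 t] fun r => π (δ r) := by
      filter_upwards [hI] with r hr
      rw [hδ, PSPath.ofPieces_apply _ _ hr, hD r hr]
    have hδs : s ∘ γ =ᶠ[𝓝 t] δ := by
      filter_upwards [hI, hev] with r hr hr'
      rw [hδ, PSPath.ofPieces_apply _ _ hr, hr' hr, Function.comp]
    have hγd : MDifferentiableAt 𝓘(ℝ, ℝ) 𝓘(ℝ, EM) γ t :=
      ((hπ.mdifferentiableAt_proj (δ t)).comp t hd).congr_of_eventuallyEq hγ
    have h1 := ((hP.isFlatSection hπ hs).mfderiv_comp_mem_hor hγd hU).2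
    rw [hδs.mfderiv_eq] at h1
    have h2 : s (γ t) = δ t := hδs.self_of_nhds
    exact h2 ▸ h1
  · exact (PSPath.ofPieces_apply _ _ (left_mem_Icc.2 γ.lt.le)).trans hDa
  · exact (PSPath.ofPieces_apply _ _ (right_mem_Icc.2 γ.lt.le)).trans hDb

/-- Parallel sections are horizontal for every connection with transport `P`, since lifts of curves
are unique. -/
theorem IsParallelSection.mfderiv_mem_hor [CompleteSpace EG]
    (hπ : IsPrincipalBundle EM EG G EQ π) {H : Connection EM G EQ π}
    (hH : H.HasParallelTransport P) {s : M → Q} {U : Set M} (hs : P.IsParallelSection s U) {x : M}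
    (hx : x ∈ U) (w : EM) : (mfderiv 𝓘(ℝ, EM) 𝓘(ℝ, EQ) s x w : EQ) ∈ H.hor (s x) := by
  obtain ⟨θ, κ, W, hθ, hWU, hxW, hθ0⟩ := exists_isParametrization (toEuclidean (E := EM)) x
    (hs.isOpen.mem_nhds hx)
  -- a curve through `x` with velocity `w`
  set u : EuclideanSpace ℝ (Fin (Module.finrank ℝ EM)) :=
    mfderiv 𝓘(ℝ, EM) 𝓘(ℝ, EuclideanSpace ℝ (Fin (Module.finrank ℝ EM))) κ x w with hu
  set c : ℝ → M := fun t => θ (t • u) with hc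
  have hcsm : ContMDiff 𝓘(ℝ, ℝ) 𝓘(ℝ, EM) ∞ c :=
    hθ.contMDiff.comp (contDiff_id.smul contDiff_const).contMDiff
  have hcU : ∀ t, c t ∈ U := fun t => hWU (hθ.mem _)
  have hc0 : c 0 = x := by rw [hc]; simp only [zero_smul, hθ0]
  have hκ0 : κ x = 0 := by rw [← hθ0, hθ.left_inv]
  have hc' : (mfderiv 𝓘(ℝ, ℝ) 𝓘(ℝ, EM) c 0 (1 : ℝ) : EM) = w := by
    have hlin : HasMFDerivAt 𝓘(ℝ, ℝ) 𝓘(ℝ, EuclideanSpace ℝ (Fin (Module.finrank ℝ EM)))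
        (fun t : ℝ => t • u) 0 ((ContinuousLinearMap.id ℝ ℝ).smulRight u) :=
      ((ContinuousLinearMap.id ℝ ℝ).smulRight u).hasFDerivAt.hasMFDerivAt
    have hθd : ∀ z, MDifferentiableAt 𝓘(ℝ, EuclideanSpace ℝ (Fin (Module.finrank ℝ EM)))
        𝓘(ℝ, EM) θ z := fun z => (hθ.contMDiff z).mdifferentiableAt (by simp)
    have h1 := (hθd ((0 : ℝ) • u)).hasMFDerivAt.comp (0 : ℝ) hlin
    have h2 := DFunLike.congr_fun h1.mfderiv (1 : ℝ)
    have hκd := (hθ.contMDiffOn.contMDiffAt (hθ.isOpen.mem_nhds hxW)).mdifferentiableAt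
      (show (∞ : WithTop ℕ∞) ≠ 0 by simp)
    have h3 := (hθd (κ x)).hasMFDerivAt.comp x hκd.hasMFDerivAt
    have h4 : HasMFDerivAt 𝓘(ℝ, EM) 𝓘(ℝ, EM) (θ ∘ κ) x
        (ContinuousLinearMap.id ℝ (TangentSpace 𝓘(ℝ, EM) x)) :=
      (hasMFDerivAt_id x).congr_of_eventuallyEq
        (eventually_of_mem (hθ.isOpen.mem_nhds hxW) fun y hy => hθ.right_inv y hy)
    have h5 := DFunLike.congr_fun (hasMFDerivAt_unique h3 h4) w
    have h6 : κ x = (0 : ℝ) • u := by rw [hκ0, zero_smul]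
    rw [h6] at h5
    refine h2.trans (Eq.trans ?_ h5)
    exact congrArg _ (one_smul ℝ u)
  set γ : PSPath EM M := PSPath.ofSmooth c (show (-1 : ℝ) < 1 by norm_num) hcsm with hγ
  have hγc : ∀ t ∈ Icc (-1 : ℝ) 1, γ t = c t := fun t ht => PSPath.ofSmooth_apply _ _ ht
  have hγU : ∀ t ∈ Icc (-1 : ℝ) 1, γ t ∈ U := fun t ht => hγc t ht ▸ hcU t
  have hl : (-1 : ℝ) ∈ Icc (-1 : ℝ) 1 := by norm_num
  have hstart : π (s γ.start) = γ.start := hs.proj_apply _ (hγU _ hl)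
  -- its horizontal lift `δ` coincides with `s ∘ c`
  obtain ⟨δ, hδ, hδs, -⟩ := hH γ ⟨s γ.start, hstart⟩
  obtain ⟨ha, hb, hp, hd⟩ := id hδ
  replace ha : δ.a = -1 := ha
  replace hb : δ.b = 1 := hb
  have hδc : ∀ t ∈ Ioo (-1 : ℝ) 1, δ t = s (c t) := by
    intro t ht
    set γt := γ.restrict le_rfl ht.1 ht.2.le with hγt
    have hγt_apply : ∀ r ∈ Icc (-1) t, γt r = γ r := fun r hr => γ.restrict_apply _ _ _ hr
    have hst : γt.start = γ.start := γ.start_restrict _ _ _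
    have hst' : π (s γt.start) = γt.start := hst.symm ▸ hstart
    obtain ⟨δ', hδ', hδ's, hδ'f⟩ := hH γt ⟨s γt.start, hst'⟩
    have htr := hs.transport γt (fun r hr => by
      replace hr : r ∈ Icc (-1) t := hr
      rw [hγt_apply r hr]
      exact hγU r ⟨hr.1, hr.2.trans ht.2.le⟩) hst'
    have hft : γt.finish = c t :=
      (γ.finish_restrict _ _ _).trans (hγc t (Ioo_subset_Icc_self ht))
    set δr := δ.restrict ha.le ht.1 (ht.2.le.trans hb.ge) with hδr
    have hδrt : ∀ r ∈ Icc (-1) t, δr r = δ r := fun r hr => δ.restrict_apply _ _ _ hr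
    have hlift : H.IsHorizontalLift γt δr := by
      refine ⟨rfl, rfl, fun r hr => ?_, fun r hr hdr => ?_⟩
      · replace hr : r ∈ Icc (-1) t := hr
        rw [hδrt r hr, hγt_apply r hr]
        exact hp r ⟨hr.1, hr.2.trans ht.2.le⟩
      · replace hr : r ∈ Ioo (-1) t := hr
        have hev : (δ : ℝ → Q) =ᶠ[𝓝 r] δr := by
          filter_upwards [Icc_mem_nhds hr.1 hr.2] with r' hr'
          exact (hδrt r' hr').symm
        have h1 := hd r ⟨hr.1, hr.2.trans ht.2⟩ (hdr.congr_of_eventuallyEq hev)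
        rw [hev.mfderiv_eq] at h1
        have h2 : δ r = δr r := hev.self_of_nhds
        exact h2 ▸ h1
    have hδrs : δr.start = s γ.start := by
      have h1 : δr.start = δ (-1) := hδrt (-1) (left_mem_Icc.2 ht.1.le)
      rw [h1, ← ha]
      exact hδs
    have heq := hδ'.eqOn hπ hlift (hδ's.trans ((congrArg s hst).trans hδrs.symm))
      (right_mem_Icc.2 γt.lt.le)
    have h1 : δ' γt.b = s γt.finish := by
      rw [← hδ'.2.1]
      exact hδ'f.trans htr
    rw [← hδrt t (right_mem_Icc.2 ht.1.le), ← hft, ← h1]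
    exact heq.symm
  have h0 : (0 : ℝ) ∈ Ioo (-1 : ℝ) 1 := by norm_num
  have hev : (δ : ℝ → Q) =ᶠ[𝓝 0] s ∘ c := by
    filter_upwards [Ioo_mem_nhds h0.1 h0.2] with t ht using hδc t ht
  have hcd : MDifferentiableAt 𝓘(ℝ, ℝ) 𝓘(ℝ, EM) c 0 := (hcsm 0).mdifferentiableAt (by simp)
  have hsd : MDifferentiableAt 𝓘(ℝ, EM) 𝓘(ℝ, EQ) s (c 0) :=
    (hs.contMDiffAt (hcU 0)).mdifferentiableAt (by simp)
  have h1 := hd 0 h0 ((hsd.comp (0 : ℝ) hcd).congr_of_eventuallyEq hev)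
  rw [hev.mfderiv_eq] at h1
  have h2 : δ 0 = s (c 0) := hδc 0 h0
  have h3 := mfderiv_comp_apply (0 : ℝ) hsd hcd (1 : ℝ)
  have h4 := congrArg (mfderiv 𝓘(ℝ, EM) 𝓘(ℝ, EQ) s (c 0)) hc'
  have h5 : (mfderiv 𝓘(ℝ, EM) 𝓘(ℝ, EQ) s (c 0) w : EQ) ∈ H.hor (s (c 0)) :=
    Set.mem_of_eq_of_mem (h3.trans h4).symm (h2 ▸ h1)
  rwa [hc0] at h5

/-- A homotopy-invariant parallel transport belongs to only one connection. -/
theorem HomotopyInvariant.eq_connection [CompleteSpace EG] (hP : P.HomotopyInvariant)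
    (hπ : IsPrincipalBundle EM EG G EQ π) {H : Connection EM G EQ π}
    (hH : H.HasParallelTransport P) : H = hP.connection hπ := by
  have hle : ∀ q, ∀ v : EQ, v ∈ hP.hor q → v ∈ H.hor q := by
    rintro q _ ⟨w, rfl⟩
    obtain ⟨U, hU, hsq, hs⟩ := hP.exists_localSection q
    have h := hs.mfderiv_mem_hor hπ hH hU w
    rwa [hsq] at h
  refine Connection.ext (funext fun q => Submodule.ext fun v => ⟨fun hv => ?_, hle q v⟩)
  -- the lift `v'` of the projection of `v` is horizontal for both connections
  obtain ⟨v', b, hv', hb, hvb⟩ :=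
    Submodule.codisjoint_iff_exists_add_eq.1 (hP.isCompl_hor hπ q).codisjoint v
  have h1 : b ∈ H.hor q := by
    rw [eq_sub_of_add_eq' hvb]
    exact (H.hor q).sub_mem hv (hle q v' hv')
  have h2 : b = 0 := H.eq_zero_of_mem_hor h1 (LinearMap.mem_ker.1 hb)
  rw [h2, add_zero] at hvb
  exact hvb ▸ hv'

end ParallelTransport

end TransportOfConnection

end PrincipalTransport

open PrincipalTransport in
theorem mainTheorem2
    {EM : Type*} [NormedAddCommGroup EM] [NormedSpace ℝ EM] [FiniteDimensional ℝ EM]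
    {M : Type*} [TopologicalSpace M] [T2Space M] [ChartedSpace EM M]
    [IsManifold 𝓘(ℝ, EM) ∞ M]
    {EG : Type*} [NormedAddCommGroup EG] [NormedSpace ℝ EG] [FiniteDimensional ℝ EG]
    {G : Type*} [Group G] [TopologicalSpace G] [ChartedSpace EG G] [LieGroup 𝓘(ℝ, EG) ∞ G]
    {EQ : Type*} [NormedAddCommGroup EQ] [NormedSpace ℝ EQ] [FiniteDimensional ℝ EQ]
    {Q : Type*} [TopologicalSpace Q] [T2Space Q] [ChartedSpace EQ Q]
    [IsManifold 𝓘(ℝ, EQ) ∞ Q] [MulAction Gᵐᵒᵖ Q]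
    (π : Q → M) (hπ : IsPrincipalBundle EM EG G EQ π) :
    ∃ Φ : {H : Connection EM G EQ π // H.IsFlat} ≃
        {P : ParallelTransport EM G EQ π // P.HomotopyInvariant},
      (∀ (H : {H : Connection EM G EQ π // H.IsFlat}) (P : ParallelTransport EM G EQ π),
        H.1.HasParallelTransport P ↔ P = (Φ H).1) ∧
      (∀ (P : {P : ParallelTransport EM G EQ π // P.HomotopyInvariant})
        (H : Connection EM G EQ π),
        H.HasParallelTransport P.1 ↔ H = (Φ.symm P).1) := by
  have : CompleteSpace EG := FiniteDimensional.complete ℝ EG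
  refine ⟨{
    toFun := fun H => ⟨(H.2.hasFlatSections hπ).parallelTransport hπ,
      (H.2.hasFlatSections hπ).homotopyInvariant_parallelTransport hπ⟩
    invFun := fun P => ⟨P.2.connection hπ, (P.2.hasFlatSections_connection hπ).isFlat hπ⟩
    left_inv := fun H => Subtype.ext ?_
    right_inv := fun P => Subtype.ext ?_ },
    fun H P => ⟨fun h => ?_, ?_⟩, fun P H => ⟨fun h => ?_, ?_⟩⟩
  · exact (ParallelTransport.HomotopyInvariant.eq_connection _ hπ
      ((H.2.hasFlatSections hπ).hasParallelTransport hπ)).symm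
  · exact Connection.HasParallelTransport.unique hπ
      (Connection.HasFlatSections.hasParallelTransport _ hπ)
      (P.2.hasParallelTransport_connection hπ)
  · exact h.unique hπ ((H.2.hasFlatSections hπ).hasParallelTransport hπ)
  · rintro rfl
    exact (H.2.hasFlatSections hπ).hasParallelTransport hπ
  · exact P.2.eq_connection hπ h
  · rintro rfl
    exact P.2.hasParallelTransport_connection hπ
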